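/- Let $d\ge 1$, let $\mathcal M$ be the set of finite signed Borel measures on $\mathbb R^d$, and $\mathcal M_a\subset\mathcal M$ the set of those that are absolutely continuous with respect to Lebesgue measure; write $p_\mu$ for the density of $\mu\in\mathcal M_a$. **Young functions.** $\mathcal E$ is the set of functions $e:\mathbb R\to[0,\infty)$ that are symmetric and strictly convex, with $e(0)=0$, $e(2s)\le\lambda e(s)$ for some $\lambda>0$ and all $s$, and $s\mapsto e(s)/s$ non-decreasing. For $e\in\mathcal E$ put $e^{-1}(a)=\sup\{c: e(c)\le a\}$, $\beta_e(R)=R/e^{-1}(R)$, and $\|f\|_{(e)}=\inf\{c>0:\int e(f(x)/c)\,dx\le 1\}$. For $\alpha,\gamma\ge 0$, $\mathcal E_{\alpha,\gamma}$ is the set of $e\in\mathcal E$ with $$0<\liminf_{R\to\infty}\frac{\beta_e(R)}{R^\alpha(\ln R)^\gamma}\le\limsup_{R\to\infty}\frac{\beta_e(R)}{R^\alpha(\ln R)^\gamma}<\infty .$$ **Spaces.** For $k,l\in\mathbb N=\{0,1,\dots\}$, with weak derivatives $\partial_\alpha$ and multi-indices $\alpha,\gamma$, put $$\|f\|_{k,(e)}=\sum_{|\alpha|\le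 k}\|\partial_\alpha f\|_{(e)},\qquad \|f\|_{k,l,(e)}=\sum_{|\gamma|\le l}\sum_{|\alpha|\le k}\|x^\gamma\partial_\alpha f\|_{(e)},$$ and let $W^{k,e}$, $W^{k,l,e}$ be the sets of functions for which the weak derivatives up to order $k$ exist and the respective norm is finite. A measure is said to lie in a space of functions if it is absolutely continuous with density in that space. **Distances.** For $\mu,\nu\in\mathcal M$, $d_k(\mu,\nu)=\sup\{|\int\phi\,d\mu-\int\phi\,d\nu| : \phi\in C^\infty(\mathbb R^d),\ \sum_{|\alpha|\le k}\|\partial_\alpha\phi\|_\infty\le1\}$, and $d_k(\mu,M)=\inf_{\nu\in M}d_k(\mu,\nu)$ for $M\subset\mathcal M$. Let $q,k\in\mathbb N$, $m\ge1$ an integer, and $e\in\mathcal E$. Let $\mathcal S_{q,k,m,e}$ be the set of $\mu\in\mathcal M$ for which there is a sequence $\mu_n\in\mathcal M_a$ $(n\ge0)$ with $$\sum_{n=0}^\infty 2^{n(q+k)}\beta_e(2^{nd})\,d_k(\mu,\mu_n)+\sum_{n=0}^\infty 2^{-2nm}\|p_{\mu_n}\|_{2m+q,2m,(e)}<\infty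 .$$ Let $M_{m,q,e}(R)=\{\mu\in\mathcal M_a:\|p_\mu\|_{2m+q,2m,(e)}\le R\}$ and $L_a(R)=R(\ln R)^a$, and let $B_q(k,m,e)$ be the set of $\mu\in\mathcal M$ satisfying the balance hypothesis $H_q(k,m,e)$: there is $a>1$ with $$\limsup_{R\to\infty}\frac{L_a(R)^{1+\frac{k+q}{2m}}\,\beta_e\big(L_a(R)^{\frac d{2m}}\big)}{R}\,d_k\big(\mu,M_{m,q,e}(R)\big)<\infty .$$ **Theorem.** (i) For all $q,k\in\mathbb N$, $m\ge1$ and $e\in\mathcal E$, $$B_q(k,m,e)\subset\mathcal S_{q,k,m,e}\subset W^{q,e}.$$ In particular, every $\mu\in B_q(k,m,e)$ is absolutely continuous with density in $W^{q,e}$. (ii) If moreover $e\in\mathcal E_{\alpha,\gamma}$ with $0\le\alpha<\frac{2m+k+q}{d(2m-1)}$ and $\gamma\ge0$, and if $m>d/2$, then also $$W^{q+1,2m,e}\subset B_q(k,m,e),$$ that is, every $f\in W^{q+1,2m,e}$ is Lebesgue integrable and the measure $f(x)\,dx$ belongs to $B_q(k,m,e)$. -/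

import Mathlib

open MeasureTheory Filter Topology
open scoped ENNReal ContDiff

noncomputable section

namespace OrliczBalance

/-- `ℝ^d` with its Euclidean norm and Lebesgue measure `volume`. -/
abbrev Eucl (d : ℕ) : Type := EuclideanSpace ℝ (Fin d)

/-! ### Young functions -/

/-- The class `𝓔`: symmetric, strictly convex, nonnegative functions vanishing at `0`, which are
doubling and for which `s ↦ e s / s` is nondecreasing (where it is defined, i.e. for `s ≠ 0`). -/
structure IsYoung (e : ℝ → ℝ) : Prop where
  symm : ∀ s, e (-s) = e s
  strictConvex : StrictConvexOn ℝ Set.univ e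
  nonneg : ∀ s, 0 ≤ e s
  zero : e 0 = 0
  doubling : ∃ l : ℝ, 0 < l ∧ ∀ s, e (2 * s) ≤ l * e s
  monotone_div : MonotoneOn (fun s => e s / s) {0}ᶜ

/-- `e⁻¹(a) = sup {c : e c ≤ a}`. -/
def youngInv (e : ℝ → ℝ) (a : ℝ) : ℝ := sSup {c : ℝ | e c ≤ a}

/-- `β_e(R) = R / e⁻¹(R)`. -/
def betaFn (e : ℝ → ℝ) (R : ℝ) : ℝ := R / youngInv e R

/-- The class `𝓔_{α,γ}`: Young functions in `𝓔` for which `β_e(R)` is of the exact order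
`R ^ α * (log R) ^ γ` as `R → ∞`. -/
structure IsYoungOfOrder (α γ : ℝ) (e : ℝ → ℝ) : Prop where
  isYoung : IsYoung e
  liminf_pos :
    0 < liminf (fun R : ℝ => ENNReal.ofReal (betaFn e R / (R ^ α * Real.log R ^ γ))) atTop
  limsup_lt_top :
    limsup (fun R : ℝ => ENNReal.ofReal (betaFn e R / (R ^ α * Real.log R ^ γ))) atTop < ⊤

/-- The Luxemburg norm `inf {c > 0 : ∫ e(f/c) ≤ 1}`, with value `⊤` if there is no such `c`. -/
def luxNorm {d : ℕ} (e : ℝ → ℝ) (f : Eucl d → ℝ) : ℝ≥0∞ :=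
  ⨅ (c : ℝ) (_ : 0 < c) (_ : ∫⁻ x, ENNReal.ofReal (e (1 / c * f x)) ≤ 1), ENNReal.ofReal c

/-! ### Multi-indices and derivatives -/

/-- The finite set of multi-indices `α ∈ ℕ^d` with `|α| = ∑ i, α i ≤ k`. -/
def multiIdx (d k : ℕ) : Finset (Fin d → ℕ) :=
  (Fintype.piFinset fun _ => Finset.range (k + 1)).filter fun α => ∑ i, α i ≤ k

theorem mem_multiIdx {d k : ℕ} {α : Fin d → ℕ} : α ∈ multiIdx d k ↔ ∑ i, α i ≤ k := by
  simp only [multiIdx, Finset.mem_filter, Fintype.mem_piFinset, Finset.mem_range,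
    and_iff_right_iff_imp]
  intro h i
  exact Nat.lt_succ_of_le ((Finset.single_le_sum (fun j _ => Nat.zero_le (α j))
    (Finset.mem_univ i)).trans h)

/-- The monomial `x^γ = ∏ i, x_i ^ γ_i`. -/
def monom {d : ℕ} (γ : Fin d → ℕ) (x : Eucl d) : ℝ := ∏ i, x i ^ γ i

/-- The classical partial derivative in the `i`-th coordinate. -/
def pderiv {d : ℕ} (i : Fin d) (f : Eucl d → ℝ) : Eucl d → ℝ :=
  fun x => fderiv ℝ f x (EuclideanSpace.single i 1)

/-- The classical derivative `∂_α = ∂_1^{α_1} ⋯ ∂_d^{α_d}` (used for smooth functions only). -/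
def mderiv {d : ℕ} (α : Fin d → ℕ) (f : Eucl d → ℝ) : Eucl d → ℝ :=
  (List.finRange d).foldr (fun i g => (pderiv i)^[α i] g) f

/-- `g` is the weak derivative `∂_α f`: both are locally integrable and
`∫ f ∂_α φ = (-1)^{|α|} ∫ g φ` for all test functions `φ ∈ C_c^∞(ℝ^d)`. -/
def IsWeakDeriv {d : ℕ} (α : Fin d → ℕ) (f g : Eucl d → ℝ) : Prop :=
  LocallyIntegrable f volume ∧ LocallyIntegrable g volume ∧
    ∀ φ : Eucl d → ℝ, ContDiff ℝ ∞ φ → HasCompactSupport φ →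
      ∫ x, f x * mderiv α φ x = (-1) ^ (∑ i, α i) * ∫ x, g x * φ x

/-! ### Weighted Sobolev–Orlicz norms -/

/-- `‖x^γ ∂_α f‖_(e)` with `∂_α f` the weak derivative. Weak derivatives are unique almost
everywhere, so the infimum runs over at most one value; it is `⊤` if `∂_α f` does not exist. -/
def weakNorm {d : ℕ} (γ α : Fin d → ℕ) (e : ℝ → ℝ) (f : Eucl d → ℝ) : ℝ≥0∞ :=
  ⨅ (g : Eucl d → ℝ) (_ : IsWeakDeriv α f g), luxNorm e (fun x => monom γ x * g x)

/-- `‖f‖_{k,(e)} = ∑_{|α| ≤ k} ‖∂_α f‖_(e)`. -/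
def sobNorm {d : ℕ} (k : ℕ) (e : ℝ → ℝ) (f : Eucl d → ℝ) : ℝ≥0∞ :=
  ∑ α ∈ multiIdx d k, weakNorm 0 α e f

/-- `‖f‖_{k,l,(e)} = ∑_{|γ| ≤ l} ∑_{|α| ≤ k} ‖x^γ ∂_α f‖_(e)`. -/
def wSobNorm {d : ℕ} (k l : ℕ) (e : ℝ → ℝ) (f : Eucl d → ℝ) : ℝ≥0∞ :=
  ∑ γ ∈ multiIdx d l, ∑ α ∈ multiIdx d k, weakNorm γ α e f

/-- The space `W^{k,e}`. -/
def SobSpace (d k : ℕ) (e : ℝ → ℝ) : Set (Eucl d → ℝ) := {f | sobNorm k e f < ⊤}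

/-- The space `W^{k,l,e}`. -/
def WSobSpace (d k l : ℕ) (e : ℝ → ℝ) : Set (Eucl d → ℝ) := {f | wSobNorm k l e f < ⊤}

/-! ### Finite signed measures and the distances `d_k` -/

/-- `‖φ‖_{k,∞} = ∑_{|α| ≤ k} sup_x |∂_α φ(x)|`, for smooth `φ`. -/
def cNorm {d : ℕ} (k : ℕ) (φ : Eucl d → ℝ) : ℝ≥0∞ :=
  ∑ α ∈ multiIdx d k, ⨆ x, ‖mderiv α φ x‖ₑ

/-- `d_k(μ, ν) = sup {|∫ φ dμ - ∫ φ dν| : φ ∈ C^∞, ‖φ‖_{k,∞} ≤ 1}`. -/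
def dk {d : ℕ} (k : ℕ) (μ ν : SignedMeasure (Eucl d)) : ℝ≥0∞ :=
  ⨆ (φ : Eucl d → ℝ) (_ : ContDiff ℝ ∞ φ) (_ : cNorm k φ ≤ 1),
    ENNReal.ofReal |(∫ᵛ x, φ x ∂<•μ) - ∫ᵛ x, φ x ∂<•ν|

/-- `d_k(μ, M) = inf_{ν ∈ M} d_k(μ, ν)`. -/
def dkSet {d : ℕ} (k : ℕ) (μ : SignedMeasure (Eucl d)) (M : Set (SignedMeasure (Eucl d))) :
    ℝ≥0∞ :=
  ⨅ ν ∈ M, dk k μ ν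

/-- `𝓜_a`: the finite signed measures absolutely continuous with respect to Lebesgue measure. -/
def AC (d : ℕ) : Set (SignedMeasure (Eucl d)) :=
  {μ | VectorMeasure.AbsolutelyContinuous μ
    (Measure.toENNRealVectorMeasure (volume : Measure (Eucl d)))}

/-- The density `p_μ` of `μ ∈ 𝓜_a`. -/
def dens {d : ℕ} (μ : SignedMeasure (Eucl d)) : Eucl d → ℝ := μ.rnDeriv volume

/-- The finite signed measures with a density in the set `W` of functions. -/
def HasDensityIn {d : ℕ} (W : Set (Eucl d → ℝ)) : Set (SignedMeasure (Eucl d)) :=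
  {μ | μ ∈ AC d ∧ dens μ ∈ W}

/-! ### The spaces `𝓢_{q,k,m,e}` and `B_q(k,m,e)` -/

/-- `π_{q,k,m,e}(μ, (μ_n)_n)`. -/
def piSum {d : ℕ} (q k m : ℕ) (e : ℝ → ℝ) (μ : SignedMeasure (Eucl d))
    (μs : ℕ → SignedMeasure (Eucl d)) : ℝ≥0∞ :=
  (∑' n : ℕ, 2 ^ (n * (q + k)) * ENNReal.ofReal (betaFn e (2 ^ (n * d))) * dk k μ (μs n)) +
    ∑' n : ℕ, (2 ^ (2 * n * m))⁻¹ * wSobNorm (2 * m + q) (2 * m) e (dens (μs n))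

/-- `ρ_{q,k,m,e}(μ)`: the infimum of `π_{q,k,m,e}(μ, (μ_n)_n)` over all sequences in `𝓜_a`. -/
def rho {d : ℕ} (q k m : ℕ) (e : ℝ → ℝ) (μ : SignedMeasure (Eucl d)) : ℝ≥0∞ :=
  ⨅ (μs : ℕ → SignedMeasure (Eucl d)) (_ : ∀ n, μs n ∈ AC d), piSum q k m e μ μs

/-- `𝓢_{q,k,m,e}`. -/
def SSpace (d q k m : ℕ) (e : ℝ → ℝ) : Set (SignedMeasure (Eucl d)) :=
  {μ | rho q k m e μ < ⊤}

/-- `M_{m,q,e}(R)`. -/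
def MSet (d m q : ℕ) (e : ℝ → ℝ) (R : ℝ) : Set (SignedMeasure (Eucl d)) :=
  {μ | μ ∈ AC d ∧ wSobNorm (2 * m + q) (2 * m) e (dens μ) ≤ ENNReal.ofReal R}

/-- `L_a(R) = R (log R)^a`. -/
def La (a R : ℝ) : ℝ := R * Real.log R ^ a

/-- The balance hypothesis `H_q(k,m,e)` for `μ`. -/
def Balance {d : ℕ} (q k m : ℕ) (e : ℝ → ℝ) (μ : SignedMeasure (Eucl d)) : Prop :=
  ∃ a : ℝ, 1 < a ∧
    limsup (fun R : ℝ =>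
      ENNReal.ofReal (La a R ^ (1 + ((k : ℝ) + q) / (2 * m)) *
          betaFn e (La a R ^ ((d : ℝ) / (2 * m))) / R) *
        dkSet k μ (MSet d m q e R)) atTop < ⊤

/-- `B_q(k,m,e)`. -/
def BSpace (d q k m : ℕ) (e : ℝ → ℝ) : Set (SignedMeasure (Eucl d)) :=
  {μ | Balance q k m e μ}

end OrliczBalance

end

open OrliczBalance

/-!
The inclusions rest on approximate identities of high order. Let `φ` be an even mollifier at scale
`δ`, let `T` be convolution with `φ`, and let `K = kern φ N`, so that `g - g * K = (1 - T)^N g`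
(`sub_conv_kern`). By the fundamental theorem of calculus along segments, `1 - T` gains one factor
`δ` against one derivative in every norm for which Minkowski's inequality for averages of translates
holds (`IsTransNorm.resid_le`). The Luxemburg norms are among these, by Jensen's inequality, as
are the `L¹` and the supremum norm; so `g - g * K` is of order `δ^N` as soon as `g` has `N`
derivatives.

*From `𝓢` to `W^{q,e}`.* Let `μ_n` be approximations of `μ` and `K_n` the kernel of order `2m` at
scale `2^{-n}`; with `χ_n = K_{n+1} - K_n` the increments of `∂_α (μ * K_n)` split as
`∂_α (μ - μ_n) * χ_n + ∂_α μ_n * χ_n`. The second term is of order `2^{-2mn}` times the norm of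
`p_{μ_n}` of order `2m + q` (`luxNorm_conv_scaleKern_sub_le`). The first is bounded by
`2^{n(q+k)} β_e(2^{nd}) d_k(μ, μ_n)` (`luxNorm_sconv_sub_le`): if `u` is this term divided by
a constant `c`, then the integral of `e(u)` is `1/c` times the pairing of `μ - μ_n` with a
mollification of `e(u)/u`. The bound `e(u)/u ≤ (s + e(u)) / e⁻¹(s)` with `s = 2^{nd}` controls the
derivatives of that test function up to order `k` by the integral of `e(u)` itself, and this
integral can be absorbed into the left hand side when `c` is large. Hence the increments are summable
in the Luxemburg norm, the sequences `∂_α (μ * K_n)` converge, and their limits are the density of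
`μ` and its weak derivatives (`SSpace_subset_hasDensityIn`).

*From `B_q` to `𝓢`.* One takes near-optimal `μ_n ∈ M(R_n)` for radii `R_n = 2^{2mn} n^{-b}` with
`1 < b < a`, so that `L_a(R_n) ≥ 2^{2mn}`. The balance hypothesis then bounds the terms of both sums
in the definition of `𝓢` by constants times `n^{-b}` (`BSpace_subset_SSpace`).

*From `W^{q+1,2m,e}` to `B_q`.* Here `2m > d`, and polynomial weights of degree `2m` make `f` and its
weak derivatives integrable. The mollifications of `f` by kernels of order `q + 1 + k` at scale `δ`
have weighted norm of order `δ^{-(2m-1)}`, since `2m - 1` derivatives fall on the kernel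
(`exists_wSobNorm_conv_dil_le`), and `d_k` distance of order `δ^{q+1+k}` from `f`, since `q + 1`
differences may be moved to `f` in `L¹` while `k` remain with the test function
(`dk_conv_kern_le`). Choosing `δ` so that the first quantity equals `R` gives the decay
`R^{-(q+1+k)/(2m-1)}` of the distance; it beats the weight of the balance hypothesis, with
room for all logarithms, exactly under the assumed bound on `α` (`withDensity_mem_BSpace`).
-/

noncomputable section

namespace OrliczBalance

/-! ### Young functions -/

namespace IsYoung

variable {e : ℝ → ℝ} (h : IsYoung e)
include h

theorem continuous : Continuous e :=
  continuousOn_univ.1 (h.strictConvex.convexOn.continuousOn isOpen_univ)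

theorem pos {s : ℝ} (hs : s ≠ 0) : 0 < e s := by
  rcases (h.nonneg s).lt_or_eq with h0 | h0
  · exact h0
  · have := h.strictConvex.2 (Set.mem_univ s) (Set.mem_univ 0) hs (half_pos one_pos)
      (half_pos one_pos) (add_halves (1 : ℝ))
    rw [← h0, h.zero] at this
    simp only [smul_eq_mul, mul_zero, add_zero] at this
    exact absurd (h.nonneg _) (not_le.2 this)

theorem abs_eq (s : ℝ) : e |s| = e s := by
  rcases abs_choice s with hs | hs <;> rw [hs]
  exact h.symm s

theorem div_mono {s t : ℝ} (hs : 0 < s) (hst : s ≤ t) : e s / s ≤ e t / t :=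
  h.monotone_div (by simpa using hs.ne') (by simpa using (hs.trans_le hst).ne') hst

theorem mono_of_nonneg {s t : ℝ} (hs : 0 ≤ s) (hst : s ≤ t) : e s ≤ e t := by
  rcases hs.eq_or_lt with rfl | hs
  · rw [h.zero]; exact h.nonneg t
  · have h1 := h.div_mono hs hst
    have ht := hs.trans_le hst
    rw [div_le_div_iff₀ hs ht] at h1
    have h2 : e t * s ≤ e t * t := mul_le_mul_of_nonneg_left hst (h.nonneg t)
    exact le_of_mul_le_mul_right (h1.trans h2) ht

theorem mono_abs {s t : ℝ} (hst : |s| ≤ |t|) : e s ≤ e t := by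
  rw [← h.abs_eq s, ← h.abs_eq t]
  exact h.mono_of_nonneg (abs_nonneg s) hst

/-- `e` grows at least linearly: `|s| ≤ 1 + e s / e 1`. -/
theorem abs_le_one_add (s : ℝ) : |s| ≤ 1 + e s / e 1 := by
  have h1 := h.pos one_ne_zero
  rcases le_or_gt |s| 1 with hs | hs
  · have := div_nonneg (h.nonneg s) h1.le
    linarith
  · have h2 := h.div_mono one_pos hs.le
    rw [h.abs_eq, div_one, le_div_iff₀ (by linarith)] at h2
    have : |s| ≤ e s / e 1 := by rw [le_div_iff₀ h1]; linarith
    linarith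

theorem le_mul_abs {s : ℝ} (hs : |s| ≤ 1) : e s ≤ e 1 * |s| := by
  rcases eq_or_ne s 0 with rfl | h0
  · simp [h.zero]
  · have h2 := h.div_mono (abs_pos.2 h0) hs
    rw [h.abs_eq, div_one, div_le_iff₀ (abs_pos.2 h0)] at h2
    exact h2

theorem doubling_pow : ∃ l : ℝ, 0 < l ∧ ∀ (j : ℕ) (s : ℝ), e (2 ^ j * s) ≤ l ^ j * e s := by
  obtain ⟨l, hl, hd⟩ := h.doubling
  refine ⟨l, hl, fun j s => ?_⟩
  induction j with
  | zero => simp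
  | succ j ih =>
    calc e (2 ^ (j + 1) * s) = e (2 * (2 ^ j * s)) := by ring_nf
      _ ≤ l * e (2 ^ j * s) := hd _
      _ ≤ l * (l ^ j * e s) := by gcongr
      _ = _ := by ring

theorem bddAbove_sublevel (a : ℝ) : BddAbove {c : ℝ | e c ≤ a} := by
  have h1 := h.pos one_ne_zero
  refine ⟨1 + a / e 1, fun c hc => ?_⟩
  have : e c / e 1 ≤ a / e 1 := div_le_div_of_nonneg_right hc h1.le
  linarith [le_abs_self c, h.abs_le_one_add c]

theorem le_youngInv {a c : ℝ} (hc : e c ≤ a) : c ≤ youngInv e a :=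
  le_csSup (h.bddAbove_sublevel a) hc

theorem youngInv_nonneg {a : ℝ} (ha : 0 ≤ a) : 0 ≤ youngInv e a :=
  h.le_youngInv (by rwa [h.zero])

theorem apply_youngInv {a : ℝ} (ha : 0 ≤ a) : e (youngInv e a) = a := by
  have hne : {c : ℝ | e c ≤ a}.Nonempty := ⟨0, by simpa [h.zero] using ha⟩
  have hcl : IsClosed {c : ℝ | e c ≤ a} := isClosed_le h.continuous continuous_const
  have hmem : youngInv e a ∈ {c : ℝ | e c ≤ a} := hcl.csSup_mem hne (h.bddAbove_sublevel a)
  refine le_antisymm hmem (le_of_not_gt fun hlt => ?_)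
  have hev : ∀ᶠ c in 𝓝 (youngInv e a), e c < a :=
    h.continuous.continuousAt.eventually_lt continuousAt_const hlt
  obtain ⟨c, hc, hgt⟩ := (hev.filter_mono nhdsWithin_le_nhds
    |>.and (self_mem_nhdsWithin (s := Set.Ioi (youngInv e a)))).exists
  exact absurd (h.le_youngInv hc.le) (not_le.2 hgt)

theorem youngInv_pos {a : ℝ} (ha : 0 < a) : 0 < youngInv e a := by
  refine (h.youngInv_nonneg ha.le).lt_of_ne fun h0 => ?_
  have := h.apply_youngInv ha.le
  rw [← h0, h.zero] at this
  exact ha.ne this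

theorem youngInv_mono {a b : ℝ} (ha : 0 ≤ a) (hab : a ≤ b) : youngInv e a ≤ youngInv e b :=
  h.le_youngInv (by rwa [h.apply_youngInv ha])

theorem betaFn_pos {a : ℝ} (ha : 0 < a) : 0 < betaFn e a := div_pos ha (h.youngInv_pos ha)

theorem betaFn_mono {a b : ℝ} (ha : 0 < a) (hab : a ≤ b) : betaFn e a ≤ betaFn e b := by
  have := h.div_mono (h.youngInv_pos ha) (h.youngInv_mono ha.le hab)
  rwa [h.apply_youngInv ha.le, h.apply_youngInv (ha.le.trans hab)] at this

end IsYoung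

/-! ### The Luxemburg norm -/

/-- The modular `∫ e(f)` of the Orlicz class of `e`. -/
def modular {d : ℕ} (e : ℝ → ℝ) (f : Eucl d → ℝ) : ℝ≥0∞ := ∫⁻ x, ENNReal.ofReal (e (f x))

section Lux

variable {d : ℕ} {e : ℝ → ℝ} {f g : Eucl d → ℝ}

theorem luxNorm_le_of {c : ℝ} (hc : 0 < c) (h : modular e (fun x => 1 / c * f x) ≤ 1) :
    luxNorm e f ≤ ENNReal.ofReal c := iInf_le_of_le c (iInf_le_of_le hc (iInf_le_of_le h le_rfl))

theorem modular_congr (h : f =ᵐ[volume] g) : modular e f = modular e g :=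
  lintegral_congr_ae (h.mono fun x hx => by simp only [hx])

theorem luxNorm_congr (h : f =ᵐ[volume] g) : luxNorm e f = luxNorm e g := by
  have : ∀ c : ℝ, modular e (fun x => 1 / c * f x) = modular e (fun x => 1 / c * g x) :=
    fun c => modular_congr (h.mono fun x hx => by simp only [hx])
  simp only [modular] at this
  simp only [luxNorm, this]

variable (he : IsYoung e)
include he

theorem modular_mono (h : ∀ᵐ x, |f x| ≤ |g x|) : modular e f ≤ modular e g :=
  lintegral_mono_ae (h.mono fun _ hx => ENNReal.ofReal_le_ofReal (he.mono_abs hx))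

theorem modular_le_one_of_luxNorm_lt {c : ℝ} (h : luxNorm e f < ENNReal.ofReal c) :
    modular e (fun x => 1 / c * f x) ≤ 1 := by
  simp only [luxNorm, iInf_lt_iff] at h
  obtain ⟨b, hb, hm, hbc⟩ := h
  have hbc' : b ≤ c := (ENNReal.ofReal_lt_ofReal_iff_of_nonneg hb.le).1 hbc |>.le
  refine (modular_mono he (Eventually.of_forall fun x => ?_)).trans hm
  rw [abs_mul, abs_mul]
  refine mul_le_mul_of_nonneg_right ?_ (abs_nonneg _)
  rw [abs_of_pos (one_div_pos.2 hb), abs_of_pos (one_div_pos.2 (hb.trans_le hbc'))]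
  exact one_div_le_one_div_of_le hb hbc'

theorem luxNorm_mono (h : ∀ᵐ x, |f x| ≤ |g x|) : luxNorm e f ≤ luxNorm e g := by
  refine le_iInf fun c => le_iInf fun hc => le_iInf fun hm => luxNorm_le_of hc ?_
  refine (modular_mono he (h.mono fun x hx => ?_)).trans hm
  rw [abs_mul, abs_mul]
  gcongr

theorem luxNorm_zero : luxNorm e (fun _ : Eucl d => (0 : ℝ)) = 0 := by
  refine le_antisymm (le_of_forall_gt fun c hc => ?_) zero_le
  rcases eq_or_ne c ⊤ with rfl | hct
  · exact (luxNorm_le_of one_pos (by simp [modular, he.zero])).trans_lt ENNReal.ofReal_lt_top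
  · have h0 : 0 < c.toReal := ENNReal.toReal_pos hc.ne' hct
    refine (luxNorm_le_of (c := c.toReal / 2) (half_pos h0) (by simp [modular, he.zero])).trans_lt ?_
    conv_rhs => rw [← ENNReal.ofReal_toReal hct]
    exact (ENNReal.ofReal_lt_ofReal_iff h0).2 (half_lt_self h0)

omit he in
/-- To bound a quantity by a multiple of the Luxemburg norm, test against admissible constants. -/
theorem le_mul_luxNorm {X : ℝ≥0∞} {r : ℝ≥0∞} (hr : r ≠ 0) (hr' : r ≠ ⊤)
    (h : ∀ c : ℝ, 0 < c → modular e (fun x => 1 / c * f x) ≤ 1 → X ≤ r * ENNReal.ofReal c) :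
    X ≤ r * luxNorm e f := by
  rw [mul_comm, ← ENNReal.div_le_iff hr hr']
  refine le_iInf fun c => le_iInf fun hc => le_iInf fun hm => ?_
  rw [ENNReal.div_le_iff hr hr', mul_comm]
  exact h c hc hm

theorem luxNorm_smul_le (a : ℝ) :
    luxNorm e (fun x => a * f x) ≤ ENNReal.ofReal |a| * luxNorm e f := by
  rcases eq_or_ne a 0 with rfl | ha
  · simp [luxNorm_zero he]
  have ha' := abs_pos.2 ha
  refine le_mul_luxNorm (by simpa using ha) ENNReal.ofReal_ne_top fun c hc hm => ?_
  rw [← ENNReal.ofReal_mul ha'.le]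
  refine luxNorm_le_of (by positivity) ((modular_mono he (Eventually.of_forall fun x => ?_)).trans hm)
  rw [abs_mul, abs_mul, abs_mul, abs_of_pos (one_div_pos.2 (mul_pos ha' hc)),
    abs_of_pos (one_div_pos.2 hc)]
  apply le_of_eq
  field_simp

theorem luxNorm_add_le (hf : AEMeasurable f) :
    luxNorm e (fun x => f x + g x) ≤ luxNorm e f + luxNorm e g := by
  refine ENNReal.le_of_forall_pos_le_add fun ε hε hlt => ?_
  have hfin := ENNReal.add_lt_top.1 hlt
  set a := (luxNorm e f).toReal + ε / 2 with ha
  set b := (luxNorm e g).toReal + ε / 2 with hb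
  have hε' : (0 : ℝ) < ε := hε
  have ha0 : 0 < a := by positivity
  have hb0 : 0 < b := by positivity
  have hfa : luxNorm e f < ENNReal.ofReal a :=
    (ENNReal.lt_ofReal_iff_toReal_lt hfin.1.ne).2 (by rw [ha]; linarith)
  have hgb : luxNorm e g < ENNReal.ofReal b :=
    (ENNReal.lt_ofReal_iff_toReal_lt hfin.2.ne).2 (by rw [hb]; linarith)
  have h1 := modular_le_one_of_luxNorm_lt he hfa
  have h2 := modular_le_one_of_luxNorm_lt he hgb
  have key : luxNorm e (fun x => f x + g x) ≤ ENNReal.ofReal (a + b) := by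
    refine luxNorm_le_of (by positivity) ?_
    calc modular e (fun x => 1 / (a + b) * (f x + g x))
        ≤ ∫⁻ x, (ENNReal.ofReal (a / (a + b)) * ENNReal.ofReal (e (1 / a * f x)) +
            ENNReal.ofReal (b / (a + b)) * ENNReal.ofReal (e (1 / b * g x))) := by
          refine lintegral_mono fun x => ?_
          rw [← ENNReal.ofReal_mul (by positivity), ← ENNReal.ofReal_mul (by positivity),
            ← ENNReal.ofReal_add (mul_nonneg (by positivity) (he.nonneg _))
              (mul_nonneg (by positivity) (he.nonneg _))]
          refine ENNReal.ofReal_le_ofReal ?_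
          have := he.strictConvex.convexOn.2 (Set.mem_univ (1 / a * f x))
            (Set.mem_univ (1 / b * g x)) (div_pos ha0 (add_pos ha0 hb0)).le
            (div_pos hb0 (add_pos ha0 hb0)).le (by field_simp)
          simp only [smul_eq_mul] at this
          have hx : 1 / (a + b) * (f x + g x) =
              a / (a + b) * (1 / a * f x) + b / (a + b) * (1 / b * g x) := by field_simp
          rwa [← hx] at this
      _ = ENNReal.ofReal (a / (a + b)) * modular e (fun x => 1 / a * f x) +
            ENNReal.ofReal (b / (a + b)) * modular e (fun x => 1 / b * g x) := by
          rw [lintegral_add_left', lintegral_const_mul', lintegral_const_mul']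
          · rfl
          · exact ENNReal.ofReal_ne_top
          · exact ENNReal.ofReal_ne_top
          · exact ((he.continuous.measurable.comp_aemeasurable
              (hf.const_mul _)).ennreal_ofReal).const_mul _
      _ ≤ ENNReal.ofReal (a / (a + b)) * 1 + ENNReal.ofReal (b / (a + b)) * 1 := by gcongr
      _ = 1 := by
          rw [mul_one, mul_one, ← ENNReal.ofReal_add (by positivity) (by positivity), ← add_div,
            div_self (by positivity), ENNReal.ofReal_one]
  refine key.trans (le_of_eq ?_)
  rw [ha, hb, show (luxNorm e f).toReal + (ε : ℝ) / 2 + ((luxNorm e g).toReal + ε / 2) =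
    (luxNorm e f).toReal + (luxNorm e g).toReal + ε by ring, ENNReal.ofReal_add (by positivity)
    (by positivity), ENNReal.ofReal_add (by positivity) (by positivity),
    ENNReal.ofReal_toReal hfin.1.ne, ENNReal.ofReal_toReal hfin.2.ne, ENNReal.ofReal_coe_nnreal]

/-- Fatou's lemma for the Luxemburg norm. -/
theorem luxNorm_le_of_tendsto {F : ℕ → Eucl d → ℝ} {C : ℝ≥0∞} (hF : ∀ n, AEMeasurable (F n))
    (hlim : ∀ᵐ x, Tendsto (fun n => F n x) atTop (𝓝 (f x))) (hC : ∀ n, luxNorm e (F n) ≤ C) :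
    luxNorm e f ≤ C := by
  refine le_of_forall_gt fun c hc => ?_
  obtain ⟨b, hCb, hbc⟩ := exists_between hc
  have hbt := (hbc.trans_le le_top).ne
  have hb : ENNReal.ofReal b.toReal = b := ENNReal.ofReal_toReal hbt
  have hb0 : 0 < b.toReal := ENNReal.toReal_pos (zero_le.trans_lt hCb).ne' hbt
  refine lt_of_le_of_lt ?_ hbc
  rw [← hb]
  refine luxNorm_le_of hb0 ?_
  calc modular e (fun x => 1 / b.toReal * f x)
      = ∫⁻ x, liminf (fun n => ENNReal.ofReal (e (1 / b.toReal * F n x))) atTop := by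
        refine lintegral_congr_ae (hlim.mono fun x hx => ?_)
        refine (Tendsto.liminf_eq ?_).symm
        exact (ENNReal.continuous_ofReal.tendsto _).comp
          ((he.continuous.tendsto _).comp (hx.const_mul _))
    _ ≤ liminf (fun n => modular e (fun x => 1 / b.toReal * F n x)) atTop :=
        lintegral_liminf_le' fun n =>
          (he.continuous.measurable.comp_aemeasurable ((hF n).const_mul _)).ennreal_ofReal
    _ ≤ 1 := by
        refine liminf_le_of_frequently_le' (Eventually.frequently (Eventually.of_forall fun n => ?_))
        exact modular_le_one_of_luxNorm_lt he (by rw [hb]; exact (hC n).trans_lt hCb)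

/-- Jensen's inequality; when `F` or `e ∘ F` is not integrable it holds trivially. -/
theorem jensen_lintegral {Y : Type*} [MeasurableSpace Y] (ρ : Measure Y) [IsProbabilityMeasure ρ]
    {F : Y → ℝ} (hF : AEStronglyMeasurable F ρ) :
    ENNReal.ofReal (e (∫ y, F y ∂ρ)) ≤ ∫⁻ y, ENNReal.ofReal (e (F y)) ∂ρ := by
  by_cases hi : Integrable F ρ
  swap
  · simp [integral_undef hi, he.zero]
  have hm : AEStronglyMeasurable (fun y => e (F y)) ρ :=
    he.continuous.comp_aestronglyMeasurable hF
  by_cases ht : ∫⁻ y, ENNReal.ofReal (e (F y)) ∂ρ = ⊤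
  · simp [ht]
  have hei : Integrable (fun y => e (F y)) ρ := by
    refine ⟨hm, ?_⟩
    rw [hasFiniteIntegral_iff_ofReal (Eventually.of_forall fun y => he.nonneg _)]
    exact lt_top_iff_ne_top.2 ht
  rw [← ofReal_integral_eq_lintegral_ofReal hei (Eventually.of_forall fun y => he.nonneg _)]
  exact ENNReal.ofReal_le_ofReal (he.strictConvex.convexOn.map_integral_le
    he.continuous.continuousOn isClosed_univ (by simp) hi hei)

/-- Minkowski's inequality: averaging translates of `F` does not increase the Luxemburg norm. -/
theorem luxNorm_avg_le (ρ : Measure (Eucl d)) [IsFiniteMeasure ρ] {F : Eucl d → ℝ}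
    (hF : Measurable F) :
    luxNorm e (fun x => ∫ y, F (x - y) ∂ρ) ≤ ρ Set.univ * luxNorm e F := by
  rcases eq_or_ne (ρ Set.univ) 0 with h0 | h0
  · rw [Measure.measure_univ_eq_zero.1 h0]; simp [luxNorm_zero he]
  have ht := measure_ne_top ρ Set.univ
  set r := (ρ Set.univ).toReal with hr
  have hr0 : 0 < r := ENNReal.toReal_pos h0 ht
  have : NeZero ρ := ⟨fun h => h0 (by simp [h])⟩
  refine le_mul_luxNorm h0 ht fun c hc hm => ?_
  rw [← ENNReal.ofReal_toReal ht, ← ENNReal.ofReal_mul ENNReal.toReal_nonneg]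
  refine luxNorm_le_of (by positivity) ?_
  set ρ' : Measure (Eucl d) := (ρ Set.univ)⁻¹ • ρ with hρ'
  have hp : IsProbabilityMeasure ρ' := isProbabilityMeasureSMul
  calc modular e (fun x => 1 / (r * c) * ∫ y, F (x - y) ∂ρ)
      = ∫⁻ x, ENNReal.ofReal (e (∫ y, 1 / c * F (x - y) ∂ρ')) := by
        refine lintegral_congr fun x => ?_
        rw [hρ', integral_smul_measure, integral_const_mul, ENNReal.toReal_inv, ← hr, smul_eq_mul]
        congr 2
        field_simp
    _ ≤ ∫⁻ x, ∫⁻ y, ENNReal.ofReal (e (1 / c * F (x - y))) ∂ρ' := by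
        refine lintegral_mono fun x => jensen_lintegral he ρ' ?_
        exact ((hF.comp (measurable_const.sub measurable_id)).const_mul _).aestronglyMeasurable
    _ = ∫⁻ y, (∫⁻ x, ENNReal.ofReal (e (1 / c * F (x - y)))) ∂ρ' := by
        refine lintegral_lintegral_swap (μ := volume) (ν := ρ')
          (f := fun x y => ENNReal.ofReal (e (1 / c * F (x - y)))) (Measurable.aemeasurable ?_)
        exact (he.continuous.measurable.comp ((hF.comp measurable_sub).const_mul _)).ennreal_ofReal
    _ = ∫⁻ _, modular e (fun x => 1 / c * F x) ∂ρ' := by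
        congr 1; ext1 y
        exact lintegral_sub_right_eq_self (fun x => ENNReal.ofReal (e (1 / c * F x))) y
    _ ≤ ∫⁻ _, 1 ∂ρ' := lintegral_mono fun _ => hm
    _ = 1 := by simp

/-- Functions of finite Luxemburg norm are integrable against bounded integrable weights. -/
theorem lintegral_mul_le_luxNorm
    {w : Eucl d → ℝ≥0∞} (hw : Measurable w) (hw1 : ∀ x, w x ≤ 1) (hwt : ∫⁻ x, w x ≠ ⊤) :
    ∫⁻ x, ‖f x‖ₑ * w x ≤ ((∫⁻ x, w x) + ENNReal.ofReal (1 / e 1)) * luxNorm e f := by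
  have h1 := he.pos one_ne_zero
  refine le_mul_luxNorm (by simp [h1]) (ENNReal.add_ne_top.2 ⟨hwt, ENNReal.ofReal_ne_top⟩)
    fun c hc hm => ?_
  calc ∫⁻ x, ‖f x‖ₑ * w x
      ≤ ∫⁻ x, ENNReal.ofReal c *
          (w x + ENNReal.ofReal (1 / e 1) * ENNReal.ofReal (e (1 / c * f x))) := by
        refine lintegral_mono fun x => ?_
        -- linear growth of `e`, applied to `f x / c`
        have h2 : ‖f x‖ₑ ≤ ENNReal.ofReal c *
            (1 + ENNReal.ofReal (1 / e 1) * ENNReal.ofReal (e (1 / c * f x))) := by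
          rw [← ENNReal.ofReal_mul (by positivity), ← ENNReal.ofReal_one,
            ← ENNReal.ofReal_add one_pos.le (mul_nonneg (by positivity) (he.nonneg _)),
            ← ENNReal.ofReal_mul hc.le, Real.enorm_eq_ofReal_abs]
          refine ENNReal.ofReal_le_ofReal ?_
          have := he.abs_le_one_add (1 / c * f x)
          rw [abs_mul, abs_of_pos (by positivity), one_div, inv_mul_le_iff₀ hc] at this
          refine this.trans (le_of_eq ?_)
          simp only [one_div]
          ring
        calc ‖f x‖ₑ * w x ≤ ENNReal.ofReal c *
            (1 + ENNReal.ofReal (1 / e 1) * ENNReal.ofReal (e (1 / c * f x))) * w x := by gcongr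
          _ = ENNReal.ofReal c * (w x +
            ENNReal.ofReal (1 / e 1) * ENNReal.ofReal (e (1 / c * f x)) * w x) := by ring
          _ ≤ ENNReal.ofReal c * (w x +
            ENNReal.ofReal (1 / e 1) * ENNReal.ofReal (e (1 / c * f x)) * 1) := by
              gcongr; exact hw1 x
          _ = _ := by rw [mul_one]
    _ = ENNReal.ofReal c * ((∫⁻ x, w x) +
          ENNReal.ofReal (1 / e 1) * modular e (fun x => 1 / c * f x)) := by
        rw [lintegral_const_mul' _ _ ENNReal.ofReal_ne_top, lintegral_add_left hw,
          lintegral_const_mul' _ _ ENNReal.ofReal_ne_top]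
        rfl
    _ ≤ ENNReal.ofReal c * ((∫⁻ x, w x) + ENNReal.ofReal (1 / e 1) * 1) := by gcongr
    _ = _ := by rw [mul_one, mul_comm]

theorem setLIntegral_le_luxNorm {K : Set (Eucl d)} (hK : IsCompact K) :
    ∫⁻ x in K, ‖f x‖ₑ ≤ (volume K + ENNReal.ofReal (1 / e 1)) * luxNorm e f := by
  have hw : ∫⁻ x, K.indicator (1 : Eucl d → ℝ≥0∞) x = volume K :=
    lintegral_indicator_one hK.measurableSet
  have key := lintegral_mul_le_luxNorm he (f := f)
    (w := K.indicator 1) (measurable_one.indicator hK.measurableSet)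
    (fun x => Set.indicator_le_self' (by simp) x) (by rw [hw]; exact hK.measure_lt_top.ne)
  rw [hw] at key
  refine le_trans (le_of_eq ?_) key
  rw [← lintegral_indicator hK.measurableSet]
  refine lintegral_congr fun x => ?_
  by_cases hx : x ∈ K <;> simp [hx]

/-- Bounded integrable functions have finite Luxemburg norm. -/
theorem luxNorm_lt_top_of_integrable (hf : Integrable f) {B : ℝ} (hB : ∀ x, |f x| ≤ B) :
    luxNorm e f < ⊤ := by
  set c := |B| + e 1 * (∫ x, |f x|) + 1 with hc
  have hI : 0 ≤ ∫ x, |f x| := integral_nonneg fun x => abs_nonneg _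
  have h1 := he.pos one_ne_zero
  have hp : 0 ≤ e 1 * ∫ x, |f x| := by positivity
  have hc0 : 0 < c := by positivity
  refine (luxNorm_le_of hc0 ?_).trans_lt ENNReal.ofReal_lt_top
  calc modular e (fun x => 1 / c * f x) ≤ ∫⁻ x, ENNReal.ofReal (e 1 / c * |f x|) := by
        refine lintegral_mono fun x => ENNReal.ofReal_le_ofReal ?_
        have hx : |1 / c * f x| ≤ 1 := by
          rw [abs_mul, abs_of_pos (by positivity), one_div, inv_mul_le_iff₀ hc0, mul_one]
          exact (hB x).trans ((le_abs_self B).trans (by rw [hc]; linarith))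
        refine (he.le_mul_abs hx).trans (le_of_eq ?_)
        rw [abs_mul, abs_of_pos (by positivity)]; ring
    _ = ENNReal.ofReal (∫ x, e 1 / c * |f x|) := by
        rw [ofReal_integral_eq_lintegral_ofReal (hf.abs.const_mul _)]
        exact Eventually.of_forall fun x => by positivity
    _ ≤ 1 := by
        rw [integral_const_mul, ENNReal.ofReal_le_one, div_mul_eq_mul_div, div_le_one hc0, hc]
        linarith [abs_nonneg B]

/-- By the doubling condition, all dilates of a function of finite Luxemburg norm have finite
modular. -/
theorem modular_lt_top (h : luxNorm e f < ⊤) {c : ℝ} (hc : 0 < c) :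
    modular e (fun x => 1 / c * f x) < ⊤ := by
  obtain ⟨l, hl, hd⟩ := he.doubling_pow
  obtain ⟨j, hj⟩ : ∃ j : ℕ, (luxNorm e f).toReal / c < 2 ^ j :=
    pow_unbounded_of_one_lt _ one_lt_two
  rw [div_lt_iff₀ hc] at hj
  have hm := modular_le_one_of_luxNorm_lt he (f := f) (c := 2 ^ j * c)
    ((ENNReal.lt_ofReal_iff_toReal_lt h.ne).2 hj)
  calc modular e (fun x => 1 / c * f x)
      ≤ ∫⁻ x, ENNReal.ofReal (l ^ j) * ENNReal.ofReal (e (1 / (2 ^ j * c) * f x)) := by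
        refine lintegral_mono fun x => ?_
        rw [← ENNReal.ofReal_mul (by positivity)]
        refine ENNReal.ofReal_le_ofReal (le_trans (le_of_eq ?_) (hd j _))
        congr 1
        field_simp
    _ = ENNReal.ofReal (l ^ j) * modular e (fun x => 1 / (2 ^ j * c) * f x) :=
        lintegral_const_mul' _ _ ENNReal.ofReal_ne_top
    _ ≤ ENNReal.ofReal (l ^ j) * 1 := by gcongr
    _ < ⊤ := by simp

end Lux

/-! ### Translation-invariant norms -/

/-- The properties shared by the Luxemburg norms, the `L¹` norm and the supremum norm which give
the rate of convergence of mollification: monotonicity, subadditivity, and Minkowski's inequality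
for averages of translates. -/
structure IsTransNorm {d : ℕ} (P : (Eucl d → ℝ) → ℝ≥0∞) : Prop where
  mono : ∀ f g : Eucl d → ℝ, (∀ x, |f x| ≤ |g x|) → P f ≤ P g
  add : ∀ f g : Eucl d → ℝ, Measurable f → P (fun x => f x + g x) ≤ P f + P g
  zero : P (fun _ => 0) = 0
  smul : ∀ (a : ℝ) (f : Eucl d → ℝ), P (fun x => a * f x) ≤ ENNReal.ofReal |a| * P f
  avg : ∀ (ρ : Measure (Eucl d)) [IsFiniteMeasure ρ] (F : Eucl d → ℝ), Measurable F →
    P (fun x => ∫ y, F (x - y) ∂ρ) ≤ ρ Set.univ * P F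

theorem isTransNorm_luxNorm {d : ℕ} {e : ℝ → ℝ} (he : IsYoung e) :
    IsTransNorm (luxNorm e (d := d)) where
  mono _ _ h := luxNorm_mono he (Eventually.of_forall h)
  add _ _ hf := luxNorm_add_le he hf.aemeasurable
  zero := luxNorm_zero he
  smul a _ := luxNorm_smul_le he a
  avg ρ _ _ hF := luxNorm_avg_le he ρ hF

theorem isTransNorm_lintegral {d : ℕ} :
    IsTransNorm (fun f : Eucl d → ℝ => ∫⁻ x, ‖f x‖ₑ) where
  mono f g h := lintegral_mono fun x => by
    rw [Real.enorm_eq_ofReal_abs, Real.enorm_eq_ofReal_abs]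
    exact ENNReal.ofReal_le_ofReal (h x)
  add f g hf := by
    rw [← lintegral_add_left hf.enorm]
    exact lintegral_mono fun x => enorm_add_le _ _
  zero := by simp
  smul a f := by
    rw [← lintegral_const_mul' _ _ ENNReal.ofReal_ne_top]
    refine lintegral_mono fun x => ?_
    rw [enorm_mul, Real.enorm_eq_ofReal_abs a]
  avg ρ _ F hF := by
    calc ∫⁻ x, ‖∫ y, F (x - y) ∂ρ‖ₑ ≤ ∫⁻ x, ∫⁻ y, ‖F (x - y)‖ₑ ∂ρ :=
          lintegral_mono fun x => enorm_integral_le_lintegral_enorm _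
      _ = ∫⁻ y, (∫⁻ x, ‖F (x - y)‖ₑ) ∂ρ :=
          lintegral_lintegral_swap (hF.comp measurable_sub).enorm.aemeasurable
      _ = ∫⁻ _, (∫⁻ x, ‖F x‖ₑ) ∂ρ :=
          lintegral_congr fun y => lintegral_sub_right_eq_self (fun x => ‖F x‖ₑ) y
      _ = _ := by rw [lintegral_const, mul_comm]

theorem isTransNorm_iSup {d : ℕ} : IsTransNorm (fun f : Eucl d → ℝ => ⨆ x, ‖f x‖ₑ) where
  mono f g h := iSup_mono fun x => by
    rw [Real.enorm_eq_ofReal_abs, Real.enorm_eq_ofReal_abs]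
    exact ENNReal.ofReal_le_ofReal (h x)
  add f g _ := iSup_le fun x => (enorm_add_le _ _).trans
    (add_le_add (le_iSup (fun x => ‖f x‖ₑ) x) (le_iSup (fun x => ‖g x‖ₑ) x))
  zero := by simp
  smul a f := iSup_le fun x => by
    rw [enorm_mul, Real.enorm_eq_ofReal_abs a]
    gcongr
    exact le_iSup (fun x => ‖f x‖ₑ) x
  avg ρ _ F _ := iSup_le fun x => by
    calc ‖∫ y, F (x - y) ∂ρ‖ₑ ≤ ∫⁻ y, ‖F (x - y)‖ₑ ∂ρ := enorm_integral_le_lintegral_enorm _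
      _ ≤ ∫⁻ _, (⨆ x, ‖F x‖ₑ) ∂ρ := lintegral_mono fun y => le_iSup (fun x => ‖F x‖ₑ) (x - y)
      _ = _ := by rw [lintegral_const, mul_comm]


/-! ### Iterated partial derivatives -/

section Deriv

variable {d : ℕ}

/-- The test functions `C_c^∞(ℝ^d)`. -/
structure IsTest (f : Eucl d → ℝ) : Prop where
  smooth : ContDiff ℝ ∞ f
  compact : HasCompactSupport f

theorem contDiff_pderiv {f : Eucl d → ℝ} (hf : ContDiff ℝ ∞ f) (i : Fin d) :
    ContDiff ℝ ∞ (pderiv i f) :=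
  (hf.fderiv_right (m := ∞) (by simp)).clm_apply contDiff_const

theorem IsTest.pderiv {f : Eucl d → ℝ} (hf : IsTest f) (i : Fin d) : IsTest (pderiv i f) :=
  ⟨contDiff_pderiv hf.smooth i, hf.compact.fderiv_apply (𝕜 := ℝ) _⟩

theorem pderiv_comm {f : Eucl d → ℝ} (hf : ContDiff ℝ ∞ f) (i j : Fin d) :
    pderiv i (pderiv j f) = pderiv j (pderiv i f) := by
  funext x
  have hd : DifferentiableAt ℝ (fderiv ℝ f) x :=
    ((hf.fderiv_right (m := ∞) (by simp)).differentiable (by simp)).differentiableAt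
  have h2 : ∀ v w : Eucl d, fderiv ℝ (fun y => fderiv ℝ f y v) x w = fderiv ℝ (fderiv ℝ f) x w v := by
    intro v w
    rw [fderiv_clm_apply hd (differentiableAt_const v)]
    simp
  have hs : IsSymmSndFDerivAt ℝ f x :=
    hf.contDiffAt.isSymmSndFDerivAt (by
      simpa using (WithTop.coe_le_coe.2 le_top : ((2 : ℕ∞) : ℕ∞ω) ≤ ((⊤ : ℕ∞) : ℕ∞ω)))
  exact (h2 _ _).trans ((hs _ _).trans (h2 _ _).symm)

theorem pderiv_const_mul (c : ℝ) (f : Eucl d → ℝ) (i : Fin d) :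
    pderiv i (fun x => c * f x) = fun x => c * pderiv i f x := by
  funext x
  have := congrFun (fderiv_const_smul_field (𝕜 := ℝ) (f := f) c) x
  simp only [pderiv]
  rw [show (fun x => c * f x) = c • f from rfl, this]
  simp

theorem mderiv_zero (f : Eucl d → ℝ) : mderiv 0 f = f := by
  simp only [mderiv, Pi.zero_apply, Function.iterate_zero, id]
  induction List.finRange d with
  | nil => rfl
  | cons a l ih => simp [ih]

/-- An operator that commutes with the partial derivatives up to a factor `c` commutes with `∂_α` up
to `c ^ |α|`. -/
theorem mderiv_intertwine {C : Set (Eucl d → ℝ)} {T : (Eucl d → ℝ) → (Eucl d → ℝ)} {c : ℝ}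
    (hC : ∀ i, ∀ f ∈ C, pderiv i f ∈ C)
    (hT : ∀ i, ∀ f ∈ C, pderiv i (T f) = fun x => c * T (pderiv i f) x) (α : Fin d → ℕ)
    {f : Eucl d → ℝ} (hf : f ∈ C) :
    mderiv α f ∈ C ∧ mderiv α (T f) = fun x => c ^ (∑ i, α i) * T (mderiv α f) x := by
  have hiter : ∀ (i : Fin d) (n : ℕ) (g : Eucl d → ℝ) (b : ℝ), g ∈ C →
      (pderiv i)^[n] g ∈ C ∧
      (pderiv i)^[n] (fun x => b * T g x) = fun x => c ^ n * b * T ((pderiv i)^[n] g) x := by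
    intro i n
    induction n with
    | zero => intro g b hg; simpa using hg
    | succ n ih =>
      intro g b hg
      obtain ⟨h1, h2⟩ := ih (pderiv i g) (c * b) (hC i g hg)
      simp only [Function.iterate_succ_apply]
      refine ⟨h1, ?_⟩
      rw [pderiv_const_mul, hT i g hg]
      simp only [← mul_assoc] at h2 ⊢
      rw [mul_comm b c, h2]
      funext x
      ring
  simp only [mderiv, Fin.sum_univ_def]
  induction List.finRange d with
  | nil => simpa using hf
  | cons a l ih =>
    simp only [List.foldr_cons, List.map_cons, List.sum_cons]
    rw [ih.2]
    obtain ⟨h1, h2⟩ := hiter a (α a) _ (c ^ (l.map α).sum) ih.1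
    exact ⟨h1, by rw [h2, pow_add]⟩

theorem mderiv_comm_of_pderiv_comm {C : Set (Eucl d → ℝ)} {T : (Eucl d → ℝ) → (Eucl d → ℝ)}
    (hC : ∀ i, ∀ f ∈ C, pderiv i f ∈ C)
    (hT : ∀ i, ∀ f ∈ C, pderiv i (T f) = T (pderiv i f)) (α : Fin d → ℕ)
    {f : Eucl d → ℝ} (hf : f ∈ C) : mderiv α (T f) = T (mderiv α f) := by
  have := (mderiv_intertwine (c := 1) hC (T := T) (fun i g hg => by simpa using hT i g hg) α hf).2
  simpa using this

theorem contDiff_mderiv {f : Eucl d → ℝ} (hf : ContDiff ℝ ∞ f) (α : Fin d → ℕ) :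
    ContDiff ℝ ∞ (mderiv α f) :=
  (mderiv_intertwine (C := {f | ContDiff ℝ ∞ f}) (T := id) (c := 1)
    (fun i _ hg => contDiff_pderiv hg i) (fun _ _ _ => by simp) α hf).1

theorem IsTest.mderiv {f : Eucl d → ℝ} (hf : IsTest f) (α : Fin d → ℕ) : IsTest (mderiv α f) :=
  (mderiv_intertwine (C := {f | IsTest f}) (T := id) (c := 1)
    (fun i _ hg => hg.pderiv i) (fun _ _ _ => by simp) α hf).1

theorem mderiv_const_mul (c : ℝ) (f : Eucl d → ℝ) (α : Fin d → ℕ) :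
    mderiv α (fun x => c * f x) = fun x => c * mderiv α f x :=
  mderiv_comm_of_pderiv_comm (C := Set.univ) (T := fun f x => c * f x) (fun _ _ _ => trivial)
    (fun i f _ => pderiv_const_mul c f i) α (Set.mem_univ f)

theorem mderiv_add {f : Eucl d → ℝ} (hf : ContDiff ℝ ∞ f) (α β : Fin d → ℕ) :
    mderiv (α + β) f = mderiv α (mderiv β f) := by
  have hsm : ∀ (l : List (Fin d)) (γ : Fin d → ℕ),
      ContDiff ℝ ∞ (l.foldr (fun i g => (pderiv i)^[γ i] g) f) := by
    intro l γ
    induction l with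
    | nil => exact hf
    | cons a l ih =>
      simp only [List.foldr_cons]
      generalize List.foldr (fun i g => (pderiv i)^[γ i] g) f l = g at ih
      induction γ a generalizing g with
      | zero => exact ih
      | succ n ihn => exact ihn _ (contDiff_pderiv ih a)
  have hcomm : ∀ (i : Fin d) (n : ℕ) (l : List (Fin d)) (g : Eucl d → ℝ), ContDiff ℝ ∞ g →
      l.foldr (fun i g => (pderiv i)^[α i] g) ((pderiv i)^[n] g) =
        (pderiv i)^[n] (l.foldr (fun i g => (pderiv i)^[α i] g) g) := by
    intro i n l g hg
    have hstep : ∀ (l : List (Fin d)) (g : Eucl d → ℝ), ContDiff ℝ ∞ g →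
        ContDiff ℝ ∞ (l.foldr (fun i g => (pderiv i)^[α i] g) g) ∧
        l.foldr (fun i g => (pderiv i)^[α i] g) (pderiv i g) =
        pderiv i (l.foldr (fun i g => (pderiv i)^[α i] g) g) := by
      intro l g hg
      induction l with
      | nil => exact ⟨hg, rfl⟩
      | cons a l ih =>
        simp only [List.foldr_cons]
        rw [ih.2]
        have ih' := ih.1
        generalize List.foldr (fun i g => (pderiv i)^[α i] g) g l = u at ih'
        clear ih
        induction α a generalizing u with
        | zero => exact ⟨ih', rfl⟩
        | succ n ihn =>
          simp only [Function.iterate_succ_apply]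
          rw [pderiv_comm ih' a i]
          exact ihn _ (contDiff_pderiv ih' a)
    induction n generalizing g with
    | zero => rfl
    | succ n ihn =>
      simp only [Function.iterate_succ_apply]
      rw [ihn _ (contDiff_pderiv hg i), (hstep l g hg).2]
  simp only [mderiv]
  induction List.finRange d with
  | nil => rfl
  | cons a l ih =>
    simp only [List.foldr_cons, Pi.add_apply, Function.iterate_add_apply]
    rw [hcomm a (β a) l _ (hsm l β), ← ih]
    simp only [Pi.add_apply, Function.iterate_add_apply]

/-- The first-order multi-index `Pi.single i 1` gives the `i`-th partial derivative. -/
theorem mderiv_single (i : Fin d) (f : Eucl d → ℝ) :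
    mderiv (Pi.single i 1) f = pderiv i f := by
  have key : ∀ l : List (Fin d), l.Nodup →
      l.foldr (fun j g => (pderiv j)^[(Pi.single i 1 : Fin d → ℕ) j] g) f =
        if i ∈ l then pderiv i f else f := by
    intro l hl
    induction l with
    | nil => simp
    | cons a l ih =>
      rw [List.nodup_cons] at hl
      rw [List.foldr_cons, ih hl.2]
      rcases eq_or_ne a i with rfl | hai
      · simp [hl.1]
      · simp [hai.symm, hai]
  rw [mderiv, key _ (List.nodup_finRange d), if_pos (List.mem_finRange i)]

/-- Chain rule for a homothety composed with a translation. -/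
theorem mderiv_comp_affine {f : Eucl d → ℝ} (hf : ContDiff ℝ ∞ f) (α : Fin d → ℕ) (c : ℝ)
    (b : Eucl d) :
    mderiv α (fun x => f (c • x + b)) = fun x => c ^ (∑ i, α i) * mderiv α f (c • x + b) := by
  refine (mderiv_intertwine (C := {f | ContDiff ℝ ∞ f}) (T := fun f x => f (c • x + b)) (c := c)
    (fun i _ hg => contDiff_pderiv hg i) (fun i g hg => ?_) α hf).2
  funext x
  have h1 : HasFDerivAt (fun x : Eucl d => c • x + b) (c • ContinuousLinearMap.id ℝ (Eucl d)) x :=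
    ((hasFDerivAt_id x).const_smul c).add_const b
  have h2 : HasFDerivAt g (fderiv ℝ g (c • x + b)) (c • x + b) :=
    (ContDiff.differentiable (n := ∞) hg (by simp)).differentiableAt.hasFDerivAt
  have h3 := (h2.comp x h1).fderiv
  simp only [pderiv]
  rw [show (fun x => g (c • x + b)) = g ∘ fun x => c • x + b from rfl, h3]
  simp

theorem IsTest.comp_affine {f : Eucl d → ℝ} (hf : IsTest f) {c : ℝ} (hc : c ≠ 0) (b : Eucl d) :
    IsTest (fun x => f (c • x + b)) := by
  refine ⟨hf.smooth.comp ((contDiff_const_smul c).add contDiff_const), ?_⟩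
  exact hf.compact.comp_homeomorph ((Homeomorph.smulOfNeZero c hc).trans (Homeomorph.addRight b))

theorem IsTest.continuous {f : Eucl d → ℝ} (hf : IsTest f) : Continuous f := hf.smooth.continuous

theorem IsTest.integrable {f : Eucl d → ℝ} (hf : IsTest f) : Integrable f :=
  hf.continuous.integrable_of_hasCompactSupport hf.compact

theorem IsTest.exists_bound {f : Eucl d → ℝ} (hf : IsTest f) : ∃ B, 0 ≤ B ∧ ∀ x, |f x| ≤ B := by
  obtain ⟨B, hB⟩ := hf.compact.exists_bound_of_continuous hf.continuous
  exact ⟨B, (norm_nonneg _).trans (hB 0), hB⟩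

theorem IsTest.exists_support {f : Eucl d → ℝ} (hf : IsTest f) :
    ∃ r : ℝ, 0 < r ∧ ∀ x, f x ≠ 0 → ‖x‖ ≤ r := by
  obtain ⟨r, hr⟩ := hf.compact.isBounded.exists_norm_le
  refine ⟨max r 1, by positivity, fun x hx => (hr x ?_).trans (le_max_left _ _)⟩
  exact subset_tsupport _ hx

theorem IsTest.add {f g : Eucl d → ℝ} (hf : IsTest f) (hg : IsTest g) :
    IsTest (fun x => f x + g x) := ⟨hf.smooth.add hg.smooth, hf.compact.add hg.compact⟩

theorem IsTest.const_mul {f : Eucl d → ℝ} (hf : IsTest f) (c : ℝ) : IsTest (fun x => c * f x) :=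
  ⟨contDiff_const.mul hf.smooth, hf.compact.mul_left⟩

theorem IsTest.sub {f g : Eucl d → ℝ} (hf : IsTest f) (hg : IsTest g) :
    IsTest (fun x => f x - g x) := by
  simpa [sub_eq_add_neg] using hf.add (hg.const_mul (-1))

theorem IsTest.comp_sub_left {f : Eucl d → ℝ} (hf : IsTest f) (b : Eucl d) :
    IsTest (fun x => f (b - x)) := by
  have := hf.comp_affine (c := -1) (by norm_num) b
  simpa [neg_add_eq_sub] using this

theorem IsTest.comp_sub_right {f : Eucl d → ℝ} (hf : IsTest f) (b : Eucl d) :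
    IsTest (fun x => f (x - b)) := by
  have := hf.comp_affine (c := 1) (by norm_num) (-b)
  simpa [← sub_eq_add_neg] using this

theorem mderiv_comp_sub_left {f : Eucl d → ℝ} (hf : ContDiff ℝ ∞ f) (α : Fin d → ℕ) (b : Eucl d) :
    mderiv α (fun x => f (b - x)) = fun x => (-1) ^ (∑ i, α i) * mderiv α f (b - x) := by
  have := mderiv_comp_affine hf α (-1) b
  simpa [neg_add_eq_sub] using this

theorem mderiv_comp_sub_right {f : Eucl d → ℝ} (hf : ContDiff ℝ ∞ f) (α : Fin d → ℕ) (b : Eucl d) :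
    mderiv α (fun x => f (x - b)) = fun x => mderiv α f (x - b) := by
  have := mderiv_comp_affine hf α 1 (-b)
  simpa [← sub_eq_add_neg] using this

theorem integral_mul_pderiv {f φ : Eucl d → ℝ} (hf : ContDiff ℝ ∞ f) (hφ : IsTest φ) (i : Fin d) :
    ∫ x, f x * pderiv i φ x = -1 * ∫ x, pderiv i f x * φ x := by
  rw [neg_one_mul]
  refine integral_mul_fderiv_eq_neg_fderiv_mul_of_integrable ?_ ?_ ?_
    (fun x _ => (hf.differentiable (by simp)).differentiableAt)
    (fun x _ => (hφ.smooth.differentiable (by simp)).differentiableAt)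
  · exact ((contDiff_pderiv hf i).continuous.mul hφ.continuous).integrable_of_hasCompactSupport
      hφ.compact.mul_left
  · exact (hf.continuous.mul (hφ.pderiv i).continuous).integrable_of_hasCompactSupport
      (hφ.pderiv i).compact.mul_left
  · exact (hf.continuous.mul hφ.continuous).integrable_of_hasCompactSupport hφ.compact.mul_left

theorem integral_mul_mderiv {f φ : Eucl d → ℝ} (hf : ContDiff ℝ ∞ f) (hφ : IsTest φ)
    (α : Fin d → ℕ) :
    ∫ x, f x * mderiv α φ x = (-1) ^ (∑ i, α i) * ∫ x, mderiv α f x * φ x := by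
  -- strong form: peel off one coordinate direction at a time
  have hiter : ∀ (i : Fin d) (n : ℕ) (u ψ : Eucl d → ℝ), ContDiff ℝ ∞ u → IsTest ψ →
      IsTest ((pderiv i)^[n] ψ) ∧ ∫ x, u x * (pderiv i)^[n] ψ x =
        (-1) ^ n * ∫ x, (pderiv i)^[n] u x * ψ x := by
    intro i n
    induction n with
    | zero => intro u ψ _ hψ; simpa using hψ
    | succ n ih =>
      intro u ψ hu hψ
      refine ⟨(ih u _ hu (hψ.pderiv i)).1, ?_⟩
      rw [Function.iterate_succ_apply, (ih u _ hu (hψ.pderiv i)).2, Function.iterate_succ_apply',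
        integral_mul_pderiv _ hψ i]
      · ring
      · clear ih
        induction n with
        | zero => exact hu
        | succ n ih => rw [Function.iterate_succ_apply']; exact contDiff_pderiv ih i
  have hsm : ∀ (i : Fin d) (n : ℕ) (u : Eucl d → ℝ), ContDiff ℝ ∞ u →
      ContDiff ℝ ∞ ((pderiv i)^[n] u) := by
    intro i n
    induction n with
    | zero => exact fun u hu => hu
    | succ n ih => exact fun u hu => ih _ (contDiff_pderiv hu i)
  have hcomm : ∀ (i j : Fin d) (n k : ℕ) (u : Eucl d → ℝ), ContDiff ℝ ∞ u →
      (pderiv i)^[n] ((pderiv j)^[k] u) = (pderiv j)^[k] ((pderiv i)^[n] u) := by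
    intro i j n k u hu
    have h1 : ∀ (k : ℕ) (u : Eucl d → ℝ), ContDiff ℝ ∞ u →
        pderiv i ((pderiv j)^[k] u) = (pderiv j)^[k] (pderiv i u) := by
      intro k
      induction k with
      | zero => exact fun _ _ => rfl
      | succ k ih =>
        intro u hu
        simp only [Function.iterate_succ_apply]
        rw [ih _ (contDiff_pderiv hu j), pderiv_comm hu]
    induction n generalizing u with
    | zero => rfl
    | succ n ih =>
      simp only [Function.iterate_succ_apply]
      rw [h1 k u hu, ih _ (contDiff_pderiv hu i)]
  have main : ∀ (l : List (Fin d)) (u : Eucl d → ℝ), ContDiff ℝ ∞ u →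
      IsTest (l.foldr (fun i g => (pderiv i)^[α i] g) φ) ∧
      (∀ (j : Fin d) (k : ℕ), l.foldr (fun i g => (pderiv i)^[α i] g) ((pderiv j)^[k] u) =
        (pderiv j)^[k] (l.foldr (fun i g => (pderiv i)^[α i] g) u)) ∧
      ContDiff ℝ ∞ (l.foldr (fun i g => (pderiv i)^[α i] g) u) ∧
      ∫ x, u x * l.foldr (fun i g => (pderiv i)^[α i] g) φ x =
        (-1) ^ (l.map α).sum * ∫ x, l.foldr (fun i g => (pderiv i)^[α i] g) u x * φ x := by
    intro l
    induction l with
    | nil => intro u hu; exact ⟨hφ, fun _ _ => rfl, hu, by simp⟩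
    | cons a l ih =>
      intro u hu
      obtain ⟨h1, h2, h3, -⟩ := ih u hu
      have h4 := (ih _ (hsm a (α a) u hu)).2.2.2
      simp only [List.foldr_cons, List.map_cons, List.sum_cons]
      refine ⟨(hiter a (α a) u _ hu h1).1, fun j k => ?_, hsm _ _ _ h3, ?_⟩
      · rw [h2, hcomm _ _ _ _ _ h3]
      · rw [(hiter a (α a) u _ hu h1).2, h4, h2, pow_add, mul_assoc]
  have := (main (List.finRange d) f hf).2.2.2
  rw [Fin.sum_univ_def]
  exact this

theorem isWeakDeriv_of_contDiff {f : Eucl d → ℝ} (hf : ContDiff ℝ ∞ f) (α : Fin d → ℕ) :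
    IsWeakDeriv α f (mderiv α f) :=
  ⟨hf.continuous.locallyIntegrable, (contDiff_mderiv hf α).continuous.locallyIntegrable,
    fun _ h1 h2 => integral_mul_mderiv hf ⟨h1, h2⟩ α⟩

theorem IsWeakDeriv.ae_unique {f g g' : Eucl d → ℝ} {α : Fin d → ℕ} (h : IsWeakDeriv α f g)
    (h' : IsWeakDeriv α f g') : g =ᵐ[volume] g' := by
  refine ae_eq_of_integral_contDiff_smul_eq h.2.1 h'.2.1 fun φ h1 h2 => ?_
  have := (h.2.2 φ h1 h2).symm.trans (h'.2.2 φ h1 h2)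
  have h3 := mul_left_cancel₀ (pow_ne_zero _ (by norm_num)) this
  simpa [mul_comm] using h3

theorem IsWeakDeriv.congr {f f' g g' : Eucl d → ℝ} {α : Fin d → ℕ} (h : IsWeakDeriv α f g)
    (hf : f =ᵐ[volume] f') (hg : g =ᵐ[volume] g') : IsWeakDeriv α f' g' := by
  refine ⟨(locallyIntegrable_congr hf).1 h.1, (locallyIntegrable_congr hg).1 h.2.1,
    fun φ h1 h2 => ?_⟩
  rw [← integral_congr_ae (hf.mono fun x hx => by simp only [hx] :
      (fun x => f x * mderiv α φ x) =ᵐ[volume] _), h.2.2 φ h1 h2,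
    integral_congr_ae (hg.mono fun x hx => by simp only [hx] :
      (fun x => g x * φ x) =ᵐ[volume] fun x => g' x * φ x)]

theorem IsWeakDeriv.weakNorm_eq {f g : Eucl d → ℝ} {α : Fin d → ℕ} (h : IsWeakDeriv α f g)
    (γ : Fin d → ℕ) (e : ℝ → ℝ) : weakNorm γ α e f = luxNorm e (fun x => monom γ x * g x) := by
  refine le_antisymm (iInf₂_le g h) (le_iInf₂ fun g' h' => le_of_eq (luxNorm_congr ?_))
  exact (h.ae_unique h').mono fun x hx => by simp only [hx]

theorem weakNorm_congr {f f' : Eucl d → ℝ} (hf : f =ᵐ[volume] f') (γ α : Fin d → ℕ) (e : ℝ → ℝ) :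
    weakNorm γ α e f = weakNorm γ α e f' :=
  le_antisymm
    (le_iInf₂ fun g h => iInf₂_le g (h.congr hf.symm EventuallyEq.rfl))
    (le_iInf₂ fun g h => iInf₂_le g (h.congr hf EventuallyEq.rfl))

end Deriv

/-! ### Convolution with test functions -/

section Conv

variable {d : ℕ}

/-- The convolution `f * g` of real functions with respect to Lebesgue measure. -/
def conv (f g : Eucl d → ℝ) : Eucl d → ℝ :=
  convolution f g (ContinuousLinearMap.mul ℝ ℝ) volume

theorem conv_apply (f g : Eucl d → ℝ) (x : Eucl d) : conv f g x = ∫ t, f t * g (x - t) := rfl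

theorem conv_comm (f g : Eucl d → ℝ) : conv f g = conv g f := by
  funext x
  rw [conv, convolution_mul_swap, conv_apply]
  simp [mul_comm]

theorem contDiff_conv {f g : Eucl d → ℝ} (hf : LocallyIntegrable f) (hg : IsTest g) :
    ContDiff ℝ ∞ (conv f g) :=
  HasCompactSupport.contDiff_convolution_right (n := ⊤) _ hg.compact hf hg.smooth

theorem IsTest.conv {f g : Eucl d → ℝ} (hf : IsTest f) (hg : IsTest g) : IsTest (conv f g) :=
  ⟨contDiff_conv hf.continuous.locallyIntegrable hg,
    HasCompactSupport.convolution (ContinuousLinearMap.mul ℝ ℝ) (μ := volume)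
      hf.compact hg.compact⟩

theorem integrable_conv_integrand {f g : Eucl d → ℝ} (hf : LocallyIntegrable f)
    (hg : Continuous g) (hg' : HasCompactSupport g) (x : Eucl d) :
    Integrable (fun t => f t * g (x - t)) :=
  hg'.convolutionExists_right (ContinuousLinearMap.mul ℝ ℝ) hf hg x

theorem pderiv_conv {f g : Eucl d → ℝ} (hf : LocallyIntegrable f) (hg : IsTest g) (i : Fin d) :
    pderiv i (conv f g) = conv f (pderiv i g) := by
  funext x
  have h := hg.compact.hasFDerivAt_convolution_right (ContinuousLinearMap.mul ℝ ℝ) hf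
    (hg.smooth.of_le (by simp)) x
  simp only [pderiv, conv]
  rw [h.fderiv, convolution_precompR_apply _ hf (hg.compact.fderiv ℝ)
    (hg.smooth.continuous_fderiv (by simp))]
  rfl

theorem mderiv_conv {f g : Eucl d → ℝ} (hf : LocallyIntegrable f) (hg : IsTest g)
    (α : Fin d → ℕ) : mderiv α (conv f g) = conv f (mderiv α g) :=
  mderiv_comm_of_pderiv_comm (C := {g | IsTest g}) (T := fun g => conv f g)
    (fun i _ hu => hu.pderiv i) (fun i _ hu => pderiv_conv hf hu i) α hg

/-- Weak derivatives may be moved from the test function to the convolved function. -/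
theorem IsWeakDeriv.conv_eq {f g χ : Eucl d → ℝ} {α : Fin d → ℕ} (h : IsWeakDeriv α f g)
    (hχ : IsTest χ) : conv f (mderiv α χ) = conv g χ := by
  funext x
  have h1 := hχ.comp_sub_left x
  have h2 := h.2.2 _ h1.smooth h1.compact
  rw [mderiv_comp_sub_left hχ.smooth] at h2
  simp only [mul_left_comm _ ((-1 : ℝ) ^ _)] at h2
  rw [integral_const_mul] at h2
  exact mul_left_cancel₀ (pow_ne_zero _ (by norm_num)) h2

theorem mderiv_conv_left {f χ : Eucl d → ℝ} (hf : ContDiff ℝ ∞ f) (hχ : IsTest χ)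
    (α : Fin d → ℕ) : mderiv α (conv f χ) = conv (mderiv α f) χ := by
  rw [mderiv_conv hf.continuous.locallyIntegrable hχ, (isWeakDeriv_of_contDiff hf α).conv_eq hχ]

theorem pderiv_conv_left {f χ : Eucl d → ℝ} (hf : ContDiff ℝ ∞ f) (hχ : IsTest χ)
    (i : Fin d) : pderiv i (conv f χ) = conv (pderiv i f) χ := by
  simpa only [mderiv_single] using mderiv_conv_left hf hχ (Pi.single i 1)

theorem conv_assoc {f g k : Eucl d → ℝ} (hf : LocallyIntegrable f) (hg : IsTest g)
    (hk : IsTest k) : conv (conv f g) k = conv f (conv g k) := by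
  funext x
  set L := ContinuousLinearMap.mul ℝ ℝ with hL
  have hc : HasCompactSupport (convolution (fun x => ‖g x‖) (fun x => ‖k x‖) L volume) :=
    HasCompactSupport.convolution L hg.compact.norm hk.compact.norm
  have hcont : Continuous (convolution (fun x => ‖g x‖) (fun x => ‖k x‖) L volume) :=
    HasCompactSupport.continuous_convolution_right L hk.compact.norm
      hg.continuous.norm.locallyIntegrable hk.continuous.norm
  have hfn : LocallyIntegrable (fun x => ‖f x‖) volume :=
    hf.mono hf.aestronglyMeasurable.norm (Eventually.of_forall fun x => by simp)
  exact convolution_assoc L L L L (fun a b c => by simp [hL, mul_assoc]) hf.aestronglyMeasurable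
    hg.continuous.aestronglyMeasurable hk.continuous.aestronglyMeasurable
    (Eventually.of_forall fun y =>
      HasCompactSupport.convolutionExists_right L hg.compact hf hg.continuous y)
    (Eventually.of_forall fun y => HasCompactSupport.convolutionExists_right L hk.compact.norm
      hg.continuous.norm.locallyIntegrable hk.continuous.norm y)
    (HasCompactSupport.convolutionExists_right L hc hfn hcont x)

theorem conv_add_right {f g k : Eucl d → ℝ} (hf : LocallyIntegrable f) (hg : IsTest g)
    (hk : IsTest k) : conv f (fun x => g x + k x) = fun x => conv f g x + conv f k x := by
  funext x
  simp only [conv_apply, mul_add]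
  exact integral_add (integrable_conv_integrand hf hg.continuous hg.compact x)
    (integrable_conv_integrand hf hk.continuous hk.compact x)

theorem conv_sub_right {f g k : Eucl d → ℝ} (hf : LocallyIntegrable f) (hg : IsTest g)
    (hk : IsTest k) : conv f (fun x => g x - k x) = fun x => conv f g x - conv f k x := by
  funext x
  simp only [conv_apply, mul_sub]
  exact integral_sub (integrable_conv_integrand hf hg.continuous hg.compact x)
    (integrable_conv_integrand hf hk.continuous hk.compact x)

theorem conv_sub_left {f f' g : Eucl d → ℝ} (hf : LocallyIntegrable f) (hf' : LocallyIntegrable f')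
    (hg : IsTest g) : conv (fun x => f x - f' x) g = fun x => conv f g x - conv f' g x := by
  funext x
  simp only [conv_apply, sub_mul]
  exact integral_sub (integrable_conv_integrand hf hg.continuous hg.compact x)
    (integrable_conv_integrand hf' hg.continuous hg.compact x)

/-- A translation-invariant norm of `f * χ` is at most that of `f` times the `L¹` norm of `χ`. -/
theorem IsTransNorm.conv_le {P : (Eucl d → ℝ) → ℝ≥0∞} (hP : IsTransNorm P) {f χ : Eucl d → ℝ}
    (hf : Measurable f) (hχ : IsTest χ) : P (conv f χ) ≤ (∫⁻ x, ‖χ x‖ₑ) * P f := by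
  set ρ : Measure (Eucl d) := volume.withDensity fun y => ‖χ y‖ₑ with hρ
  have hu : ρ Set.univ = ∫⁻ x, ‖χ x‖ₑ := by
    rw [hρ, withDensity_apply _ MeasurableSet.univ, Measure.restrict_univ]
  have : IsFiniteMeasure ρ := ⟨by rw [hu]; exact hχ.integrable.2⟩
  refine (hP.mono _ (fun x => ∫ y, |f (x - y)| ∂ρ) fun x => ?_).trans ?_
  · rw [abs_of_nonneg (integral_nonneg fun y => abs_nonneg _), hρ,
      integral_withDensity_eq_integral_toReal_smul hχ.continuous.measurable.enorm
        (Eventually.of_forall fun _ => enorm_lt_top), conv_comm, conv_apply]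
    refine (abs_integral_le_integral_abs).trans (le_of_eq (integral_congr_ae ?_))
    exact Eventually.of_forall fun y => by simp [abs_mul]
  · refine (hP.avg ρ (fun x => |f x|) (continuous_abs.measurable.comp hf)).trans ?_
    rw [hu]
    gcongr
    exact hP.mono _ _ fun x => by simp

end Conv


/-! ### Mollifiers and kernels of high order -/

section Kernel

variable {d : ℕ}

/-- A smooth bump function centred at `0`, equal to `1` on the ball of radius `1 / (j + 2)` and
supported in the ball of radius `1 / (j + 1)`. -/
def mollBump (d j : ℕ) : ContDiffBump (0 : Eucl d) where
  rIn := 1 / (j + 2)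
  rOut := 1 / (j + 1)
  rIn_pos := by positivity
  rIn_lt_rOut := one_div_lt_one_div_of_lt (by positivity) (by linarith)

/-- The mollifiers: even nonnegative test functions of integral `1`, the `j`-th one supported in
the ball of radius `1 / (j + 1)`. -/
def moll (d j : ℕ) : Eucl d → ℝ := (mollBump d j).normed volume

theorem isTest_moll (j : ℕ) : IsTest (moll d j) :=
  ⟨(mollBump d j).contDiff_normed, (mollBump d j).hasCompactSupport_normed⟩

theorem moll_nonneg (j : ℕ) (x : Eucl d) : 0 ≤ moll d j x := (mollBump d j).nonneg_normed x

theorem moll_neg (j : ℕ) (x : Eucl d) : moll d j (-x) = moll d j x := (mollBump d j).normed_neg x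

theorem integral_moll (j : ℕ) : ∫ x, moll d j x = 1 := (mollBump d j).integral_normed

theorem lintegral_moll (j : ℕ) : ∫⁻ x, ‖moll d j x‖ₑ = 1 := by
  have := ofReal_integral_eq_lintegral_ofReal (isTest_moll (d := d) j).integrable
    (Eventually.of_forall (moll_nonneg j))
  rw [integral_moll, ENNReal.ofReal_one] at this
  rw [this]
  refine lintegral_congr fun x => ?_
  rw [Real.enorm_eq_ofReal_abs, abs_of_nonneg (moll_nonneg j x)]

theorem norm_le_of_moll_ne_zero {x : Eucl d} (hx : moll d 0 x ≠ 0) : ‖x‖ ≤ 1 := by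
  have : x ∈ Function.support ((mollBump d 0).normed volume) := hx
  rw [(mollBump d 0).support_normed_eq] at this
  simpa [mollBump] using (mem_ball_zero_iff.1 this).le

theorem tendsto_conv_moll {g : Eucl d → ℝ} (hg : Continuous g) (x : Eucl d) :
    Tendsto (fun j => conv g (moll d j) x) atTop (𝓝 (g x)) := by
  have h0 : Tendsto (fun j => (mollBump d j).rOut) atTop (𝓝 0) :=
    tendsto_one_div_add_atTop_nhds_zero_nat
  have := ContDiffBump.convolution_tendsto_right_of_continuous (μ := volume) h0 hg x
  refine this.congr fun j => ?_
  rw [conv_comm]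
  rfl

/-- The `L¹`-normalized dilation `δ^{-d} χ(x / δ)`. -/
def dil (δ : ℝ) (χ : Eucl d → ℝ) : Eucl d → ℝ := fun x => (δ ^ d)⁻¹ * χ (δ⁻¹ • x)

theorem IsTest.dil {χ : Eucl d → ℝ} (hχ : IsTest χ) {δ : ℝ} (hδ : 0 < δ) : IsTest (dil δ χ) := by
  have := (hχ.comp_affine (inv_pos.2 hδ).ne' 0).const_mul (δ ^ d)⁻¹
  simp only [add_zero] at this
  exact this

theorem mderiv_dil {χ : Eucl d → ℝ} (hχ : ContDiff ℝ ∞ χ) (δ : ℝ) (α : Fin d → ℕ) :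
    mderiv α (dil δ χ) = fun x => (δ⁻¹) ^ (∑ i, α i) * dil δ (mderiv α χ) x := by
  have := mderiv_comp_affine hχ α δ⁻¹ 0
  simp only [add_zero] at this
  have h2 : dil δ χ = fun x => (δ ^ d)⁻¹ * χ (δ⁻¹ • x) := rfl
  rw [h2, mderiv_const_mul, this]
  funext x
  simp only [dil]
  ring

theorem integral_dil {χ : Eucl d → ℝ} {δ : ℝ} (hδ : 0 < δ) : ∫ x, dil δ χ x = ∫ x, χ x := by
  simp only [dil]
  rw [integral_const_mul, Measure.integral_comp_inv_smul]
  simp [abs_of_pos hδ]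
  field_simp

theorem lintegral_dil {χ : Eucl d → ℝ} (hχ : IsTest χ) {δ : ℝ} (hδ : 0 < δ) :
    ∫⁻ x, ‖dil δ χ x‖ₑ = ∫⁻ x, ‖χ x‖ₑ := by
  have h1 := ofReal_integral_norm_eq_lintegral_enorm (hχ.dil hδ).integrable
  have h2 := ofReal_integral_norm_eq_lintegral_enorm hχ.integrable
  rw [← h1, ← h2, ← integral_dil (χ := fun x => ‖χ x‖) hδ]
  congr 2
  funext x
  simp [dil, abs_of_pos hδ]

theorem conv_dil (a b : Eucl d → ℝ) {δ : ℝ} (hδ : 0 < δ) :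
    conv (dil δ a) (dil δ b) = dil δ (conv a b) := by
  funext x
  have h := integral_dil (χ := fun u => a u * ((δ ^ d)⁻¹ * b (δ⁻¹ • x - u))) hδ
  simp only [dil, conv_apply] at h ⊢
  rw [← integral_const_mul]
  simp only [smul_sub]
  simp only [mul_left_comm _ ((δ ^ d)⁻¹)] at h ⊢
  rw [← h]
  congr 1
  funext t
  ring

/-- Kernels of order `j` built from `φ`: if `T` is convolution with `φ` then convolution with
`kern φ j` is `1 - (1 - T)^j`. -/
def kern (φ : Eucl d → ℝ) : ℕ → Eucl d → ℝ
  | 0 => fun _ => 0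
  | j + 1 => fun x => φ x + kern φ j x - conv φ (kern φ j) x

/-- The residual `g - g * φ` of mollification. -/
def resid (φ g : Eucl d → ℝ) : Eucl d → ℝ := fun x => g x - conv g φ x

theorem isTest_kern {φ : Eucl d → ℝ} (hφ : IsTest φ) (j : ℕ) : IsTest (kern φ j) := by
  induction j with
  | zero => exact ⟨contDiff_const, HasCompactSupport.zero⟩
  | succ j ih => exact (hφ.add ih).sub (hφ.conv ih)

theorem kern_dil (φ : Eucl d → ℝ) {δ : ℝ} (hδ : 0 < δ) (j : ℕ) :
    kern (dil δ φ) j = dil δ (kern φ j) := by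
  induction j with
  | zero => funext x; simp [kern, dil]
  | succ j ih =>
    funext x
    simp only [kern]
    rw [ih, conv_dil _ _ hδ]
    simp only [dil]
    ring

theorem conv_even {f g : Eucl d → ℝ} (hf : ∀ x, f (-x) = f x) (hg : ∀ x, g (-x) = g x)
    (x : Eucl d) : conv f g (-x) = conv f g x := by
  rw [conv_apply, conv_apply, ← integral_neg_eq_self]
  congr 1
  funext t
  rw [hf, ← hg (x - t)]
  congr 2
  abel

theorem kern_even {φ : Eucl d → ℝ} (hφ : ∀ x, φ (-x) = φ x) (j : ℕ) (x : Eucl d) :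
    kern φ j (-x) = kern φ j x := by
  induction j generalizing x with
  | zero => rfl
  | succ j ih => simp only [kern, hφ, ih, conv_even hφ ih]

theorem locallyIntegrable_resid {φ g : Eucl d → ℝ} (hφ : IsTest φ) (hg : LocallyIntegrable g) :
    LocallyIntegrable (resid φ g) := hg.sub (contDiff_conv hg hφ).continuous.locallyIntegrable

theorem contDiff_resid {φ g : Eucl d → ℝ} (hφ : IsTest φ) (hg : ContDiff ℝ ∞ g) :
    ContDiff ℝ ∞ (resid φ g) := hg.sub (contDiff_conv hg.continuous.locallyIntegrable hφ)

theorem contDiff_resid_iterate {φ g : Eucl d → ℝ} (hφ : IsTest φ) (hg : ContDiff ℝ ∞ g) (j : ℕ) :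
    ContDiff ℝ ∞ ((resid φ)^[j] g) := by
  induction j generalizing g with
  | zero => exact hg
  | succ j ih => exact ih (contDiff_resid hφ hg)

/-- The defining property of the kernels: the error of approximation by `kern φ j` is the `j`-fold
residual of mollification by `φ`. -/
theorem sub_conv_kern {φ g : Eucl d → ℝ} (hφ : IsTest φ) (hg : LocallyIntegrable g) (j : ℕ) :
    (fun x => g x - conv g (kern φ j) x) = (resid φ)^[j] g := by
  induction j generalizing g with
  | zero => funext x; simp [kern, conv_apply]
  | succ j ih =>
    have hk := isTest_kern hφ j
    rw [Function.iterate_succ_apply, ← ih (locallyIntegrable_resid hφ hg)]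
    funext x
    have h1 : conv g (kern φ (j + 1)) x =
        conv g φ x + conv g (kern φ j) x - conv g (conv φ (kern φ j)) x := by
      rw [show kern φ (j + 1) = fun x => φ x + kern φ j x - conv φ (kern φ j) x from rfl,
        conv_sub_right hg (hφ.add hk) (hφ.conv hk), conv_add_right hg hφ hk]
    have h2 : conv (resid φ g) (kern φ j) x =
        conv g (kern φ j) x - conv g (conv φ (kern φ j)) x := by
      rw [← conv_assoc hg hφ hk]
      exact congrFun (conv_sub_left hg (contDiff_conv hg hφ).continuous.locallyIntegrable hk) x
    rw [h1, h2, resid]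
    ring

theorem pderiv_sub {f g : Eucl d → ℝ} (hf : ContDiff ℝ ∞ f) (hg : ContDiff ℝ ∞ g) (i : Fin d) :
    pderiv i (fun x => f x - g x) = fun x => pderiv i f x - pderiv i g x := by
  funext x
  simp only [pderiv]
  rw [fderiv_fun_sub (hf.differentiable (by simp)).differentiableAt
    (hg.differentiable (by simp)).differentiableAt]
  rfl

theorem mderiv_sub {f g : Eucl d → ℝ} (hf : ContDiff ℝ ∞ f) (hg : ContDiff ℝ ∞ g)
    (α : Fin d → ℕ) :
    mderiv α (fun x => f x - g x) = fun x => mderiv α f x - mderiv α g x := by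
  have hiter : ∀ (i : Fin d) (n : ℕ) (f g : Eucl d → ℝ), ContDiff ℝ ∞ f → ContDiff ℝ ∞ g →
      ContDiff ℝ ∞ ((pderiv i)^[n] f) ∧ ContDiff ℝ ∞ ((pderiv i)^[n] g) ∧
      (pderiv i)^[n] (fun x => f x - g x) = fun x => (pderiv i)^[n] f x - (pderiv i)^[n] g x := by
    intro i n
    induction n with
    | zero => exact fun f g hf hg => ⟨hf, hg, rfl⟩
    | succ n ih =>
      intro f g hf hg
      simp only [Function.iterate_succ_apply]
      rw [pderiv_sub hf hg]
      exact ih _ _ (contDiff_pderiv hf i) (contDiff_pderiv hg i)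
  have main : ∀ l : List (Fin d),
      ContDiff ℝ ∞ (l.foldr (fun i g => (pderiv i)^[α i] g) f) ∧
      ContDiff ℝ ∞ (l.foldr (fun i g => (pderiv i)^[α i] g) g) ∧
      l.foldr (fun i g => (pderiv i)^[α i] g) (fun x => f x - g x) = fun x =>
        l.foldr (fun i g => (pderiv i)^[α i] g) f x -
        l.foldr (fun i g => (pderiv i)^[α i] g) g x := by
    intro l
    induction l with
    | nil => exact ⟨hf, hg, rfl⟩
    | cons a l ih =>
      simp only [List.foldr_cons]
      rw [ih.2.2]
      exact hiter a _ _ _ ih.1 ih.2.1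
  exact (main _).2.2

theorem pderiv_resid {φ g : Eucl d → ℝ} (hφ : IsTest φ) (hg : ContDiff ℝ ∞ g) (i : Fin d) :
    pderiv i (resid φ g) = resid φ (pderiv i g) := by
  unfold resid
  rw [pderiv_sub hg (contDiff_conv hg.continuous.locallyIntegrable hφ), pderiv_conv_left hg hφ]

theorem pderiv_resid_iterate {φ g : Eucl d → ℝ} (hφ : IsTest φ) (hg : ContDiff ℝ ∞ g) (i : Fin d)
    (j : ℕ) : pderiv i ((resid φ)^[j] g) = (resid φ)^[j] (pderiv i g) := by
  induction j generalizing g with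
  | zero => rfl
  | succ j ih =>
    rw [Function.iterate_succ_apply, Function.iterate_succ_apply, ih (contDiff_resid hφ hg),
      pderiv_resid hφ hg]

theorem IsTransNorm.sum_le {P : (Eucl d → ℝ) → ℝ≥0∞} (hP : IsTransNorm P) {ι : Type*}
    (s : Finset ι) {f : ι → Eucl d → ℝ} (hf : ∀ i, Measurable (f i)) :
    P (fun x => ∑ i ∈ s, f i x) ≤ ∑ i ∈ s, P (f i) := by
  classical
  induction s using Finset.induction_on with
  | empty => simp [hP.zero]
  | insert a s ha ih =>
    simp only [Finset.sum_insert ha]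
    exact (hP.add _ _ (hf a)).trans (by gcongr)

theorem abs_apply_le_norm (y : Eucl d) (i : Fin d) : |y i| ≤ ‖y‖ := by
  have := EuclideanSpace.norm_eq y
  rw [this]
  refine Real.abs_le_sqrt ?_
  have h := Finset.single_le_sum (f := fun i => ‖y i‖ ^ 2) (fun j _ => sq_nonneg _)
    (Finset.mem_univ i)
  simpa using h

theorem fderiv_apply_eq_sum (f : Eucl d → ℝ) (x y : Eucl d) :
    fderiv ℝ f x y = ∑ i, y i * pderiv i f x := by
  have hy : y = ∑ i, y i • EuclideanSpace.single i (1 : ℝ) := by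
    ext j
    simp [Finset.sum_apply, Pi.single_apply]
  conv_lhs => rw [hy]
  simp [map_sum, pderiv]

/-- Mollification at scale `r` is accurate to first order: the residual is an average of translates
of the gradient, by the fundamental theorem of calculus along segments. -/
theorem IsTransNorm.resid_le {P : (Eucl d → ℝ) → ℝ≥0∞} (hP : IsTransNorm P) {φ g : Eucl d → ℝ}
    (hφ : IsTest φ) (hφ0 : ∀ x, 0 ≤ φ x) (hφ1 : ∫ x, φ x = 1) {r : ℝ} (hr : 0 < r)
    (hφr : ∀ x, φ x ≠ 0 → ‖x‖ ≤ r) (hg : ContDiff ℝ ∞ g) :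
    P (resid φ g) ≤ ENNReal.ofReal r * ∑ i, P (pderiv i g) := by
  set ρ₁ : Measure (Eucl d) := volume.withDensity fun y => ENNReal.ofReal (φ y) with hρ₁
  set K : Set (Eucl d) := Metric.closedBall 0 r with hK
  have hKc : IsCompact K := isCompact_closedBall _ _
  have hρ₁u : ρ₁ Set.univ = 1 := by
    rw [hρ₁, withDensity_apply _ MeasurableSet.univ, Measure.restrict_univ,
      ← ofReal_integral_eq_lintegral_ofReal hφ.integrable (Eventually.of_forall hφ0), hφ1,
      ENNReal.ofReal_one]
  have hprob : IsProbabilityMeasure ρ₁ := ⟨hρ₁u⟩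
  have hρ₁K : ρ₁.restrict K = ρ₁ := by
    refine Measure.restrict_eq_self_of_ae_mem ?_
    rw [hρ₁, ae_withDensity_iff hφ.continuous.measurable.ennreal_ofReal]
    refine Eventually.of_forall fun y hy => ?_
    rw [hK, mem_closedBall_zero_iff]
    exact hφr y fun h => hy (by simp [h])
  -- `ρ` is the law of `t • y`, with `y` of density `φ` and `t` uniform in `[0, 1]`
  set Q : Measure (Eucl d × ℝ) := (ρ₁.prod volume).restrict (K ×ˢ Set.Icc 0 1) with hQ
  have hQu : Q Set.univ ≤ 1 := by
    rw [hQ, Measure.restrict_apply_univ, Measure.prod_prod, Real.volume_Icc]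
    simpa using prob_le_one
  have hQf : IsFiniteMeasure Q := ⟨hQu.trans_lt ENNReal.one_lt_top⟩
  have hQi : ∀ F : Eucl d × ℝ → ℝ, Continuous F → Integrable F Q := fun F hF =>
    hF.continuousOn.integrableOn_compact (hKc.prod isCompact_Icc)
  set ρ : Measure (Eucl d) := Q.map fun p => p.2 • p.1 with hρ
  have hmeas : Measurable fun p : Eucl d × ℝ => p.2 • p.1 := by fun_prop
  have hρf : IsFiniteMeasure ρ := Measure.isFiniteMeasure_map Q _
  have hρu : ρ Set.univ ≤ 1 := by
    rw [hρ, Measure.map_apply hmeas MeasurableSet.univ, Set.preimage_univ]; exact hQu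
  have hgi : ∀ i, Continuous (pderiv i g) := fun i => (contDiff_pderiv hg i).continuous
  -- the residual as an average over the segments `[x - y, x]`
  have hrep : ∀ x, resid φ g x = ∫ p, ∑ i, p.1 i * pderiv i g (x - p.2 • p.1) ∂Q := by
    intro x
    have hcont : Continuous fun p : Eucl d × ℝ => ∑ i, p.1 i * pderiv i g (x - p.2 • p.1) := by
      refine continuous_finsetSum _ fun i _ => ?_
      have := hgi i
      fun_prop
    rw [hQ, setIntegral_prod _ (hQi _ hcont)]
    have hin : ∀ y : Eucl d, ∫ t in Set.Icc (0 : ℝ) 1, ∑ i, y i * pderiv i g (x - t • y) =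
        g x - g (x - y) := by
      intro y
      rw [integral_Icc_eq_integral_Ioc, ← intervalIntegral.integral_of_le zero_le_one]
      have hder : ∀ t : ℝ, HasDerivAt (fun t : ℝ => -g (x - t • y))
          (∑ i, y i * pderiv i g (x - t • y)) t := by
        intro t
        have h1 : HasDerivAt (fun t : ℝ => x - t • y) (-y) t := by
          simpa using ((hasDerivAt_id t).smul_const y).const_sub x
        have h2 : HasFDerivAt g (fderiv ℝ g (x - t • y)) (x - t • y) :=
          (hg.differentiable (by simp)).differentiableAt.hasFDerivAt
        have h3 := (h2.comp_hasDerivAt t h1).neg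
        rw [map_neg, neg_neg, fderiv_apply_eq_sum] at h3
        exact h3
      have hc : Continuous fun t : ℝ => ∑ i, y i * pderiv i g (x - t • y) :=
        hcont.comp (by fun_prop : Continuous fun t : ℝ => (y, t))
      rw [intervalIntegral.integral_eq_sub_of_hasDerivAt (fun t _ => hder t)
        (hc.intervalIntegrable 0 1)]
      simp
      ring
    simp only [hin]
    rw [hρ₁K]
    have hgc : Continuous fun y => g (x - y) := hg.continuous.comp (continuous_const.sub continuous_id)
    have hgint : Integrable (fun y => g (x - y)) ρ₁ := by
      rw [← hρ₁K]; exact hgc.continuousOn.integrableOn_compact hKc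
    rw [integral_sub (integrable_const _) hgint, integral_const, probReal_univ, one_smul, resid,
      conv_comm, conv_apply, hρ₁, integral_withDensity_eq_integral_toReal_smul
        hφ.continuous.measurable.ennreal_ofReal (Eventually.of_forall fun _ => ENNReal.ofReal_lt_top)]
    congr 2
    funext y
    rw [ENNReal.toReal_ofReal (hφ0 y), smul_eq_mul]
  set A : Fin d → Eucl d → ℝ := fun i x => ∫ z, |pderiv i g (x - z)| ∂ρ with hA
  have hAm : ∀ i, Measurable (A i) := fun i => by
    refine StronglyMeasurable.measurable ?_
    refine StronglyMeasurable.integral_prod_right' (f := fun p : Eucl d × Eucl d =>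
      |pderiv i g (p.1 - p.2)|) ?_
    exact ((hgi i).comp (continuous_fst.sub continuous_snd)).abs.stronglyMeasurable
  have hbound : ∀ x, |resid φ g x| ≤ |r * ∑ i, A i x| := by
    intro x
    have hAx : ∀ i, A i x = ∫ p, |pderiv i g (x - p.2 • p.1)| ∂Q := fun i => by
      rw [hA, hρ]
      refine integral_map hmeas.aemeasurable ?_
      exact ((hgi i).comp (continuous_const.sub continuous_id)).abs.aestronglyMeasurable
    refine le_trans ?_ (le_abs_self _)
    have hci : ∀ i, Continuous fun p : Eucl d × ℝ => |pderiv i g (x - p.2 • p.1)| := fun i => by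
      have := hgi i
      fun_prop
    simp only [hAx]
    rw [hrep, ← integral_finsetSum _ (fun i _ => hQi _ (hci i)), ← integral_const_mul]
    refine abs_integral_le_integral_abs.trans (integral_mono_ae ?_ ?_ ?_)
    · refine (hQi _ ?_).abs
      refine continuous_finsetSum _ fun i _ => ?_
      have := hgi i
      fun_prop
    · exact (hQi _ (continuous_finsetSum _ fun i _ => hci i)).const_mul _
    · have hae : ∀ᵐ p ∂Q, p ∈ K ×ˢ Set.Icc (0 : ℝ) 1 :=
        ae_restrict_mem (hKc.prod isCompact_Icc).measurableSet
      filter_upwards [hae] with p hp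
      have hp1 : ‖p.1‖ ≤ r := mem_closedBall_zero_iff.1 hp.1
      refine (Finset.abs_sum_le_sum_abs _ _).trans ?_
      rw [Finset.mul_sum]
      refine Finset.sum_le_sum fun i _ => ?_
      rw [abs_mul]
      exact mul_le_mul_of_nonneg_right ((abs_apply_le_norm _ i).trans hp1) (abs_nonneg _)
  refine (hP.mono _ _ hbound).trans ((hP.smul _ _).trans ?_)
  rw [abs_of_pos hr]
  gcongr
  refine (hP.sum_le _ hAm).trans (Finset.sum_le_sum fun i _ => ?_)
  refine (hP.avg ρ (fun x => |pderiv i g x|) (hgi i).abs.measurable).trans ?_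
  calc ρ Set.univ * P (fun x => |pderiv i g x|) ≤ 1 * P (pderiv i g) := by
        gcongr
        exact hP.mono _ _ fun x => by simp
    _ = _ := one_mul _

/-- Iterating the first-order estimate: the `j`-fold residual is accurate to order `j`. -/
theorem IsTransNorm.resid_iterate_le {P : (Eucl d → ℝ) → ℝ≥0∞} (hP : IsTransNorm P)
    {φ g : Eucl d → ℝ} (hφ : IsTest φ) (hφ0 : ∀ x, 0 ≤ φ x) (hφ1 : ∫ x, φ x = 1) {r : ℝ}
    (hr : 0 < r) (hφr : ∀ x, φ x ≠ 0 → ‖x‖ ≤ r) (hg : ContDiff ℝ ∞ g) {n : ℕ} {B : ℝ≥0∞}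
    (hB : ∀ β : Fin d → ℕ, ∑ i, β i ≤ n → P (mderiv β g) ≤ B) (j : ℕ) (α : Fin d → ℕ)
    (hα : ∑ i, α i + j ≤ n) :
    P ((resid φ)^[j] (mderiv α g)) ≤ (ENNReal.ofReal r * d) ^ j * B := by
  induction j generalizing α with
  | zero => simpa using hB α (by omega)
  | succ j ih =>
    have hsm := contDiff_mderiv hg α
    rw [Function.iterate_succ_apply']
    refine (hP.resid_le hφ hφ0 hφ1 hr hφr (contDiff_resid_iterate hφ hsm j)).trans ?_
    calc ENNReal.ofReal r * ∑ i, P (pderiv i ((resid φ)^[j] (mderiv α g)))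
        ≤ ENNReal.ofReal r * ∑ _i : Fin d, (ENNReal.ofReal r * d) ^ j * B := by
          gcongr with i
          rw [pderiv_resid_iterate hφ hsm, ← mderiv_single i (mderiv α g), ← mderiv_add hg]
          refine ih _ ?_
          simp only [Pi.add_apply, Finset.sum_add_distrib, Finset.sum_pi_single', Finset.mem_univ,
            if_true]
          omega
      _ = _ := by
          rw [Finset.sum_const, Finset.card_univ, Fintype.card_fin, nsmul_eq_mul]
          ring

end Kernel


/-! ### Signed measures as functionals -/

section Signed

variable {d : ℕ}

/-- The pairing `∫ φ dμ` of a function with a signed measure. -/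
def spair (μ : SignedMeasure (Eucl d)) (φ : Eucl d → ℝ) : ℝ := ∫ᵛ x, φ x ∂<•μ

theorem integrable_of_continuous_of_bound (a : Measure (Eucl d)) [IsFiniteMeasure a]
    {φ : Eucl d → ℝ} (hφ : Continuous φ) {B : ℝ} (hB : ∀ x, |φ x| ≤ B) : Integrable φ a :=
  Integrable.of_bound hφ.aestronglyMeasurable B (Eventually.of_forall hB)

theorem spair_toSignedMeasure_sub (a b : Measure (Eucl d)) [IsFiniteMeasure a] [IsFiniteMeasure b]
    {φ : Eucl d → ℝ} (hφ : Continuous φ) {B : ℝ} (hB : ∀ x, |φ x| ≤ B) :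
    spair (a.toSignedMeasure - b.toSignedMeasure) φ = ∫ x, φ x ∂a - ∫ x, φ x ∂b := by
  rw [spair, VectorMeasure.integral_sub_vectorMeasure]
  · simp
  · rw [VectorMeasure.Integrable, Measure.variation_toSignedMeasure]
    exact integrable_of_continuous_of_bound a hφ hB
  · rw [VectorMeasure.Integrable, Measure.variation_toSignedMeasure]
    exact integrable_of_continuous_of_bound b hφ hB

/-- The pairing as a difference of Bochner integrals over the Jordan decomposition. -/
theorem spair_eq (μ : SignedMeasure (Eucl d)) {φ : Eucl d → ℝ} (hφ : Continuous φ) {B : ℝ}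
    (hB : ∀ x, |φ x| ≤ B) :
    spair μ φ = ∫ x, φ x ∂μ.toJordanDecomposition.posPart -
      ∫ x, φ x ∂μ.toJordanDecomposition.negPart := by
  rw [← spair_toSignedMeasure_sub _ _ hφ hB]
  conv_lhs => rw [← μ.toSignedMeasure_toJordanDecomposition]
  rfl

theorem spair_withDensity {p : Eucl d → ℝ} (hp : Integrable p) {φ : Eucl d → ℝ}
    (hφ : Continuous φ) {B : ℝ} (hB : ∀ x, |φ x| ≤ B) :
    spair (volume.withDensityᵥ p) φ = ∫ x, p x * φ x := by
  have h1 := isFiniteMeasure_withDensity_ofReal hp.2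
  have h2 := isFiniteMeasure_withDensity_ofReal hp.neg.2
  have hm := hp.1.aemeasurable
  have hB' : ∀ᵐ x ∂(volume : Measure (Eucl d)), ‖φ x‖ ≤ B := Eventually.of_forall hB
  simp only [Pi.neg_apply] at h2
  rw [withDensityᵥ_eq_withDensity_pos_part_sub_withDensity_neg_part hp,
    spair_toSignedMeasure_sub _ _ hφ hB,
    integral_withDensity_eq_integral_toReal_smul₀ hm.ennreal_ofReal
      (Eventually.of_forall fun _ => ENNReal.ofReal_lt_top),
    integral_withDensity_eq_integral_toReal_smul₀ (f := fun x => ENNReal.ofReal (-p x))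
      hm.neg.ennreal_ofReal
      (Eventually.of_forall fun _ => ENNReal.ofReal_lt_top), ← integral_sub]
  · refine integral_congr_ae (Eventually.of_forall fun x => ?_)
    simp only [smul_eq_mul, ← sub_mul]
    congr 1
    rcases le_total 0 (p x) with h | h
    · rw [ENNReal.toReal_ofReal h, ENNReal.ofReal_of_nonpos (by linarith)]; simp
    · rw [ENNReal.toReal_ofReal (by linarith : 0 ≤ -p x), ENNReal.ofReal_of_nonpos h]; simp
  · exact (hp.real_toNNReal).mul_bdd hφ.aestronglyMeasurable hB'
  · exact (hp.neg.real_toNNReal).mul_bdd hφ.aestronglyMeasurable hB'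

theorem spair_sub (μ : SignedMeasure (Eucl d)) {φ ψ : Eucl d → ℝ} (hφ : Continuous φ)
    (hψ : Continuous ψ) {B B' : ℝ} (hB : ∀ x, |φ x| ≤ B) (hB' : ∀ x, |ψ x| ≤ B') :
    spair μ (fun x => φ x - ψ x) = spair μ φ - spair μ ψ := by
  rw [spair_eq μ (φ := fun x => φ x - ψ x) (B := B + B') (hφ.sub hψ)
    (fun x => (abs_sub _ _).trans (add_le_add (hB x) (hB' x))), spair_eq μ hφ hB, spair_eq μ hψ hB',
    integral_sub, integral_sub]
  · ring
  all_goals exact integrable_of_continuous_of_bound _ ‹_› ‹_›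

theorem spair_const_mul (μ : SignedMeasure (Eucl d)) (c : ℝ) (φ : Eucl d → ℝ) :
    spair μ (fun x => c * φ x) = c * spair μ φ := by
  simpa [spair] using VectorMeasure.integral_fun_smul μ (ContinuousLinearMap.lsmul ℝ ℝ).flip c φ

/-- The total mass of a signed measure. -/
def mass (μ : SignedMeasure (Eucl d)) : ℝ :=
  μ.toJordanDecomposition.posPart.real Set.univ + μ.toJordanDecomposition.negPart.real Set.univ

theorem abs_spair_le (μ : SignedMeasure (Eucl d)) {φ : Eucl d → ℝ} (hφ : Continuous φ) {B : ℝ}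
    (hB : ∀ x, |φ x| ≤ B) : |spair μ φ| ≤ B * mass μ := by
  rw [spair_eq μ hφ hB, mass, mul_add]
  have hB' : ∀ x, ‖φ x‖ ≤ B := hB
  refine (abs_sub _ _).trans (add_le_add ?_ ?_) <;>
  exact norm_integral_le_of_norm_le_const (Eventually.of_forall hB')

/-- The convolution `μ * χ` of a signed measure with a function. -/
def sconv (μ : SignedMeasure (Eucl d)) (χ : Eucl d → ℝ) : Eucl d → ℝ :=
  fun x => spair μ fun y => χ (x - y)

theorem sconv_eq (μ : SignedMeasure (Eucl d)) {χ : Eucl d → ℝ} (hχ : IsTest χ) (x : Eucl d) :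
    sconv μ χ x = ∫ y, χ (x - y) ∂μ.toJordanDecomposition.posPart -
      ∫ y, χ (x - y) ∂μ.toJordanDecomposition.negPart := by
  obtain ⟨B, -, hB⟩ := hχ.exists_bound
  exact spair_eq μ (hχ.comp_sub_left x).continuous (fun y => hB _)

theorem measurable_integral_sub (a : Measure (Eucl d)) [IsFiniteMeasure a] {χ : Eucl d → ℝ}
    (hχ : Continuous χ) : Measurable fun x => ∫ y, χ (x - y) ∂a := by
  refine StronglyMeasurable.measurable ?_
  exact StronglyMeasurable.integral_prod_right' (f := fun p : Eucl d × Eucl d => χ (p.1 - p.2))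
    (hχ.comp (continuous_fst.sub continuous_snd)).stronglyMeasurable

theorem measurable_sconv (μ : SignedMeasure (Eucl d)) {χ : Eucl d → ℝ} (hχ : IsTest χ) :
    Measurable (sconv μ χ) := by
  simp_rw [funext (sconv_eq μ hχ)]
  exact (measurable_integral_sub _ hχ.continuous).sub (measurable_integral_sub _ hχ.continuous)

theorem abs_sconv_le (μ : SignedMeasure (Eucl d)) {χ : Eucl d → ℝ} (hχ : IsTest χ) {B : ℝ}
    (hB : ∀ x, |χ x| ≤ B) (x : Eucl d) : |sconv μ χ x| ≤ B * mass μ :=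
  abs_spair_le μ (hχ.comp_sub_left x).continuous fun _ => hB _

theorem sconv_sub (μ : SignedMeasure (Eucl d)) {χ ψ : Eucl d → ℝ} (hχ : IsTest χ)
    (hψ : IsTest ψ) (x : Eucl d) :
    sconv μ (fun y => χ y - ψ y) x = sconv μ χ x - sconv μ ψ x := by
  obtain ⟨B, -, hB⟩ := hχ.exists_bound
  obtain ⟨B', -, hB'⟩ := hψ.exists_bound
  exact spair_sub μ (hχ.comp_sub_left x).continuous (hψ.comp_sub_left x).continuous
    (fun _ => hB _) (fun _ => hB' _)

theorem luxNorm_sconv_lt_top {e : ℝ → ℝ} (he : IsYoung e) (μ : SignedMeasure (Eucl d))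
    {χ : Eucl d → ℝ} (hχ : IsTest χ) : luxNorm e (sconv μ χ) < ⊤ := by
  obtain ⟨B, -, hB⟩ := hχ.exists_bound
  set ρ := μ.toJordanDecomposition.posPart + μ.toJordanDecomposition.negPart with hρ
  have hi : ∀ (a : Measure (Eucl d)) [IsFiniteMeasure a] (x : Eucl d),
      Integrable (fun y => |χ (x - y)|) a := fun a _ x =>
    integrable_of_continuous_of_bound a (hχ.comp_sub_left x).continuous.abs
      (fun y => by simpa using hB (x - y))
  calc luxNorm e (sconv μ χ) ≤ luxNorm e (fun x => ∫ y, |χ (x - y)| ∂ρ) := by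
        refine luxNorm_mono he (Eventually.of_forall fun x => ?_)
        rw [abs_of_nonneg (integral_nonneg fun y => abs_nonneg _), sconv_eq μ hχ, hρ,
          integral_add_measure (hi _ x) (hi _ x)]
        exact (abs_sub _ _).trans
          (add_le_add abs_integral_le_integral_abs abs_integral_le_integral_abs)
    _ ≤ ρ Set.univ * luxNorm e (fun x => |χ x|) :=
        luxNorm_avg_le he ρ (F := fun x => |χ x|) hχ.continuous.abs.measurable
    _ < ⊤ := by
        refine ENNReal.mul_lt_top (measure_lt_top _ _) ?_
        exact luxNorm_lt_top_of_integrable he hχ.integrable.abs (B := B) (by simpa using hB)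

theorem integrable_prod_mul_sub (a : Measure (Eucl d)) [IsFiniteMeasure a] {h χ : Eucl d → ℝ}
    (hh : Measurable h) {B : ℝ} (hB : ∀ x, |h x| ≤ B) (hχ : IsTest χ) :
    Integrable (fun p : Eucl d × Eucl d => h p.1 * χ (p.1 - p.2)) (volume.prod a) := by
  have h1 : Integrable (fun p : Eucl d × Eucl d => χ (p.1 - p.2)) (volume.prod a) := by
    have hc : Continuous fun p : Eucl d × Eucl d => χ (p.1 - p.2) :=
      hχ.continuous.comp (continuous_fst.sub continuous_snd)
    rw [integrable_prod_iff' hc.aestronglyMeasurable]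
    refine ⟨Eventually.of_forall fun y => hχ.integrable.comp_sub_right y, ?_⟩
    have : ∀ y : Eucl d, ∫ x, ‖χ (x - y)‖ = ∫ x, ‖χ x‖ := fun y =>
      integral_sub_right_eq_self (fun x => ‖χ x‖) y
    simp only [this]
    exact integrable_const _
  exact h1.bdd_mul (hh.comp measurable_fst).aestronglyMeasurable
    (Eventually.of_forall fun p => hB p.1)

/-- Fubini's theorem for the convolution of a signed measure with a test function. -/
theorem integral_mul_sconv (μ : SignedMeasure (Eucl d)) {h χ : Eucl d → ℝ}
    (hh : Measurable h) {B : ℝ} (hB : ∀ x, |h x| ≤ B) (hχ : IsTest χ) :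
    Integrable (fun x => h x * sconv μ χ x) ∧
    ∫ x, h x * sconv μ χ x = spair μ fun y => ∫ x, h x * χ (x - y) := by
  have hB0 : 0 ≤ B := (abs_nonneg _).trans (hB 0)
  have hrefl : IsTest fun x => χ (-x) := by simpa using hχ.comp_sub_left 0
  have hloc : LocallyIntegrable h :=
    (locallyIntegrable_const B).mono hh.aestronglyMeasurable
      (Eventually.of_forall fun x => (hB x).trans (le_abs_self B))
  have hcont : Continuous fun y => ∫ x, h x * χ (x - y) := by
    have := (contDiff_conv hloc hrefl).continuous
    refine this.congr fun y => ?_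
    simp [conv_apply]
  have hbd : ∀ y, |∫ x, h x * χ (x - y)| ≤ B * ∫ x, |χ x| := by
    intro y
    rw [← integral_sub_right_eq_self (fun x => |χ x|) y, ← integral_const_mul]
    rw [← Real.norm_eq_abs]
    refine norm_integral_le_of_norm_le ((hχ.integrable.abs.comp_sub_right y).const_mul B)
      (Eventually.of_forall fun x => ?_)
    rw [norm_mul]
    exact mul_le_mul_of_nonneg_right (hB x) (abs_nonneg _)
  have hprod := fun (a : Measure (Eucl d)) [IsFiniteMeasure a] =>
    integrable_prod_mul_sub a hh hB hχ
  have hint : ∀ (a : Measure (Eucl d)) [IsFiniteMeasure a],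
      Integrable (fun x => h x * ∫ y, χ (x - y) ∂a) := fun a _ => by
    simpa only [integral_const_mul] using (hprod a).integral_prod_left
  have hswap : ∀ (a : Measure (Eucl d)) [IsFiniteMeasure a],
      ∫ x, h x * ∫ y, χ (x - y) ∂a = ∫ y, (∫ x, h x * χ (x - y)) ∂a := fun a _ => by
    rw [← integral_integral_swap (μ := volume) (ν := a) (f := fun x y => h x * χ (x - y)) (hprod a)]
    simp only [integral_const_mul]
  have hfun : (fun x => h x * sconv μ χ x) = fun x =>
      h x * (∫ y, χ (x - y) ∂μ.toJordanDecomposition.posPart) -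
      h x * (∫ y, χ (x - y) ∂μ.toJordanDecomposition.negPart) := by
    funext x
    rw [sconv_eq μ hχ, mul_sub]
  rw [hfun]
  refine ⟨(hint _).sub (hint _), ?_⟩
  rw [integral_sub (hint _) (hint _), hswap, hswap, spair_eq μ hcont hbd]

theorem integrable_dens (μ : SignedMeasure (Eucl d)) : Integrable (dens μ) :=
  SignedMeasure.integrable_rnDeriv μ volume

theorem withDensity_dens {μ : SignedMeasure (Eucl d)} (hμ : μ ∈ AC d) :
    volume.withDensityᵥ (dens μ) = μ :=
  SignedMeasure.withDensityᵥ_rnDeriv_eq μ volume hμ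

theorem withDensity_mem_AC (f : Eucl d → ℝ) : volume.withDensityᵥ f ∈ AC d :=
  Measure.withDensityᵥ_absolutelyContinuous volume f

theorem dens_withDensity {f : Eucl d → ℝ} (hf : Integrable f) :
    dens (volume.withDensityᵥ f) =ᵐ[volume] f :=
  (Integrable.ae_eq_of_withDensityᵥ_eq (integrable_dens _) hf
    (withDensity_dens (withDensity_mem_AC f)))

theorem sconv_eq_conv_dens {μ : SignedMeasure (Eucl d)} (hμ : μ ∈ AC d) {χ : Eucl d → ℝ}
    (hχ : IsTest χ) : sconv μ χ = conv (dens μ) χ := by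
  obtain ⟨B, -, hB⟩ := hχ.exists_bound
  funext x
  conv_lhs => rw [← withDensity_dens hμ]
  exact spair_withDensity (integrable_dens μ) (hχ.comp_sub_left x).continuous fun _ => hB _

/-- A signed measure that acts on test functions as a locally integrable function `g` is absolutely
continuous with density `g`. Both are compared through their densities with respect to
`|μ| + volume`. -/
theorem mem_AC_of_spair_eq {μ : SignedMeasure (Eucl d)} {g : Eucl d → ℝ}
    (hg : LocallyIntegrable g)
    (h : ∀ φ : Eucl d → ℝ, IsTest φ → spair μ φ = ∫ x, g x * φ x) :
    μ ∈ AC d ∧ dens μ =ᵐ[volume] g := by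
  have hAC : μ ∈ AC d := by
    set a := μ.toJordanDecomposition.posPart with ha
    set b := μ.toJordanDecomposition.negPart with hb
    set l : Measure (Eucl d) := a + b + volume with hl
    have hlσ : SigmaFinite l := by rw [hl]; infer_instance
    have hal : a ≪ l := (Measure.le_add_right (Measure.le_add_right le_rfl)).absolutelyContinuous
    have hbl : b ≪ l := (Measure.le_add_right (Measure.le_add_left le_rfl)).absolutelyContinuous
    have hvl : (volume : Measure (Eucl d)) ≪ l := (Measure.le_add_left le_rfl).absolutelyContinuous
    set ra := fun x => (a.rnDeriv l x).toReal with hra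
    set rb := fun x => (b.rnDeriv l x).toReal with hrb
    set rv := fun x => ((volume : Measure (Eucl d)).rnDeriv l x).toReal with hrv
    have hai : Integrable ra l := Measure.integrable_toReal_rnDeriv
    have hbi : Integrable rb l := Measure.integrable_toReal_rnDeriv
    have hgl : LocallyIntegrable (fun x => rv x * g x) l := by
      rw [locallyIntegrable_iff]
      intro K hK
      have h1 : Integrable (K.indicator g) := (integrable_indicator_iff hK.measurableSet).2
        (hg.integrableOn_isCompact hK)
      have h2 := (integrable_rnDeriv_smul_iff hvl).2 h1
      rw [← integrable_indicator_iff hK.measurableSet]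
      refine h2.congr (Eventually.of_forall fun x => ?_)
      by_cases hx : x ∈ K <;> simp [hx, hrv]
    -- both functionals have `l`-densities, which agree when tested against smooth functions
    have hzero : ∀ᵐ x ∂l, (ra x - rb x) - rv x * g x = 0 := by
      refine ae_eq_zero_of_integral_contDiff_smul_eq_zero
        ((hai.sub hbi).locallyIntegrable.sub hgl) fun φ h1 h2 => ?_
      have hφ : IsTest φ := ⟨h1, h2⟩
      obtain ⟨B, -, hB⟩ := hφ.exists_bound
      have hB' : ∀ᵐ x ∂l, ‖φ x‖ ≤ B := Eventually.of_forall hB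
      have e1 : ∫ x, ra x * φ x ∂l = ∫ x, φ x ∂a := integral_rnDeriv_smul hal
      have e2 : ∫ x, rb x * φ x ∂l = ∫ x, φ x ∂b := integral_rnDeriv_smul hbl
      have e3 : ∫ x, rv x * (g x * φ x) ∂l = ∫ x, g x * φ x := integral_rnDeriv_smul hvl
      have i1 : Integrable (fun x => ra x * φ x) l := hai.mul_bdd hφ.continuous.aestronglyMeasurable hB'
      have i2 : Integrable (fun x => rb x * φ x) l := hbi.mul_bdd hφ.continuous.aestronglyMeasurable hB'
      have i3 : Integrable (fun x => rv x * (g x * φ x)) l := by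
        refine (integrable_rnDeriv_smul_iff hvl).2 ?_
        simpa [mul_comm] using
          hg.integrable_smul_left_of_hasCompactSupport hφ.continuous hφ.compact
      have h3 := h φ hφ
      rw [spair_eq μ hφ.continuous hB, ← ha, ← hb, ← e1, ← e2, ← e3] at h3
      calc ∫ x, φ x • ((ra x - rb x) - rv x * g x) ∂l
          = ∫ x, (ra x * φ x - rb x * φ x) - rv x * (g x * φ x) ∂l := by
            congr 1; funext x; simp only [smul_eq_mul]; ring
        _ = 0 := by
            rw [integral_sub (f := fun x => ra x * φ x - rb x * φ x) (i1.sub i2) i3, integral_sub i1 i2, h3, sub_self]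
    refine VectorMeasure.AbsolutelyContinuous.mk fun s hs hvs => ?_
    rw [Measure.toENNRealVectorMeasure_apply_measurable hs] at hvs
    have hrv0 : ∀ᵐ x ∂(l.restrict s), rv x = 0 := by
      have h0 : ∫⁻ x in s, (volume : Measure (Eucl d)).rnDeriv l x ∂l = 0 := by
        rw [Measure.setLIntegral_rnDeriv hvl, hvs]
      rw [lintegral_eq_zero_iff (Measure.measurable_rnDeriv _ _)] at h0
      filter_upwards [h0] with x hx
      simp [hrv, hx]
    have hab : ∫ x in s, ra x ∂l = ∫ x in s, rb x ∂l := by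
      refine integral_congr_ae ?_
      filter_upwards [hrv0, ae_restrict_of_ae hzero] with x h1 h2
      rw [h1] at h2
      linarith
    rw [Measure.setIntegral_toReal_rnDeriv hal, Measure.setIntegral_toReal_rnDeriv hbl] at hab
    rw [← μ.toSignedMeasure_toJordanDecomposition, JordanDecomposition.toSignedMeasure,
      _root_.sub_apply, Measure.toSignedMeasure_apply_measurable hs,
      Measure.toSignedMeasure_apply_measurable hs]
    exact sub_eq_zero.2 hab
  refine ⟨hAC, ?_⟩
  refine ae_eq_of_integral_contDiff_smul_eq (integrable_dens μ).locallyIntegrable hg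
    fun φ h1 h2 => ?_
  have hφ : IsTest φ := ⟨h1, h2⟩
  obtain ⟨B, -, hB⟩ := hφ.exists_bound
  have h3 := h φ hφ
  rw [← withDensity_dens hAC, spair_withDensity (integrable_dens μ) hφ.continuous hB] at h3
  simpa [mul_comm] using h3

end Signed


/-! ### Mollified differences of measures in the Luxemburg norm -/

section Duality

variable {d : ℕ}

theorem exists_mderiv_bound {χ : Eucl d → ℝ} (hχ : IsTest χ) (n : ℕ) :
    ∃ B r : ℝ, 0 < B ∧ 0 < r ∧ ∀ β : Fin d → ℕ, ∑ i, β i ≤ n →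
      ∀ x, |mderiv β χ x| ≤ B ∧ (mderiv β χ x ≠ 0 → ‖x‖ ≤ r) := by
  choose B hB0 hB using fun β : Fin d → ℕ => (hχ.mderiv β).exists_bound
  choose r hr0 hr using fun β : Fin d → ℕ => (hχ.mderiv β).exists_support
  refine ⟨1 + ∑ β ∈ multiIdx d n, B β, 1 + ∑ β ∈ multiIdx d n, r β, ?_, ?_, fun β hβ x => ⟨?_, ?_⟩⟩
  · have := Finset.sum_nonneg fun β (_ : β ∈ multiIdx d n) => hB0 β
    linarith
  · have := Finset.sum_nonneg fun β (_ : β ∈ multiIdx d n) => (hr0 β).le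
    linarith
  · have := Finset.single_le_sum (fun β _ => hB0 β) (mem_multiIdx.2 hβ)
    linarith [hB β x]
  · intro hx
    have := Finset.single_le_sum (fun β _ => (hr0 β).le) (mem_multiIdx.2 hβ)
    linarith [hr β x hx]

theorem cNorm_le_of {k : ℕ} {Ψ : Eucl d → ℝ} {M : ℝ}
    (h : ∀ β ∈ multiIdx d k, ∀ x, |mderiv β Ψ x| ≤ M) :
    cNorm k Ψ ≤ ENNReal.ofReal ((multiIdx d k).card * M) := by
  calc cNorm k Ψ ≤ ∑ _β ∈ multiIdx d k, ENNReal.ofReal M := by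
        refine Finset.sum_le_sum fun β hβ => iSup_le fun x => ?_
        rw [Real.enorm_eq_ofReal_abs]
        exact ENNReal.ofReal_le_ofReal (h β hβ x)
    _ = _ := by
        rw [Finset.sum_const, nsmul_eq_mul, ENNReal.ofReal_mul (Nat.cast_nonneg _),
          ENNReal.ofReal_natCast]

theorem cNorm_const_mul (k : ℕ) (c : ℝ) (Ψ : Eucl d → ℝ) :
    cNorm k (fun x => c * Ψ x) = ENNReal.ofReal |c| * cNorm k Ψ := by
  simp only [cNorm, Finset.mul_sum, ENNReal.mul_iSup, mderiv_const_mul, enorm_mul,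
    Real.enorm_eq_ofReal_abs c]

theorem abs_spair_sub_le {k : ℕ} {μ ν : SignedMeasure (Eucl d)} (hdk : dk k μ ν ≠ ⊤)
    {Ψ : Eucl d → ℝ} (hΨ : ContDiff ℝ ∞ Ψ) {b : ℝ} (hb : 0 < b)
    (hc : cNorm k Ψ ≤ ENNReal.ofReal b) :
    |spair μ Ψ - spair ν Ψ| ≤ (dk k μ ν).toReal * b := by
  have h1 : cNorm k (fun x => b⁻¹ * Ψ x) ≤ 1 := by
    rw [cNorm_const_mul, abs_of_pos (inv_pos.2 hb)]
    calc ENNReal.ofReal b⁻¹ * cNorm k Ψ ≤ ENNReal.ofReal b⁻¹ * ENNReal.ofReal b := by gcongr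
      _ = 1 := by rw [← ENNReal.ofReal_mul (by positivity), inv_mul_cancel₀ hb.ne',
          ENNReal.ofReal_one]
  have h2 : ENNReal.ofReal |spair μ (fun x => b⁻¹ * Ψ x) - spair ν (fun x => b⁻¹ * Ψ x)| ≤
      dk k μ ν := le_iSup_of_le (fun x => b⁻¹ * Ψ x)
    (le_iSup_of_le (contDiff_const.mul hΨ) (le_iSup_of_le h1 le_rfl))
  rw [ENNReal.ofReal_le_iff_le_toReal hdk, spair_const_mul, spair_const_mul, ← mul_sub, abs_mul,
    abs_of_pos (inv_pos.2 hb), inv_mul_le_iff₀ hb] at h2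
  linarith

/-- The difference of two measures mollified at scale `δ` is controlled by `d_k`. With
`h = e(u) / u`, `u` the mollified difference divided by `c`, the integral of `e(u)` is the pairing
of the two measures with the smooth function `h * χ`, whose `C^k` norm is in turn bounded by the
integral of `e(u)`; for `c` large the latter can be absorbed. -/
theorem luxNorm_sconv_sub_le {e : ℝ → ℝ} (he : IsYoung e) {χ : Eucl d → ℝ} (hχ : IsTest χ)
    (q k : ℕ) :
    ∃ C : ℝ, 0 < C ∧ ∀ α : Fin d → ℕ, ∑ i, α i ≤ q → ∀ δ : ℝ, 0 < δ → δ ≤ 1 →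
      ∀ μ ν : SignedMeasure (Eucl d),
      luxNorm e (fun x => sconv μ (mderiv α (dil δ χ)) x - sconv ν (mderiv α (dil δ χ)) x) ≤
        ENNReal.ofReal (C * (δ⁻¹ ^ (q + k) * betaFn e (δ⁻¹ ^ d))) * dk k μ ν := by
  obtain ⟨B, r, hB0, hr0, hBr⟩ := exists_mderiv_bound hχ (q + k)
  set V : ℝ := (volume (Metric.closedBall (0 : Eucl d) r)).toReal with hV
  have hV0 : 0 ≤ V := ENNReal.toReal_nonneg
  set N : ℝ := ((multiIdx d k).card : ℝ) with hN
  have hN0 : 0 < N := by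
    rw [hN, Nat.cast_pos, Finset.card_pos]
    exact ⟨0, mem_multiIdx.2 (by simp)⟩
  refine ⟨N * B * (2 + 2 * V), by positivity, fun α hα δ hδ hδ1 μ ν => ?_⟩
  set s : ℝ := δ⁻¹ ^ d with hs
  have hs0 : 0 < s := by positivity
  set A := youngInv e s with hA
  have hA0 : 0 < A := he.youngInv_pos hs0
  have hβ0 := he.betaFn_pos hs0
  have hβ : betaFn e s = s / A := rfl
  set W : ℝ := δ⁻¹ ^ (q + k) with hW
  have hW0 : 0 < W := by positivity
  have hδinv : 1 ≤ δ⁻¹ := (one_le_inv₀ hδ).2 hδ1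
  rcases eq_or_ne (dk k μ ν) ⊤ with hdk | hdk
  · rw [hdk, ENNReal.mul_top]
    · exact le_top
    · have : 0 < N * B * (2 + 2 * V) * (W * betaFn e s) := by positivity
      simpa using this
  set D := (dk k μ ν).toReal with hD
  have hD0 : 0 ≤ D := ENNReal.toReal_nonneg
  set κ := mderiv α (dil δ χ) with hκ
  have hκt : IsTest κ := (hχ.dil hδ).mderiv α
  set g : Eucl d → ℝ := fun x => sconv μ κ x - sconv ν κ x with hg
  have hgm : Measurable g := (measurable_sconv μ hκt).sub (measurable_sconv ν hκt)
  have hgfin : luxNorm e g < ⊤ := by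
    have h1 := luxNorm_add_le he (f := sconv μ κ) (g := fun x => (-1) * sconv ν κ x)
      (measurable_sconv μ hκt).aemeasurable
    have h2 : (fun x => sconv μ κ x + (-1) * sconv ν κ x) = g := by
      funext x; rw [hg]; ring
    rw [h2] at h1
    refine h1.trans_lt (ENNReal.add_lt_top.2 ⟨luxNorm_sconv_lt_top he μ hκt, ?_⟩)
    exact (luxNorm_smul_le he _).trans_lt
      (ENNReal.mul_lt_top ENNReal.ofReal_lt_top (luxNorm_sconv_lt_top he ν hκt))
  obtain ⟨G, hG⟩ : ∃ G : ℝ, ∀ x, |g x| ≤ G := by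
    obtain ⟨B', -, hB'⟩ := hκt.exists_bound
    exact ⟨_, fun x => (abs_sub _ _).trans
      (add_le_add (abs_sconv_le μ hκt hB' x) (abs_sconv_le ν hκt hB' x))⟩
  -- any `c > 0` above the claimed bound is admissible in the Luxemburg norm; the claimed bound itself
  -- may vanish
  suffices H : ∀ c : ℝ, 0 < c → N * B * (2 + 2 * V) * (W * betaFn e s) * D ≤ c →
      luxNorm e g ≤ ENNReal.ofReal c by
    have heq : ENNReal.ofReal (N * B * (2 + 2 * V) * (W * betaFn e s)) * dk k μ ν =
        ENNReal.ofReal (N * B * (2 + 2 * V) * (W * betaFn e s) * D) := by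
      rw [ENNReal.ofReal_mul (q := D) (by positivity), hD, ENNReal.ofReal_toReal hdk]
    rw [heq]
    refine ENNReal.le_of_forall_pos_le_add fun ε hε _ => ?_
    have hε' : (0 : ℝ) < ε := hε
    refine (H (N * B * (2 + 2 * V) * (W * betaFn e s) * D + ε) (by positivity) (by linarith)).trans ?_
    rw [ENNReal.ofReal_add (by positivity) hε'.le, ENNReal.ofReal_coe_nnreal]
  intro c hc hcD
  refine luxNorm_le_of hc ?_
  set u : Eucl d → ℝ := fun x => 1 / c * g x with hu
  have hum : Measurable u := hgm.const_mul _
  have hmod : modular e u < ⊤ := modular_lt_top he hgfin hc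
  have heu : Integrable (fun x => e (u x)) := by
    refine ⟨(he.continuous.measurable.comp hum).aestronglyMeasurable, ?_⟩
    rw [hasFiniteIntegral_iff_ofReal (Eventually.of_forall fun x => he.nonneg _)]
    exact hmod
  set I := ∫ x, e (u x) with hI
  have hI0 : 0 ≤ I := integral_nonneg fun x => he.nonneg _
  have hmodI : modular e u = ENNReal.ofReal I :=
    (ofReal_integral_eq_lintegral_ofReal heu (Eventually.of_forall fun x => he.nonneg _)).symm
  rw [hmodI, ENNReal.ofReal_le_one]
  set h : Eucl d → ℝ := fun x => e (u x) / u x with hh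
  have hhm : Measurable h := (he.continuous.measurable.comp hum).div hum
  have habs : ∀ x, |h x| = e (u x) / |u x| := fun x => by
    rw [hh, abs_div, abs_of_nonneg (he.nonneg _)]
  have hdiv : ∀ x (T : ℝ), 0 < T → |u x| ≤ T → |h x| ≤ e T / T := fun x T hT hx => by
    rw [habs]
    rcases eq_or_ne (u x) 0 with h0 | h0
    · rw [h0, abs_zero, div_zero]; exact div_nonneg (he.nonneg _) hT.le
    · have := he.div_mono (abs_pos.2 h0) hx
      rwa [he.abs_eq] at this
  have hhB : ∀ x, |h x| ≤ e (1 / c * |G| + 1) / (1 / c * |G| + 1) := fun x => by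
    refine hdiv x _ (by positivity) ?_
    rw [hu, abs_mul, abs_of_pos (by positivity)]
    have := (hG x).trans (le_abs_self G)
    have : 1 / c * |g x| ≤ 1 / c * |G| := by gcongr
    linarith
  -- with `A = e⁻¹(s)`: for `|u| ≤ A` use that `e(s)/s` is nondecreasing, otherwise divide by `A`
  have hhA : ∀ x, |h x| ≤ s / A + e (u x) / A := fun x => by
    rcases le_or_gt |u x| A with hx | hx
    · have h1 := hdiv x A hA0 hx
      rw [hA, he.apply_youngInv hs0.le, ← hA] at h1
      have := div_nonneg (he.nonneg (u x)) hA0.le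
      linarith
    · rw [habs]
      have h1 : e (u x) / |u x| ≤ e (u x) / A :=
        div_le_div_of_nonneg_left (he.nonneg _) hA0 hx.le
      have : 0 < s / A := by positivity
      linarith
  have hhloc : LocallyIntegrable h :=
    (locallyIntegrable_const (e (1 / c * |G| + 1) / (1 / c * |G| + 1))).mono
      hhm.aestronglyMeasurable (Eventually.of_forall fun x => (hhB x).trans (le_abs_self _))
  -- the test function `h * κ(-·)`, against which `μ - ν` gives the integral of `c e(u)`
  set κ' : Eucl d → ℝ := fun z => κ (0 - z) with hκ'
  have hκ't : IsTest κ' := hκt.comp_sub_left 0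
  set Ψ := conv h κ' with hΨ
  have hΨs : ContDiff ℝ ∞ Ψ := contDiff_conv hhloc hκ't
  have hΨeq : Ψ = fun y => ∫ x, h x * κ (x - y) := by
    funext y
    simp [hΨ, conv_apply, hκ']
  have hduality : c * I = spair μ Ψ - spair ν Ψ := by
    obtain ⟨i1, e1⟩ := integral_mul_sconv μ hhm hhB hκt
    obtain ⟨i2, e2⟩ := integral_mul_sconv ν hhm hhB hκt
    rw [hΨeq, ← e1, ← e2, ← integral_sub i1 i2, hI, ← integral_const_mul]
    congr 1
    funext x
    rw [← mul_sub]
    change c * e (u x) = e (u x) / u x * g x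
    have hgx : g x = c * u x := by rw [hu]; field_simp
    rcases eq_or_ne (u x) 0 with h0 | h0
    · rw [hgx, h0, he.zero]; simp
    · rw [hgx]; field_simp
  -- the kernel lives at scale `δ`, on balls of volume `V / s`
  have hball : ∀ y : Eucl d, ∫ t in Metric.closedBall y (δ * r), |h t| ≤ (V / s) * (s / A) + I / A := by
    intro y
    set K := Metric.closedBall y (δ * r) with hK
    have hKv : (volume K).toReal = V / s := by
      rw [hK, Measure.addHaar_closedBall_mul _ _ hδ.le hr0.le, ENNReal.toReal_mul,
        ENNReal.toReal_ofReal (by positivity), finrank_euclideanSpace_fin, ← hV, hs, inv_pow]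
      field_simp
    have hKf : volume K ≠ ⊤ := measure_closedBall_lt_top.ne
    have i1 : Integrable (fun _ => s / A) (volume.restrict K) := integrableOn_const hKf
    have i2 : Integrable (fun t => e (u t) / A) (volume.restrict K) :=
      (heu.div_const A).integrableOn
    calc ∫ t in K, |h t| ≤ ∫ t in K, (s / A + e (u t) / A) := by
          refine integral_mono ?_ ?_ fun t => hhA t
          · exact (hhloc.integrableOn_isCompact (isCompact_closedBall _ _)).abs
          · exact i1.add i2
      _ = (V / s) * (s / A) + (∫ t in K, e (u t)) / A := by
          rw [integral_add i1 i2, setIntegral_const, integral_div, Measure.real, hKv, smul_eq_mul]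
      _ ≤ _ := by
          gcongr
          exact setIntegral_le_integral heu (Eventually.of_forall fun x => he.nonneg _)
  have hΨb : ∀ β ∈ multiIdx d k, ∀ y, |mderiv β Ψ y| ≤ W * B * betaFn e s * (V + I) := by
    intro β hβk y
    have hβk' := mem_multiIdx.1 hβk
    have hsum : ∑ i, (β + α) i ≤ q + k := by
      simp only [Pi.add_apply, Finset.sum_add_distrib]; omega
    have hker : ∀ z, |mderiv β κ' z| ≤ if ‖z‖ ≤ δ * r then W * (s * B) else 0 := by
      intro z
      rw [hκ', mderiv_comp_sub_left hκt.smooth, abs_mul, abs_pow, abs_neg, abs_one, one_pow,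
        one_mul, hκ, ← mderiv_add (hχ.dil hδ).smooth, mderiv_dil hχ.smooth]
      simp only [dil, zero_sub, smul_neg]
      obtain ⟨hb1, hb2⟩ := hBr (β + α) hsum (-(δ⁻¹ • z))
      split_ifs with hz
      · rw [abs_mul, abs_mul, abs_of_pos (by positivity), abs_of_pos (by positivity), ← inv_pow,
          ← hs]
        gcongr
        exact pow_le_pow_right₀ hδinv hsum
      · have : mderiv (β + α) χ (-(δ⁻¹ • z)) = 0 := by
          by_contra hne
          have := hb2 hne
          rw [norm_neg, norm_smul, Real.norm_of_nonneg (by positivity), inv_mul_le_iff₀ hδ] at this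
          exact hz this
        rw [this]; simp
    rw [hΨ, mderiv_conv hhloc hκ't, conv_apply]
    have hint := integrable_conv_integrand hhloc (hκ't.mderiv β).continuous (hκ't.mderiv β).compact y
    calc |∫ t, h t * mderiv β κ' (y - t)| ≤ ∫ t, |h t * mderiv β κ' (y - t)| :=
          abs_integral_le_integral_abs
      _ ≤ ∫ t, (Metric.closedBall y (δ * r)).indicator (fun t => W * (s * B) * |h t|) t := by
          refine integral_mono hint.abs ?_ fun t => ?_
          · rw [integrable_indicator_iff measurableSet_closedBall]
            exact (hhloc.integrableOn_isCompact (isCompact_closedBall _ _)).abs.const_mul _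
          · simp only [abs_mul]
            have := hker (y - t)
            by_cases ht : t ∈ Metric.closedBall y (δ * r)
            · rw [Set.indicator_of_mem ht]
              rw [if_pos (by rw [← dist_eq_norm, dist_comm]; exact ht)] at this
              rw [mul_comm]
              gcongr
            · rw [Set.indicator_of_notMem ht]
              rw [if_neg (by rw [← dist_eq_norm, dist_comm]; exact ht)] at this
              rw [le_antisymm this (abs_nonneg _), mul_zero]
      _ = W * (s * B) * ∫ t in Metric.closedBall y (δ * r), |h t| := by
          rw [integral_indicator measurableSet_closedBall, integral_const_mul]
      _ ≤ W * (s * B) * ((V / s) * (s / A) + I / A) := by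
          gcongr
          exact hball y
      _ = W * B * betaFn e s * (V + I) := by
          rw [hβ]; field_simp
  have hfinal : c * I ≤ D * (N * (W * B * betaFn e s * (V + I)) ) := by
    rw [hduality]
    refine (le_abs_self _).trans ?_
    have hcn := cNorm_le_of hΨb
    rw [← hN] at hcn
    refine le_of_forall_pos_le_add fun ε hε => ?_
    have hD1 : 0 < D + 1 := by linarith
    have hb : 0 < N * (W * B * betaFn e s * (V + I)) + ε / (D + 1) := by positivity
    refine (abs_spair_sub_le hdk hΨs hb (hcn.trans (ENNReal.ofReal_le_ofReal
      (le_add_of_nonneg_right (by positivity))))).trans ?_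
    rw [mul_add, ← hD]
    have : D * (ε / (D + 1)) ≤ ε := by
      rw [mul_div_assoc', div_le_iff₀ hD1]; nlinarith
    linarith
  -- for this `c` the term containing `I` on the right is at most half of `c * I`
  set θ := D * (N * (W * B * betaFn e s)) with hθ
  have hθ0 : 0 ≤ θ := by positivity
  have h1 : c * I ≤ θ * (V + I) := by rw [hθ]; linarith
  have h2 : θ * (2 + 2 * V) ≤ c := by
    refine le_trans (le_of_eq ?_) hcD
    rw [hθ]; ring
  have h3 : θ * (2 + 2 * V) * I ≤ c * I := by gcongr
  by_contra hlt
  push Not at hlt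
  rcases hθ0.eq_or_lt with h0 | h0
  · rw [← h0] at h1
    have : 0 < c * I := by positivity
    linarith
  · have h4 : θ * ((2 + 2 * V) * I) ≤ θ * (V + I) := by linarith
    have h5 := le_of_mul_le_mul_left h4 h0
    nlinarith

end Duality

/-! ### Mollification of functions with weak derivatives -/

section Weak

variable {d : ℕ}

theorem conv_congr {f f' : Eucl d → ℝ} (h : f =ᵐ[volume] f') (χ : Eucl d → ℝ) :
    conv f χ = conv f' χ := by
  funext x
  exact integral_congr_ae (h.mono fun t ht => by simp only [ht])

theorem luxNorm_conv_le {e : ℝ → ℝ} (he : IsYoung e) {f χ : Eucl d → ℝ}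
    (hf : AEStronglyMeasurable f) (hχ : IsTest χ) :
    luxNorm e (conv f χ) ≤ (∫⁻ x, ‖χ x‖ₑ) * luxNorm e f := by
  rw [conv_congr hf.ae_eq_mk, luxNorm_congr hf.ae_eq_mk]
  exact (isTransNorm_luxNorm he).conv_le hf.stronglyMeasurable_mk.measurable hχ

theorem lintegral_conv_le {f χ : Eucl d → ℝ} (hf : AEStronglyMeasurable f) (hχ : IsTest χ) :
    ∫⁻ x, ‖conv f χ x‖ₑ ≤ (∫⁻ x, ‖χ x‖ₑ) * ∫⁻ x, ‖f x‖ₑ := by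
  have h := isTransNorm_lintegral.conv_le hf.stronglyMeasurable_mk.measurable hχ
  rw [conv_congr hf.ae_eq_mk]
  refine h.trans (le_of_eq ?_)
  congr 1
  exact lintegral_congr_ae (hf.ae_eq_mk.mono fun x hx => by simp only [hx])

theorem monom_zero (x : Eucl d) : monom 0 x = 1 := by simp [monom]

/-- Mollification turns weak derivatives into classical ones without increasing their norm. -/
theorem luxNorm_mderiv_conv_moll_le {e : ℝ → ℝ} (he : IsYoung e) {p : Eucl d → ℝ}
    (hp : LocallyIntegrable p) (β : Fin d → ℕ) (j : ℕ) :
    luxNorm e (mderiv β (conv p (moll d j))) ≤ weakNorm 0 β e p := by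
  refine le_iInf₂ fun g hg => ?_
  rw [mderiv_conv hp (isTest_moll j), hg.conv_eq (isTest_moll j)]
  refine (luxNorm_conv_le he hg.2.1.aestronglyMeasurable (isTest_moll j)).trans ?_
  rw [lintegral_moll, one_mul]
  simp only [monom_zero, one_mul, le_refl]

/-- The kernel of the approximate identity at scale `2^{-n}`. -/
def scaleKern (d N n : ℕ) : Eucl d → ℝ := dil (2 ^ n)⁻¹ (kern (moll d 0) N)

theorem isTest_scaleKern (N n : ℕ) : IsTest (scaleKern d N n) :=
  (isTest_kern (isTest_moll 0) N).dil (by positivity)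

theorem dil_moll_nonneg {δ : ℝ} (hδ : 0 < δ) (x : Eucl d) : 0 ≤ dil δ (moll d 0) x :=
  mul_nonneg (by positivity) (moll_nonneg 0 _)

theorem integral_dil_moll {δ : ℝ} (hδ : 0 < δ) : ∫ x, dil δ (moll d 0) x = 1 := by
  rw [integral_dil hδ, integral_moll]

theorem norm_le_of_dil_moll_ne_zero {δ : ℝ} (hδ : 0 < δ) {x : Eucl d}
    (hx : dil δ (moll d 0) x ≠ 0) : ‖x‖ ≤ δ := by
  have := norm_le_of_moll_ne_zero (right_ne_zero_of_mul hx)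
  rwa [norm_smul, Real.norm_of_nonneg (by positivity), inv_mul_le_iff₀ hδ, mul_one] at this

/-- Mollification by the kernel of order `N` at scale `δ` is accurate to order `N`. -/
theorem IsTransNorm.resid_dil_moll_le {P : (Eucl d → ℝ) → ℝ≥0∞} (hP : IsTransNorm P)
    {g : Eucl d → ℝ} (hg : ContDiff ℝ ∞ g) {δ : ℝ} (hδ : 0 < δ) {n : ℕ} {B : ℝ≥0∞}
    (hB : ∀ β : Fin d → ℕ, ∑ i, β i ≤ n → P (mderiv β g) ≤ B) (j : ℕ) (α : Fin d → ℕ)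
    (hα : ∑ i, α i + j ≤ n) :
    P ((resid (dil δ (moll d 0)))^[j] (mderiv α g)) ≤ (ENNReal.ofReal δ * d) ^ j * B :=
  hP.resid_iterate_le ((isTest_moll 0).dil hδ) (dil_moll_nonneg hδ) (integral_dil_moll hδ) hδ
    (fun _ => norm_le_of_dil_moll_ne_zero hδ) hg hB j α hα

/-- The increments of the approximations of a function `p` of high regularity are small. The weak
derivatives of `p` are treated by mollifying `p` first and removing the mollification at the end,
by Fatou's lemma. -/
theorem luxNorm_conv_scaleKern_sub_le {e : ℝ → ℝ} (he : IsYoung e) {p : Eucl d → ℝ}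
    (hp : LocallyIntegrable p) (α : Fin d → ℕ) (N n : ℕ) {B : ℝ≥0∞}
    (hB : ∀ β : Fin d → ℕ, ∑ i, β i ≤ ∑ i, α i + N → weakNorm 0 β e p ≤ B) :
    luxNorm e (conv p (mderiv α fun x => scaleKern d N (n + 1) x - scaleKern d N n x)) ≤
      2 * ((ENNReal.ofReal (2 ^ n)⁻¹ * d) ^ N * B) := by
  set χ : Eucl d → ℝ := fun x => scaleKern d N (n + 1) x - scaleKern d N n x with hχ
  have hχt : IsTest χ := (isTest_scaleKern N (n + 1)).sub (isTest_scaleKern N n)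
  have hcχ := contDiff_conv hp (hχt.mderiv α)
  refine luxNorm_le_of_tendsto he (F := fun j => conv (conv p (mderiv α χ)) (moll d j))
    (fun j => (contDiff_conv hcχ.continuous.locallyIntegrable
      (isTest_moll j)).continuous.measurable.aemeasurable)
    (Eventually.of_forall fun x => tendsto_conv_moll hcχ.continuous x) fun j => ?_
  have hmj := isTest_moll (d := d) j
  set P := conv p (moll d j) with hP
  have hPs : ContDiff ℝ ∞ P := contDiff_conv hp hmj
  have hPα := contDiff_mderiv hPs α
  have hcomm : conv (conv p (mderiv α χ)) (moll d j) = conv (mderiv α P) χ := by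
    rw [← mderiv_conv hp hχt, ← mderiv_conv_left (contDiff_conv hp hχt) hmj,
      conv_assoc hp hχt hmj, conv_comm χ, ← conv_assoc hp hmj hχt, mderiv_conv_left hPs hχt]
  have hres : ∀ i : ℕ, (fun x => mderiv α P x - conv (mderiv α P) (scaleKern d N i) x) =
      (resid (dil (2 ^ i)⁻¹ (moll d 0)))^[N] (mderiv α P) := by
    intro i
    rw [← sub_conv_kern ((isTest_moll 0).dil (by positivity)) hPα.continuous.locallyIntegrable,
      kern_dil _ (by positivity)]
    rfl
  have hPB : ∀ β : Fin d → ℕ, ∑ i, β i ≤ ∑ i, α i + N → luxNorm e (mderiv β P) ≤ B :=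
    fun β hβ => (luxNorm_mderiv_conv_moll_le he hp β j).trans (hB β hβ)
  have hbd : ∀ i : ℕ, luxNorm e ((resid (dil (2 ^ i)⁻¹ (moll d 0)))^[N] (mderiv α P)) ≤
      (ENNReal.ofReal (2 ^ i)⁻¹ * d) ^ N * B := fun i =>
    (isTransNorm_luxNorm he).resid_dil_moll_le hPs (by positivity) hPB N α le_rfl
  have hsm : ∀ i : ℕ, ContDiff ℝ ∞ ((resid (dil (2 ^ i)⁻¹ (moll d 0)))^[N] (mderiv α P)) :=
    fun i => contDiff_resid_iterate ((isTest_moll 0).dil (by positivity)) hPα N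
  have hdiff : conv (mderiv α P) χ = fun x =>
      (resid (dil (2 ^ n)⁻¹ (moll d 0)))^[N] (mderiv α P) x +
      (-1) * (resid (dil (2 ^ (n + 1))⁻¹ (moll d 0)))^[N] (mderiv α P) x := by
    rw [hχ, conv_sub_right hPα.continuous.locallyIntegrable (isTest_scaleKern N (n + 1))
      (isTest_scaleKern N n), ← hres n, ← hres (n + 1)]
    funext x
    ring
  rw [hcomm, hdiff]
  refine (luxNorm_add_le he (hsm n).continuous.measurable.aemeasurable).trans ?_
  rw [two_mul]
  refine add_le_add (hbd n) ((luxNorm_smul_le he _).trans ?_)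
  rw [abs_neg, abs_one, ENNReal.ofReal_one, one_mul]
  refine (hbd (n + 1)).trans ?_
  have h2 : ((2 : ℝ) ^ (n + 1))⁻¹ ≤ (2 ^ n)⁻¹ :=
    inv_anti₀ (by positivity) (pow_le_pow_right₀ (by norm_num) n.le_succ)
  have := ENNReal.ofReal_le_ofReal h2
  gcongr

end Weak


/-! ### Regularity of the measures in `𝓢_{q,k,m,e}` -/

section Regularity

variable {d : ℕ}

/-- Completeness: a sequence whose increments are summable in the Luxemburg norm converges almost
everywhere, dominated by a locally integrable function, to a function of finite norm. -/
theorem exists_limit_of_tsum_luxNorm {e : ℝ → ℝ} (he : IsYoung e) {f : ℕ → Eucl d → ℝ}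
    (hf : ∀ n, Measurable (f n)) (h0 : luxNorm e (f 0) < ⊤)
    (hs : ∑' n, luxNorm e (fun x => f (n + 1) x - f n x) < ⊤) :
    ∃ g H : Eucl d → ℝ, LocallyIntegrable g ∧ LocallyIntegrable H ∧ luxNorm e g < ⊤ ∧
      (∀ᵐ x, ∀ n, |f n x| ≤ H x) ∧ ∀ᵐ x, Tendsto (fun n => f n x) atTop (𝓝 (g x)) := by
  set u : ℕ → Eucl d → ℝ := fun n x => f (n + 1) x - f n x with hu
  have hum : ∀ n, Measurable (u n) := fun n => (hf (n + 1)).sub (hf n)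
  set G : Eucl d → ℝ≥0∞ := fun x => ‖f 0 x‖ₑ + ∑' n, ‖u n x‖ₑ with hG
  have hGm : Measurable G := (hf 0).enorm.add (Measurable.tsum fun n => (hum n).enorm)
  have hGK : ∀ K : Set (Eucl d), IsCompact K → ∫⁻ x in K, G x < ⊤ := by
    intro K hK
    set c := volume K + ENNReal.ofReal (1 / e 1) with hc
    have hct : c < ⊤ := ENNReal.add_lt_top.2 ⟨hK.measure_lt_top, ENNReal.ofReal_lt_top⟩
    rw [hG, lintegral_add_left (hf 0).enorm, lintegral_tsum fun n => (hum n).enorm.aemeasurable]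
    refine ENNReal.add_lt_top.2 ⟨(setLIntegral_le_luxNorm he hK).trans_lt
      (ENNReal.mul_lt_top hct h0), ?_⟩
    refine (ENNReal.tsum_le_tsum fun n => setLIntegral_le_luxNorm he hK).trans_lt ?_
    rw [ENNReal.tsum_mul_left]
    exact ENNReal.mul_lt_top hct hs
  have hGfin : ∀ᵐ x, G x < ⊤ := by
    have h1 : ∀ n : ℕ, ∀ᵐ x, x ∈ Metric.closedBall (0 : Eucl d) n → G x < ⊤ := fun n => by
      rw [← ae_restrict_iff' measurableSet_closedBall]
      exact ae_lt_top hGm (hGK _ (isCompact_closedBall _ _)).ne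
    filter_upwards [ae_all_iff.2 h1] with x hx
    obtain ⟨n, hn⟩ := exists_nat_ge ‖x‖
    exact hx n (mem_closedBall_zero_iff.2 hn)
  set H : Eucl d → ℝ := fun x => (G x).toReal with hH
  have hHloc : LocallyIntegrable H := by
    rw [locallyIntegrable_iff]
    exact fun K hK => integrable_toReal_of_lintegral_ne_top hGm.aemeasurable (hGK K hK).ne
  have htel : ∀ n x, f n x = f 0 x + ∑ i ∈ Finset.range n, u i x := fun n x => by
    rw [Finset.sum_range_sub (fun i => f i x)]; ring
  have hdom : ∀ᵐ x, ∀ n, |f n x| ≤ H x := by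
    filter_upwards [hGfin] with x hx n
    rw [hH, ← ENNReal.ofReal_le_iff_le_toReal hx.ne, ← Real.enorm_eq_ofReal_abs, htel]
    refine (enorm_add_le _ _).trans (add_le_add le_rfl ?_)
    refine (enorm_sum_le _ _).trans ?_
    exact ENNReal.sum_le_tsum _
  have hlim : ∀ᵐ x, Tendsto (fun n => f n x) atTop (𝓝 (f 0 x + ∑' n, u n x)) := by
    filter_upwards [hGfin] with x hx
    have hsum : Summable fun n => u n x := by
      have h1 : ∑' n, ‖u n x‖ₑ ≠ ⊤ := (ENNReal.add_lt_top.1 hx).2.ne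
      have h2 := ENNReal.summable_toReal h1
      simp only [toReal_enorm] at h2
      exact h2.of_norm
    have := hsum.hasSum.tendsto_sum_nat.const_add (f 0 x)
    exact this.congr fun n => (htel n x).symm
  set g : Eucl d → ℝ := fun x => f 0 x + ∑' n, u n x with hg
  have hgm : AEStronglyMeasurable g :=
    (aemeasurable_of_tendsto_metrizable_ae atTop (fun n => (hf n).aemeasurable)
      hlim).aestronglyMeasurable
  have hnorm : ∀ n, luxNorm e (f n) ≤ luxNorm e (f 0) + ∑' n, luxNorm e (u n) := by
    intro n
    have h1 : luxNorm e (f n) ≤ luxNorm e (f 0) + ∑ i ∈ Finset.range n, luxNorm e (u i) := by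
      rw [show f n = fun x => f 0 x + ∑ i ∈ Finset.range n, u i x from funext (htel n)]
      refine (luxNorm_add_le he (hf 0).aemeasurable).trans (add_le_add le_rfl ?_)
      exact (isTransNorm_luxNorm he).sum_le _ hum
    exact h1.trans (add_le_add le_rfl (ENNReal.sum_le_tsum _))
  refine ⟨g, H, ?_, hHloc, ?_, hdom, hlim⟩
  · refine hHloc.mono hgm ?_
    filter_upwards [hdom, hlim] with x h1 h2
    have h3 : |g x| ≤ H x := le_of_tendsto h2.abs (Eventually.of_forall h1)
    exact h3.trans (le_abs_self _)
  · exact (luxNorm_le_of_tendsto he (fun n => (hf n).aemeasurable) hlim hnorm).trans_lt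
      (ENNReal.add_lt_top.2 ⟨h0, hs⟩)

theorem tendsto_integral_mul_test {f : ℕ → Eucl d → ℝ} {g H φ : Eucl d → ℝ}
    (hf : ∀ n, Measurable (f n)) (hH : LocallyIntegrable H) (hdom : ∀ᵐ x, ∀ n, |f n x| ≤ H x)
    (hlim : ∀ᵐ x, Tendsto (fun n => f n x) atTop (𝓝 (g x))) (hφ : IsTest φ) :
    Tendsto (fun n => ∫ x, f n x * φ x) atTop (𝓝 (∫ x, g x * φ x)) := by
  refine tendsto_integral_of_dominated_convergence (fun x => |φ x| * H x)
    (fun n => ((hf n).mul hφ.continuous.measurable).aestronglyMeasurable) ?_ (fun n => ?_) ?_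
  · exact hH.integrable_smul_left_of_hasCompactSupport hφ.continuous.abs hφ.compact.abs
  · filter_upwards [hdom] with x hx
    rw [norm_mul, mul_comm]
    exact mul_le_mul_of_nonneg_left (hx n) (abs_nonneg _)
  · filter_upwards [hlim] with x hx
    exact hx.mul_const _

theorem scaleKern_neg (N n : ℕ) (x : Eucl d) : scaleKern d N n (-x) = scaleKern d N n x := by
  simp only [scaleKern, dil, smul_neg]
  rw [kern_even (moll_neg 0)]

theorem exists_enorm_mderiv_bound {φ : Eucl d → ℝ} (hφ : IsTest φ) (N : ℕ) :
    ∃ B : ℝ, ∀ β : Fin d → ℕ, ∑ i, β i ≤ N → ⨆ x, ‖mderiv β φ x‖ₑ ≤ ENNReal.ofReal B := by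
  obtain ⟨B, _, _, _, hB⟩ := exists_mderiv_bound hφ N
  refine ⟨B, fun β hβ => iSup_le fun x => ?_⟩
  rw [Real.enorm_eq_ofReal_abs]
  exact ENNReal.ofReal_le_ofReal (hB β hβ x).1

/-- The approximations of a test function converge uniformly. -/
theorem tendsto_spair_conv_scaleKern (μ : SignedMeasure (Eucl d)) {φ : Eucl d → ℝ} (hφ : IsTest φ)
    {N : ℕ} (hN : N ≠ 0) :
    Tendsto (fun n => spair μ (conv φ (scaleKern d N n))) atTop (𝓝 (spair μ φ)) := by
  obtain ⟨B, hB⟩ := exists_enorm_mderiv_bound hφ N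
  set ε : ℕ → ℝ := fun n => ((2 ^ n)⁻¹ * d) ^ N * |B| with hε
  have hε0 : Tendsto ε atTop (𝓝 0) := by
    have h1 : Tendsto (fun n : ℕ => ((2 : ℝ) ^ n)⁻¹) atTop (𝓝 0) :=
      tendsto_inv_atTop_zero.comp (tendsto_pow_atTop_atTop_of_one_lt one_lt_two)
    have h2 := ((h1.mul_const (d : ℝ)).pow N).mul_const |B|
    simpa [hN] using h2
  have hbd : ∀ n x, |φ x - conv φ (scaleKern d N n) x| ≤ ε n := by
    intro n x
    have hn : (0 : ℝ) < (2 ^ n)⁻¹ := by positivity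
    have h1 := isTransNorm_iSup.resid_dil_moll_le hφ.smooth hn
      (B := ENNReal.ofReal |B|) (n := N)
      (fun β hβ => (hB β hβ).trans (ENNReal.ofReal_le_ofReal (le_abs_self B))) N 0 (by simp)
    rw [mderiv_zero, ← sub_conv_kern ((isTest_moll 0).dil hn)
      hφ.continuous.locallyIntegrable, kern_dil _ hn] at h1
    have h2 := (le_iSup (fun x => ‖φ x - conv φ (dil (2 ^ n)⁻¹ (kern (moll d 0) N)) x‖ₑ) x).trans h1
    rw [Real.enorm_eq_ofReal_abs, ← ENNReal.ofReal_natCast, ← ENNReal.ofReal_mul hn.le,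
      ← ENNReal.ofReal_pow (by positivity), ← ENNReal.ofReal_mul (by positivity)] at h2
    exact (ENNReal.ofReal_le_ofReal_iff (by positivity)).1 h2
  have hlim : Tendsto (fun n => ε n * mass μ) atTop (𝓝 0) := by simpa using hε0.mul_const (mass μ)
  refine tendsto_iff_norm_sub_tendsto_zero.2 (squeeze_zero (fun _ => norm_nonneg _)
    (fun n => ?_) hlim)
  have hc := hφ.conv (isTest_scaleKern (d := d) N n)
  obtain ⟨B₁, -, hB₁⟩ := hφ.exists_bound
  obtain ⟨B₂, -, hB₂⟩ := hc.exists_bound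
  rw [norm_sub_rev, ← spair_sub μ hφ.continuous hc.continuous hB₁ hB₂]
  exact abs_spair_le μ (hφ.continuous.sub hc.continuous) (hbd n)

/-- The mollified measure `μ * ∂_α χ` is the weak derivative of `μ * χ`, tested against `φ`. -/
theorem integral_sconv_mul_mderiv (μ : SignedMeasure (Eucl d)) {χ φ : Eucl d → ℝ} (hχ : IsTest χ)
    (hφ : IsTest φ) (α : Fin d → ℕ) :
    ∫ x, sconv μ χ x * mderiv α φ x =
      (-1) ^ (∑ i, α i) * ∫ x, sconv μ (mderiv α χ) x * φ x := by
  obtain ⟨B, -, hB⟩ := hφ.exists_bound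
  obtain ⟨B', -, hB'⟩ := (hφ.mderiv α).exists_bound
  have h1 := (integral_mul_sconv μ (hφ.mderiv α).continuous.measurable hB' hχ).2
  have h2 := (integral_mul_sconv μ hφ.continuous.measurable hB (hχ.mderiv α)).2
  simp only [mul_comm (sconv μ _ _)]
  rw [h1, h2, ← spair_const_mul]
  congr 1
  funext y
  have h3 := integral_mul_mderiv (hχ.comp_sub_right y).smooth hφ α
  simp only [mderiv_comp_sub_right hχ.smooth, mul_comm (χ _), mul_comm (mderiv α χ _)] at h3
  exact h3

theorem weakNorm_le_wSobNorm {K l : ℕ} (e : ℝ → ℝ) (f : Eucl d → ℝ) {γ β : Fin d → ℕ}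
    (hγ : ∑ i, γ i ≤ l) (hβ : ∑ i, β i ≤ K) : weakNorm γ β e f ≤ wSobNorm K l e f := by
  refine le_trans ?_ (Finset.single_le_sum (f := fun γ => ∑ β ∈ multiIdx d K, weakNorm γ β e f)
    (fun _ _ => zero_le) (mem_multiIdx.2 hγ))
  exact Finset.single_le_sum (f := fun β => weakNorm γ β e f) (fun _ _ => zero_le)
    (mem_multiIdx.2 hβ)

/-- The approximations `μ * K_n` by kernels of order `2m` at scale `2^{-n}` converge in `W^{q,e}`, and
their limit is the density of `μ`. -/
theorem SSpace_subset_hasDensityIn {e : ℝ → ℝ} (he : IsYoung e) (q k : ℕ) {m : ℕ} (hm : 1 ≤ m) :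
    SSpace d q k m e ⊆ HasDensityIn (SobSpace d q e) := by
  intro μ hμ
  simp only [SSpace, rho, Set.mem_ofPred_eq, iInf_lt_iff] at hμ
  obtain ⟨μs, hAC, hpi⟩ := hμ
  rw [piSum, ENNReal.add_lt_top] at hpi
  obtain ⟨hpi1, hpi2⟩ := hpi
  set N := 2 * m with hN
  set K := kern (moll d 0) N with hK
  have hKt : IsTest K := isTest_kern (isTest_moll 0) N
  set χ : Eucl d → ℝ := fun x => dil (1 / 2) K x - K x with hχ
  have hχt : IsTest χ := (hKt.dil (by norm_num)).sub hKt
  -- the differences of consecutive kernels are dilations of the single test function `χ`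
  have hχn : ∀ n, (fun x => scaleKern d N (n + 1) x - scaleKern d N n x) = dil (2 ^ n)⁻¹ χ := by
    intro n
    funext x
    simp only [scaleKern, dil, hχ, smul_smul, ← hK]
    have e1 : ((1 / 2 : ℝ)⁻¹ * ((2 ^ n)⁻¹)⁻¹) = ((2 ^ (n + 1) : ℝ)⁻¹)⁻¹ := by
      rw [inv_inv, inv_inv, pow_succ]; ring
    have e2 : ((((2 : ℝ) ^ (n + 1))⁻¹) ^ d)⁻¹ = (((2 ^ n : ℝ)⁻¹) ^ d)⁻¹ * ((1 / 2 : ℝ) ^ d)⁻¹ := by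
      rw [← mul_inv, ← mul_pow, pow_succ]; congr 2; field_simp
    rw [e1, e2]
    ring
  obtain ⟨C, hC0, hC⟩ := luxNorm_sconv_sub_le he hχt q k
  -- the increments of the approximations are summable
  have hinc : ∀ α : Fin d → ℕ, ∑ i, α i ≤ q → ∑' n, luxNorm e (fun x =>
      sconv μ (mderiv α (scaleKern d N (n + 1))) x - sconv μ (mderiv α (scaleKern d N n)) x) < ⊤ := by
    intro α hα
    have hterm : ∀ n, luxNorm e (fun x =>
        sconv μ (mderiv α (scaleKern d N (n + 1))) x - sconv μ (mderiv α (scaleKern d N n)) x) ≤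
        ENNReal.ofReal C * (2 ^ (n * (q + k)) * ENNReal.ofReal (betaFn e (2 ^ (n * d))) *
          dk k μ (μs n)) +
        (2 * (d : ℝ≥0∞) ^ N) * ((2 ^ (2 * n * m))⁻¹ * wSobNorm (2 * m + q) (2 * m) e (dens (μs n))) := by
      intro n
      have hn : (0 : ℝ) < (2 ^ n)⁻¹ := by positivity
      have hn1 : ((2 : ℝ) ^ n)⁻¹ ≤ 1 := inv_le_one_of_one_le₀ (one_le_pow₀ (by norm_num))
      set κ := mderiv α (dil (2 ^ n)⁻¹ χ) with hκ
      have hκt : IsTest κ := (hχt.dil hn).mderiv α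
      have e0 : (fun x => sconv μ (mderiv α (scaleKern d N (n + 1))) x -
          sconv μ (mderiv α (scaleKern d N n)) x) = sconv μ κ := by
        funext x
        rw [hκ, ← hχn, mderiv_sub (isTest_scaleKern N (n + 1)).smooth (isTest_scaleKern N n).smooth,
          sconv_sub μ ((isTest_scaleKern N (n + 1)).mderiv α) ((isTest_scaleKern N n).mderiv α)]
      have e1 : sconv μ κ = fun x => (sconv μ κ x - sconv (μs n) κ x) + sconv (μs n) κ x := by
        funext x; ring
      rw [e0, e1]
      refine (luxNorm_add_le he ((measurable_sconv μ hκt).sub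
        (measurable_sconv (μs n) hκt)).aemeasurable).trans (add_le_add ?_ ?_)
      · refine (hC α hα _ hn hn1 μ (μs n)).trans (le_of_eq ?_)
        rw [ENNReal.ofReal_mul hC0.le, ENNReal.ofReal_mul (by positivity), inv_inv, ← pow_mul,
          ← pow_mul, ENNReal.ofReal_pow (by norm_num), ENNReal.ofReal_ofNat, mul_assoc]
      · rw [sconv_eq_conv_dens (hAC n) hκt, hκ, ← hχn]
        refine (luxNorm_conv_scaleKern_sub_le he (integrable_dens (μs n)).locallyIntegrable α N n
          (B := wSobNorm (2 * m + q) (2 * m) e (dens (μs n))) fun β hβ =>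
            weakNorm_le_wSobNorm e _ (by simp) (by omega)).trans (le_of_eq ?_)
        rw [ENNReal.ofReal_inv_of_pos (by positivity), ENNReal.ofReal_pow (by norm_num),
          ENNReal.ofReal_ofNat, mul_pow, ← ENNReal.inv_pow, ← pow_mul, show n * N = 2 * n * m by
            rw [hN]; ring]
        ring
    refine (ENNReal.tsum_le_tsum hterm).trans_lt ?_
    rw [ENNReal.tsum_add, ENNReal.tsum_mul_left, ENNReal.tsum_mul_left]
    refine ENNReal.add_lt_top.2 ⟨ENNReal.mul_lt_top ENNReal.ofReal_lt_top hpi1,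
      ENNReal.mul_lt_top (ENNReal.mul_lt_top (by simp) (ENNReal.pow_lt_top (by simp))) hpi2⟩
  have hmeas : ∀ (α : Fin d → ℕ) n, Measurable (sconv μ (mderiv α (scaleKern d N n))) := fun α n =>
    measurable_sconv μ ((isTest_scaleKern N n).mderiv α)
  choose g H hgl hHl hgn hdom hlim using fun α (hα : ∑ i, α i ≤ q) =>
    exists_limit_of_tsum_luxNorm he (hmeas α)
      (luxNorm_sconv_lt_top he μ ((isTest_scaleKern N 0).mderiv α)) (hinc α hα)
  have h00 : ∑ i, (0 : Fin d → ℕ) i ≤ q := by simp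
  set g₀ := g 0 h00 with hg₀
  -- `μ * K_n` tends to `μ` as a functional and to `g₀` almost everywhere
  have hpair : ∀ φ : Eucl d → ℝ, IsTest φ → spair μ φ = ∫ x, g₀ x * φ x := by
    intro φ hφ
    obtain ⟨B, -, hB⟩ := hφ.exists_bound
    have h1 := tendsto_integral_mul_test (hmeas 0) (hHl 0 h00) (hdom 0 h00) (hlim 0 h00) hφ
    refine tendsto_nhds_unique (tendsto_spair_conv_scaleKern μ hφ (N := N) (by omega))
      (h1.congr fun n => ?_)
    have h2 := (integral_mul_sconv μ hφ.continuous.measurable hB (isTest_scaleKern N n)).2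
    simp only [mderiv_zero, mul_comm (sconv μ _ _)]
    rw [h2]
    congr 1
    funext y
    rw [conv_apply]
    congr 1
    funext x
    rw [← scaleKern_neg, neg_sub]
  have hweak : ∀ α (hα : ∑ i, α i ≤ q), IsWeakDeriv α g₀ (g α hα) := by
    intro α hα
    refine ⟨hgl 0 h00, hgl α hα, fun φ h1 h2 => ?_⟩
    have hφ : IsTest φ := ⟨h1, h2⟩
    have t1 := tendsto_integral_mul_test (hmeas 0) (hHl 0 h00) (hdom 0 h00) (hlim 0 h00)
      (hφ.mderiv α)
    have t2 := (tendsto_integral_mul_test (hmeas α) (hHl α hα) (hdom α hα) (hlim α hα)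
      hφ).const_mul ((-1) ^ (∑ i, α i))
    refine tendsto_nhds_unique t1 (t2.congr fun n => ?_)
    rw [mderiv_zero, integral_sconv_mul_mderiv μ (isTest_scaleKern N n) hφ]
  obtain ⟨hμAC, hdens⟩ := mem_AC_of_spair_eq (hgl 0 h00) hpair
  refine ⟨hμAC, ?_⟩
  simp only [SobSpace, sobNorm, Set.mem_ofPred_eq]
  refine ENNReal.sum_lt_top.2 fun α hα => ?_
  have hα' := mem_multiIdx.1 hα
  rw [weakNorm_congr hdens, (hweak α hα').weakNorm_eq]
  simpa only [monom_zero, one_mul] using hgn α hα'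

end Regularity

/-! ### The balance hypothesis -/

section BalanceSum

variable {d : ℕ}

theorem abs_le_one_of_cNorm_le {k : ℕ} {φ : Eucl d → ℝ} (h : cNorm k φ ≤ 1) (x : Eucl d) :
    |φ x| ≤ 1 := by
  have h1 : ⨆ x, ‖mderiv 0 φ x‖ₑ ≤ cNorm k φ :=
    Finset.single_le_sum (f := fun α => ⨆ x, ‖mderiv α φ x‖ₑ) (fun _ _ => zero_le)
      (mem_multiIdx.2 (by simp))
  have h2 := (le_iSup (fun x => ‖mderiv 0 φ x‖ₑ) x).trans (h1.trans h)
  rw [mderiv_zero, Real.enorm_eq_ofReal_abs] at h2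
  exact ENNReal.ofReal_le_one.1 h2

theorem dk_lt_top (k : ℕ) (μ ν : SignedMeasure (Eucl d)) : dk k μ ν < ⊤ := by
  refine lt_of_le_of_lt (iSup_le fun φ => iSup_le fun hφ => iSup_le fun hc => ?_)
    (ENNReal.ofReal_lt_top (r := 1 * mass μ + 1 * mass ν))
  refine ENNReal.ofReal_le_ofReal ((abs_sub _ _).trans (add_le_add ?_ ?_))
  · exact abs_spair_le μ hφ.continuous (abs_le_one_of_cNorm_le hc)
  · exact abs_spair_le ν hφ.continuous (abs_le_one_of_cNorm_le hc)

theorem wSobNorm_congr {f f' : Eucl d → ℝ} (h : f =ᵐ[volume] f') (K l : ℕ) (e : ℝ → ℝ) :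
    wSobNorm K l e f = wSobNorm K l e f' := by
  simp only [wSobNorm, weakNorm_congr h]

theorem wSobNorm_dens_zero {e : ℝ → ℝ} (he : IsYoung e) (K l : ℕ) :
    wSobNorm K l e (dens (0 : SignedMeasure (Eucl d))) = 0 := by
  have h : dens (0 : SignedMeasure (Eucl d)) =ᵐ[volume] fun _ => (0 : ℝ) := by
    have := dens_withDensity (d := d) (f := 0) (integrable_zero _ _ _)
    rwa [withDensityᵥ_zero] at this
  have hw : ∀ α : Fin d → ℕ, IsWeakDeriv α (fun _ : Eucl d => (0 : ℝ)) fun _ => 0 := fun α =>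
    ⟨locallyIntegrable_const 0, locallyIntegrable_const 0, fun φ _ _ => by simp⟩
  rw [wSobNorm_congr h]
  refine Finset.sum_eq_zero fun γ _ => Finset.sum_eq_zero fun α _ => ?_
  rw [(hw α).weakNorm_eq]
  simpa using luxNorm_zero he

theorem tsum_lt_top_of_eventually_le {t : ℕ → ℝ≥0∞} (ht : ∀ n, t n ≠ ⊤) {c b : ℝ} (hb : 1 < b)
    (h : ∀ᶠ n : ℕ in atTop, t n ≤ ENNReal.ofReal (c * (n : ℝ) ^ (-b))) : ∑' n, t n < ⊤ := by
  have hs : Summable fun n : ℕ => c * (n : ℝ) ^ (-b) :=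
    (Real.summable_nat_rpow.2 (by linarith)).mul_left c
  have hs2 : Summable fun n => (t n).toReal := by
    refine hs.abs.of_norm_bounded_eventually_nat ?_
    filter_upwards [h] with n hn
    rw [Real.norm_of_nonneg ENNReal.toReal_nonneg]
    refine ENNReal.toReal_le_of_le_ofReal (abs_nonneg _)
      (hn.trans (ENNReal.ofReal_le_ofReal (le_abs_self _)))
  have := hs2.tsum_ofReal_lt_top
  simpa only [ENNReal.ofReal_toReal (ht _)] using this

/-- Near-optimal approximations of norm at most `R n`, for suitable radii `R n`, have finite
`π_{q,k,m,e}`. -/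
theorem BSpace_subset_SSpace {e : ℝ → ℝ} (he : IsYoung e) (q k : ℕ) {m : ℕ} (hm : 1 ≤ m) :
    BSpace d q k m e ⊆ SSpace d q k m e := by
  rintro μ ⟨a, ha, hlim⟩
  obtain ⟨C, hC, hCt⟩ := exists_between hlim
  have hev := eventually_lt_of_limsup_lt hC
  set b := (1 + a) / 2 with hb
  have hb1 : 1 < b := by rw [hb]; linarith
  have hba : b ≤ a := by rw [hb]; linarith
  have hm0 : (0 : ℝ) < 2 * m := by positivity
  -- the radii: `L_a (R n) ≥ 2 ^ (2 m n)` while `2 ^ (-2 m n) R n` is summable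
  set R : ℕ → ℝ := fun n => 2 ^ (2 * m * n) * (n : ℝ) ^ (-b) with hR
  have hlog : ∀ᶠ n : ℕ in atTop, (n : ℝ) ≤ Real.log (R n) ∧ 1 ≤ n := by
    have h1 : ∀ᶠ n : ℕ in atTop, ‖Real.log (n : ℝ)‖ ≤ (1 / (4 * b)) * ‖(n : ℝ)‖ :=
      (Real.isLittleO_log_id_atTop.comp_tendsto tendsto_natCast_atTop_atTop).bound (by positivity)
    filter_upwards [h1, eventually_ge_atTop 1] with n hn hn1
    refine ⟨?_, hn1⟩
    have hn0 : (0 : ℝ) < n := by exact_mod_cast hn1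
    have hlogn : 0 ≤ Real.log n := Real.log_nonneg (by exact_mod_cast hn1)
    rw [Real.norm_of_nonneg hlogn, Real.norm_of_nonneg hn0.le] at hn
    rw [hR, Real.log_mul (by positivity) (by positivity), Real.log_pow, Real.log_rpow hn0]
    have h2 : b * Real.log n ≤ (1 / 4) * n := by
      calc b * Real.log n ≤ b * ((1 / (4 * b)) * n) := by gcongr
        _ = (1 / 4) * n := by field_simp
    have h3 : (2 * n : ℝ) ≤ ((2 * m * n : ℕ) : ℝ) := by
      have : (2 * n : ℕ) ≤ 2 * m * n := by nlinarith
      exact_mod_cast this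
    have h4 := Real.log_two_gt_d9
    nlinarith
  have hRtop : Tendsto R atTop atTop := by
    refine tendsto_atTop_mono' atTop ?_ (tendsto_natCast_atTop_atTop)
    filter_upwards [hlog] with n hn
    have hn0 : (0 : ℝ) < n := by exact_mod_cast hn.2
    have hR0 : 0 < R n := by rw [hR]; positivity
    exact hn.1.trans (Real.log_le_self hR0.le)
  -- admissible approximations for all large `n`
  have hkey : ∀ᶠ n : ℕ in atTop, ∃ ν ∈ AC d,
      wSobNorm (2 * m + q) (2 * m) e (dens ν) ≤ ENNReal.ofReal (R n) ∧
      2 ^ (n * (q + k)) * ENNReal.ofReal (betaFn e (2 ^ (n * d))) * dk k μ ν ≤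
        ENNReal.ofReal (C.toReal * (n : ℝ) ^ (-b)) := by
    filter_upwards [hlog, hRtop.eventually hev] with n hn hn2
    obtain ⟨hlogn, hn1⟩ := hn
    have hn0 : (0 : ℝ) < n := by exact_mod_cast hn1
    have hR0 : 0 < R n := by rw [hR]; positivity
    set S : ℝ := 2 ^ (2 * m * n) with hS
    have hS0 : 0 < S := by positivity
    have hT : S ≤ La a (R n) := by
      rw [La]
      have h1 : (n : ℝ) ^ b ≤ Real.log (R n) ^ a :=
        (Real.rpow_le_rpow_of_exponent_le (by exact_mod_cast hn1) hba).trans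
          (Real.rpow_le_rpow hn0.le hlogn (by linarith))
      calc S = R n * (n : ℝ) ^ b := by
            simp only [hR, ← hS]
            rw [mul_assoc, ← Real.rpow_add hn0]; simp
        _ ≤ _ := by gcongr
    set T := La a (R n) with hTdef
    have hT0 : 0 < T := hS0.trans_le hT
    have hSpow : ∀ j : ℕ, S ^ ((j : ℝ) / (2 * m)) = 2 ^ (n * j) := by
      intro j
      rw [hS, ← Real.rpow_natCast, ← Real.rpow_mul (by norm_num), ← Real.rpow_natCast]
      congr 1
      push_cast
      field_simp
    have hcoef : 2 ^ (n * (q + k)) * betaFn e (2 ^ (n * d)) * (n : ℝ) ^ b ≤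
        T ^ (1 + ((k : ℝ) + q) / (2 * m)) * betaFn e (T ^ ((d : ℝ) / (2 * m))) / R n := by
      rw [le_div_iff₀ hR0]
      have h1 : S * 2 ^ (n * (q + k)) ≤ T ^ (1 + ((k : ℝ) + q) / (2 * m)) := by
        have h2 := hSpow (q + k)
        push_cast at h2
        rw [← h2, add_comm (q : ℝ), ← Real.rpow_one_add' hS0.le (by positivity)]
        exact Real.rpow_le_rpow hS0.le hT (by positivity)
      have h3 : betaFn e (2 ^ (n * d)) ≤ betaFn e (T ^ ((d : ℝ) / (2 * m))) := by
        rw [← hSpow d]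
        exact he.betaFn_mono (by positivity) (Real.rpow_le_rpow hS0.le hT (by positivity))
      have h4 : 0 < betaFn e (2 ^ (n * d)) := he.betaFn_pos (by positivity)
      calc 2 ^ (n * (q + k)) * betaFn e (2 ^ (n * d)) * (n : ℝ) ^ b * R n
          = (S * 2 ^ (n * (q + k))) * betaFn e (2 ^ (n * d)) := by
            have : S = R n * (n : ℝ) ^ b := by
              simp only [hR, ← hS]
              rw [mul_assoc, ← Real.rpow_add hn0]; simp
            rw [this]; ring
        _ ≤ _ := by gcongr
    have hβ0 : 0 < betaFn e (2 ^ (n * d)) := he.betaFn_pos (by positivity)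
    have hlt : ENNReal.ofReal (2 ^ (n * (q + k)) * betaFn e (2 ^ (n * d)) * (n : ℝ) ^ b) *
        dkSet k μ (MSet d m q e (R n)) < C :=
      lt_of_le_of_lt (by gcongr) hn2
    have hne : ENNReal.ofReal (2 ^ (n * (q + k)) * betaFn e (2 ^ (n * d)) * (n : ℝ) ^ b) ≠ 0 := by
      simp only [ne_eq, ENNReal.ofReal_eq_zero, not_le]; positivity
    rw [mul_comm, ← ENNReal.lt_div_iff_mul_lt (Or.inl hne) (Or.inl ENNReal.ofReal_ne_top), dkSet] at hlt
    simp only [iInf_lt_iff] at hlt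
    obtain ⟨ν, hν, hlt⟩ := hlt
    rw [ENNReal.lt_div_iff_mul_lt (Or.inl hne) (Or.inl ENNReal.ofReal_ne_top)] at hlt
    refine ⟨ν, hν.1, hν.2, ?_⟩
    rw [ENNReal.ofReal_mul (by positivity), ENNReal.ofReal_mul (by positivity),
      ENNReal.ofReal_pow (by norm_num), ENNReal.ofReal_ofNat] at hlt
    have hnb : ENNReal.ofReal ((n : ℝ) ^ b) * ENNReal.ofReal ((n : ℝ) ^ (-b)) = 1 := by
      rw [← ENNReal.ofReal_mul (by positivity), ← Real.rpow_add hn0]; simp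
    calc 2 ^ (n * (q + k)) * ENNReal.ofReal (betaFn e (2 ^ (n * d))) * dk k μ ν
        = (dk k μ ν * (2 ^ (n * (q + k)) * ENNReal.ofReal (betaFn e (2 ^ (n * d))) *
          ENNReal.ofReal ((n : ℝ) ^ b))) * ENNReal.ofReal ((n : ℝ) ^ (-b)) := by
          rw [← mul_one (2 ^ (n * (q + k)) * ENNReal.ofReal (betaFn e (2 ^ (n * d))) * dk k μ ν),
            ← hnb]
          ring
      _ ≤ C * ENNReal.ofReal ((n : ℝ) ^ (-b)) := by gcongr
      _ = _ := by rw [ENNReal.ofReal_mul ENNReal.toReal_nonneg, ENNReal.ofReal_toReal hCt.ne]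
  -- the finitely many remaining indices only need terms that are finite, for which `ν = 0` will do
  have hex : ∀ n : ℕ, ∃ ν ∈ AC d, wSobNorm (2 * m + q) (2 * m) e (dens ν) ≠ ⊤ ∧
      ((∃ ν ∈ AC d, wSobNorm (2 * m + q) (2 * m) e (dens ν) ≤ ENNReal.ofReal (R n) ∧
        2 ^ (n * (q + k)) * ENNReal.ofReal (betaFn e (2 ^ (n * d))) * dk k μ ν ≤
          ENNReal.ofReal (C.toReal * (n : ℝ) ^ (-b))) →
      wSobNorm (2 * m + q) (2 * m) e (dens ν) ≤ ENNReal.ofReal (R n) ∧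
      2 ^ (n * (q + k)) * ENNReal.ofReal (betaFn e (2 ^ (n * d))) * dk k μ ν ≤
        ENNReal.ofReal (C.toReal * (n : ℝ) ^ (-b))) := by
    intro n
    by_cases hP : ∃ ν ∈ AC d, wSobNorm (2 * m + q) (2 * m) e (dens ν) ≤ ENNReal.ofReal (R n) ∧
        2 ^ (n * (q + k)) * ENNReal.ofReal (betaFn e (2 ^ (n * d))) * dk k μ ν ≤
          ENNReal.ofReal (C.toReal * (n : ℝ) ^ (-b))
    · obtain ⟨ν, h1, h2, h3⟩ := hP
      exact ⟨ν, h1, (h2.trans_lt ENNReal.ofReal_lt_top).ne, fun _ => ⟨h2, h3⟩⟩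
    · refine ⟨0, ?_, ?_, fun h => absurd h hP⟩
      · have := withDensity_mem_AC (d := d) 0
        rwa [withDensityᵥ_zero] at this
      · rw [wSobNorm_dens_zero he]; exact ENNReal.zero_ne_top
  choose μs hAC hfin hgood using hex
  simp only [SSpace, rho, Set.mem_ofPred_eq, iInf_lt_iff]
  refine ⟨μs, hAC, ENNReal.add_lt_top.2 ⟨?_, ?_⟩⟩
  · refine tsum_lt_top_of_eventually_le (c := C.toReal) (fun n => ?_) hb1 ?_
    · refine ENNReal.mul_ne_top (ENNReal.mul_ne_top (ENNReal.pow_ne_top (by simp))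
        ENNReal.ofReal_ne_top) (dk_lt_top _ _ _).ne
    · filter_upwards [hkey] with n hn using (hgood n hn).2
  · refine tsum_lt_top_of_eventually_le (c := 1) (fun n => ?_) hb1 ?_
    · exact ENNReal.mul_ne_top (ENNReal.inv_ne_top.2 (by simp)) (hfin n)
    · filter_upwards [hkey] with n hn
      have h1 := (hgood n hn).1
      calc (2 ^ (2 * n * m))⁻¹ * wSobNorm (2 * m + q) (2 * m) e (dens (μs n))
          ≤ (2 ^ (2 * n * m))⁻¹ * ENNReal.ofReal (R n) := by gcongr
        _ = ENNReal.ofReal (1 * (n : ℝ) ^ (-b)) := by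
          rw [hR, ENNReal.ofReal_mul (by positivity), ENNReal.ofReal_pow (by norm_num),
            ENNReal.ofReal_ofNat, ← mul_assoc, show 2 * m * n = 2 * n * m by ring,
            ENNReal.inv_mul_cancel (by simp) (by simp), one_mul, one_mul]

end BalanceSum


/-! ### Polynomial weights -/

section Weights

variable {d : ℕ}

theorem norm_le_sum_abs (x : Eucl d) : ‖x‖ ≤ ∑ i, |x i| := by
  have h := (EuclideanSpace.basisFun (Fin d) ℝ).sum_repr x
  conv_lhs => rw [← h]
  refine (norm_sum_le _ _).trans (Finset.sum_le_sum fun i _ => ?_)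
  rw [norm_smul, OrthonormalBasis.norm_eq_one, mul_one]
  simp

theorem one_add_norm_pow_le {l : ℕ} (hl : l ≠ 0) (x : Eucl d) :
    (1 + ‖x‖) ^ l ≤ (d + 1) ^ (l - 1) * (1 + ∑ i, |x i ^ l|) := by
  obtain ⟨n, rfl⟩ := Nat.exists_eq_succ_of_ne_zero hl
  have h := pow_sum_div_card_le_sum_pow (s := (Finset.univ : Finset (Option (Fin d))))
    (f := fun o => o.elim 1 fun i => |x i|) (by rintro (_ | i) - <;> simp) n
  rw [Fintype.sum_option, Fintype.sum_option, div_le_iff₀ (by simp; positivity)] at h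
  simp only [Option.elim_none, Option.elim_some, one_pow, Finset.card_univ, Fintype.card_option,
    Fintype.card_fin, Nat.cast_add, Nat.cast_one] at h
  calc (1 + ‖x‖) ^ (n + 1) ≤ (1 + ∑ i, |x i|) ^ (n + 1) := by
        gcongr
        exact norm_le_sum_abs x
    _ ≤ _ := by
        simp only [abs_pow, Nat.succ_eq_add_one, Nat.add_sub_cancel]
        linarith

theorem abs_monom_le {γ : Fin d → ℕ} {l : ℕ} (hγ : ∑ i, γ i ≤ l) (x : Eucl d) :
    |monom γ x| ≤ (1 + ‖x‖) ^ l := by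
  rw [monom, Finset.abs_prod]
  calc ∏ i, |x i ^ γ i| ≤ ∏ i, (1 + ‖x‖) ^ γ i := by
        refine Finset.prod_le_prod (fun i _ => abs_nonneg _) fun i _ => ?_
        rw [abs_pow]
        gcongr
        linarith [abs_apply_le_norm x i]
    _ = (1 + ‖x‖) ^ (∑ i, γ i) := Finset.prod_pow_eq_pow_sum _ _ _
    _ ≤ _ := pow_le_pow_right₀ (by linarith [norm_nonneg x]) hγ

theorem monom_single (i : Fin d) (l : ℕ) (x : Eucl d) : monom (Pi.single i l) x = x i ^ l := by
  rw [monom, Finset.prod_eq_single i]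
  · simp
  · intro j _ hj
    simp [Pi.single_eq_of_ne hj]
  · simp

theorem one_add_norm_pow_le_of_norm_sub {x y : Eucl d} {r : ℝ} (hr : 0 ≤ r) (hy : ‖y‖ ≤ r) (l : ℕ) :
    (1 + ‖x‖) ^ l ≤ (1 + r) ^ l * (1 + ‖x - y‖) ^ l := by
  rw [← mul_pow]
  gcongr
  have := norm_sub_norm_le x y
  nlinarith [norm_nonneg (x - y)]

/-- The weighted norms with polynomial weights dominate the norm with the full weight
`(1 + ‖x‖) ^ l`; a measurable weak derivative is chosen. -/
theorem exists_weakDeriv_of_wSobNorm_lt_top {e : ℝ → ℝ} (he : IsYoung e) {f : Eucl d → ℝ}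
    {K l : ℕ} (hl : l ≠ 0) (hf : wSobNorm K l e f < ⊤) {α : Fin d → ℕ} (hα : ∑ i, α i ≤ K) :
    ∃ g : Eucl d → ℝ, Measurable g ∧ IsWeakDeriv α f g ∧
      luxNorm e (fun x => (1 + ‖x‖) ^ l * g x) < ⊤ := by
  have hfin : ∀ γ : Fin d → ℕ, ∑ i, γ i ≤ l → weakNorm γ α e f < ⊤ := fun γ hγ =>
    (weakNorm_le_wSobNorm e f hγ hα).trans_lt hf
  have h0 := hfin 0 (by simp)
  simp only [weakNorm, iInf_lt_iff] at h0
  obtain ⟨g', hg', -⟩ := h0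
  set g := hg'.2.1.aestronglyMeasurable.mk g' with hg
  have hgm : Measurable g := hg'.2.1.aestronglyMeasurable.stronglyMeasurable_mk.measurable
  have hgw : IsWeakDeriv α f g := hg'.congr EventuallyEq.rfl hg'.2.1.aestronglyMeasurable.ae_eq_mk
  refine ⟨g, hgm, hgw, ?_⟩
  have hlux : ∀ γ : Fin d → ℕ, ∑ i, γ i ≤ l → luxNorm e (fun x => monom γ x * g x) < ⊤ :=
    fun γ hγ => by rw [← hgw.weakNorm_eq]; exact hfin γ hγ
  have hP := isTransNorm_luxNorm he (d := d)
  have h1 : luxNorm e (fun x => |g x| + ∑ i, |x i ^ l * g x|) < ⊤ := by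
    refine (hP.add _ _ (continuous_abs.measurable.comp hgm)).trans_lt (ENNReal.add_lt_top.2 ⟨?_, ?_⟩)
    · refine (hP.mono _ (fun x => monom 0 x * g x) fun x => ?_).trans_lt (hlux 0 (by simp))
      simp [monom_zero]
    · refine (hP.sum_le _ fun i => ?_).trans_lt (ENNReal.sum_lt_top.2 fun i _ => ?_)
      · have : Measurable fun x : Eucl d => x i := by fun_prop
        exact continuous_abs.measurable.comp ((this.pow_const l).mul hgm)
      · refine (hP.mono _ (fun x => monom (Pi.single i l) x * g x) fun x => ?_).trans_lt
          (hlux _ (by simp))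
        rw [monom_single, abs_abs]
  refine (hP.mono _ (fun x => ((d : ℝ) + 1) ^ (l - 1) * (|g x| + ∑ i, |x i ^ l * g x|))
    fun x => ?_).trans_lt
    ((hP.smul _ _).trans_lt (ENNReal.mul_lt_top ENNReal.ofReal_lt_top h1))
  rw [abs_of_nonneg (a := _ * (|g x| + _)) (by positivity), abs_mul, abs_of_nonneg (by positivity)]
  refine (mul_le_mul_of_nonneg_right (one_add_norm_pow_le hl x) (abs_nonneg _)).trans (le_of_eq ?_)
  rw [mul_assoc, add_mul, one_mul, Finset.sum_mul]
  simp only [abs_mul]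

/-- A function with a high enough finite weighted moment in the Luxemburg norm is integrable. -/
theorem integrable_of_luxNorm_weight_lt_top {e : ℝ → ℝ} (he : IsYoung e) {g : Eucl d → ℝ}
    (hg : Measurable g) {l : ℕ} (hl : d < l)
    (h : luxNorm e (fun x => (1 + ‖x‖) ^ l * g x) < ⊤) : Integrable g := by
  refine ⟨hg.aestronglyMeasurable, ?_⟩
  have hw := finite_integral_one_add_norm (E := Eucl d) (μ := volume) (r := l)
    (by rw [finrank_euclideanSpace_fin]; exact_mod_cast hl)
  have hone : ∀ x : Eucl d, 1 ≤ 1 + ‖x‖ := fun x => by linarith [norm_nonneg x]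
  have key := lintegral_mul_le_luxNorm he (f := fun x => (1 + ‖x‖) ^ l * g x)
    (w := fun x : Eucl d => ENNReal.ofReal ((1 + ‖x‖) ^ (-(l : ℝ)))) (by fun_prop)
    (fun x => ENNReal.ofReal_le_one.2
      (Real.rpow_le_one_of_one_le_of_nonpos (hone x) (by simp))) hw.ne
  refine lt_of_le_of_lt (le_of_eq (lintegral_congr fun x => ?_)) (key.trans_lt
    (ENNReal.mul_lt_top (ENNReal.add_lt_top.2 ⟨hw, ENNReal.ofReal_lt_top⟩) h))
  have h0 : (0 : ℝ) < 1 + ‖x‖ := by linarith [hone x]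
  rw [enorm_mul, Real.enorm_eq_ofReal_abs ((1 + ‖x‖) ^ l), mul_right_comm, abs_of_pos (by positivity),
    ← ENNReal.ofReal_mul (by positivity), ← Real.rpow_natCast, ← Real.rpow_add h0]
  simp

/-- Minkowski's inequality for convolutions with weights: if `w x ≤ C W (x - y)` for all `y` in
the support of `χ`, then the `w`-weighted norm of `f * χ` is bounded by the `W`-weighted norm
of `f`. -/
theorem IsTransNorm.weighted_conv_le {P : (Eucl d → ℝ) → ℝ≥0∞} (hP : IsTransNorm P)
    {f χ w W : Eucl d → ℝ} (hf : Measurable f) (hfl : LocallyIntegrable f) (hχ : IsTest χ)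
    (hW : Continuous W) (hW0 : ∀ x, 0 ≤ W x) {C : ℝ} (hC : 0 ≤ C)
    (hw : ∀ x y, χ y ≠ 0 → |w x| ≤ C * W (x - y)) :
    P (fun x => w x * conv f χ x) ≤
      ENNReal.ofReal C * ((∫⁻ x, ‖χ x‖ₑ) * P (fun x => W x * f x)) := by
  set ρ : Measure (Eucl d) := volume.withDensity fun y => ‖χ y‖ₑ with hρ
  have hu : ρ Set.univ = ∫⁻ x, ‖χ x‖ₑ := by
    rw [hρ, withDensity_apply _ MeasurableSet.univ, Measure.restrict_univ]
  have : IsFiniteMeasure ρ := ⟨by rw [hu]; exact hχ.integrable.2⟩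
  have hWf : LocallyIntegrable fun x => W x * f x := hfl.continuous_mul hW
  have hmeas : Measurable fun x => |W x * f x| :=
    continuous_abs.measurable.comp (hW.measurable.mul hf)
  refine (hP.mono _ (fun x => C * ∫ y, |W (x - y) * f (x - y)| ∂ρ) fun x => ?_).trans
    ((hP.smul _ _).trans ?_)
  · rw [abs_of_nonneg (mul_nonneg hC (integral_nonneg fun y => abs_nonneg _)), hρ,
      integral_withDensity_eq_integral_toReal_smul hχ.continuous.measurable.enorm
        (Eventually.of_forall fun _ => enorm_lt_top), ← integral_const_mul, conv_comm, conv_apply,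
      ← integral_const_mul]
    refine abs_integral_le_integral_abs.trans ?_
    have i1 := (integrable_conv_integrand hfl hχ.continuous hχ.compact x).comp_sub_left x
    have i2 := ((integrable_conv_integrand hWf hχ.continuous hχ.compact x).comp_sub_left x).abs
    simp only [sub_sub_cancel] at i1 i2
    refine integral_mono ?_ ?_ fun y => ?_
    · refine (i1.const_mul (w x)).abs.congr (Eventually.of_forall fun y => ?_)
      simp only [mul_comm (χ y)]
    · refine (i2.const_mul C).congr (Eventually.of_forall fun y => ?_)
      simp [abs_mul, mul_comm]
    · simp only [toReal_enorm, smul_eq_mul, Real.norm_eq_abs, abs_mul]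
      rcases eq_or_ne (χ y) 0 with h0 | h0
      · simp [h0]
      · rw [abs_of_nonneg (hW0 _)]
        calc |w x| * (|χ y| * |f (x - y)|) ≤ (C * W (x - y)) * (|χ y| * |f (x - y)|) := by
              gcongr
              exact hw x y h0
          _ = _ := by ring
  · rw [abs_of_nonneg hC]
    gcongr
    refine (hP.avg ρ (fun x => |W x * f x|) hmeas).trans ?_
    rw [hu]
    gcongr
    exact hP.mono _ _ fun x => by simp

theorem exists_add_eq_of_sum_le {K j : ℕ} {α : Fin d → ℕ} (hα : ∑ i, α i ≤ K + j) :
    ∃ α' α'' : Fin d → ℕ, α = α'' + α' ∧ ∑ i, α' i ≤ K ∧ ∑ i, α'' i ≤ j := by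
  induction j generalizing α with
  | zero => exact ⟨α, 0, by simp, by simpa using hα, by simp⟩
  | succ j ih =>
    rcases Nat.lt_or_ge (K + j) (∑ i, α i) with h | h
    · obtain ⟨i, -, hi⟩ := Finset.exists_ne_zero_of_sum_ne_zero (by omega : ∑ i, α i ≠ 0)
      have hα' : α = (α - Pi.single i 1) + Pi.single i 1 := by
        refine (tsub_add_cancel_of_le fun j => ?_).symm
        rcases eq_or_ne j i with rfl | hj
        · simpa using Nat.one_le_iff_ne_zero.2 hi
        · simp [Pi.single_eq_of_ne hj]
      have hsum : ∑ j, α j = ∑ j, (α - Pi.single i 1 : Fin d → ℕ) j + 1 := by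
        conv_lhs => rw [hα']
        simp [Finset.sum_add_distrib]
      obtain ⟨α', α'', h1, h2, h3⟩ := ih (α := α - Pi.single i 1) (by omega)
      refine ⟨α', α'' + Pi.single i 1, ?_, h2, ?_⟩
      · rw [hα', h1]; abel
      · simpa [Finset.sum_add_distrib] using h3
    · obtain ⟨α', α'', h1, h2, h3⟩ := ih h
      exact ⟨α', α'', h1, h2, h3.trans (Nat.le_succ j)⟩

/-- Mollification at scale `δ` of a function with derivatives up to order `K` yields derivatives up
to order `K + j` of size `δ ^ (-j)`. -/
theorem exists_wSobNorm_conv_dil_le {e : ℝ → ℝ} (he : IsYoung e) {f ψ : Eucl d → ℝ} {K l : ℕ}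
    (hl : l ≠ 0) (hf : wSobNorm K l e f < ⊤) (hψ : IsTest ψ) (j : ℕ) :
    ∃ C : ℝ, 0 < C ∧ ∀ δ : ℝ, 0 < δ → δ ≤ 1 →
      wSobNorm (K + j) l e (conv f (dil δ ψ)) ≤ ENNReal.ofReal (C * δ⁻¹ ^ j) := by
  have hfl : LocallyIntegrable f := by
    obtain ⟨g, -, hg, -⟩ := exists_weakDeriv_of_wSobNorm_lt_top he hl hf (α := 0) (by simp)
    exact hg.1
  have hsplit : ∀ α ∈ multiIdx d (K + j), ∃ α' α'' : Fin d → ℕ, α = α'' + α' ∧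
      ∑ i, α' i ≤ K ∧ ∑ i, α'' i ≤ j := fun α hα => exists_add_eq_of_sum_le (mem_multiIdx.1 hα)
  obtain ⟨B, r, hB0, hr0, hBr⟩ := exists_mderiv_bound hψ j
  -- a bound for each pair of multi-indices
  have hone : ∀ γ ∈ multiIdx d l, ∀ α ∈ multiIdx d (K + j), ∃ c : ℝ, 0 ≤ c ∧
      ∀ δ : ℝ, 0 < δ → δ ≤ 1 →
        weakNorm γ α e (conv f (dil δ ψ)) ≤ ENNReal.ofReal (c * δ⁻¹ ^ j) := by
    intro γ hγ α hα
    obtain ⟨α', α'', rfl, hα', hα''⟩ := hsplit α hα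
    obtain ⟨g, hgm, hg, hgfin⟩ := exists_weakDeriv_of_wSobNorm_lt_top he hl hf hα'
    have hψ'' := hψ.mderiv α''
    have hI : ∫⁻ x, ‖mderiv α'' ψ x‖ₑ ≠ ⊤ := hψ''.integrable.2.ne
    set c : ℝ≥0∞ := ENNReal.ofReal ((1 + r) ^ l) * ((∫⁻ x, ‖mderiv α'' ψ x‖ₑ) *
      luxNorm e (fun x => (1 + ‖x‖) ^ l * g x)) with hc
    have hct : c ≠ ⊤ := ENNReal.mul_ne_top ENNReal.ofReal_ne_top (ENNReal.mul_ne_top hI hgfin.ne)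
    refine ⟨c.toReal, ENNReal.toReal_nonneg, fun δ hδ hδ1 => ?_⟩
    have hδinv : 1 ≤ δ⁻¹ := (one_le_inv₀ hδ).2 hδ1
    -- `α'` derivatives fall on `f`, the remaining `α''` on the kernel
    have hder : mderiv (α'' + α') (conv f (dil δ ψ)) =
        fun x => δ⁻¹ ^ (∑ i, α'' i) * conv g (dil δ (mderiv α'' ψ)) x := by
      rw [mderiv_conv hfl (hψ.dil hδ), add_comm, mderiv_add (hψ.dil hδ).smooth,
        hg.conv_eq ((hψ.dil hδ).mderiv α''), mderiv_dil hψ.smooth]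
      funext x
      rw [conv_apply, conv_apply, ← integral_const_mul]
      exact integral_congr_ae (Eventually.of_forall fun t => by ring)
    rw [(isWeakDeriv_of_contDiff (contDiff_conv hfl (hψ.dil hδ)) _).weakNorm_eq, hder]
    have key := (isTransNorm_luxNorm he (d := d)).weighted_conv_le hgm hg.2.1 (hψ''.dil hδ)
      (w := monom γ) (W := fun x => (1 + ‖x‖) ^ l) (by fun_prop) (fun x => by positivity)
      (C := (1 + r) ^ l) (by positivity) (fun x y hy => by
        refine (abs_monom_le (mem_multiIdx.1 hγ) x).trans
          (one_add_norm_pow_le_of_norm_sub hr0.le ?_ l)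
        have h1 := (hBr α'' hα'' _).2 (right_ne_zero_of_mul hy)
        rw [norm_smul, Real.norm_of_nonneg (by positivity), inv_mul_le_iff₀ hδ] at h1
        exact h1.trans (mul_le_of_le_one_left hr0.le hδ1))
    rw [lintegral_dil hψ'' hδ, ← hc] at key
    have h2 : (fun x => monom γ x * (δ⁻¹ ^ (∑ i, α'' i) * conv g (dil δ (mderiv α'' ψ)) x)) =
        fun x => δ⁻¹ ^ (∑ i, α'' i) * (monom γ x * conv g (dil δ (mderiv α'' ψ)) x) := by
      funext x; ring
    rw [h2]
    refine (luxNorm_smul_le he _).trans ?_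
    rw [mul_comm c.toReal, ENNReal.ofReal_mul (by positivity), ENNReal.ofReal_toReal hct,
      abs_of_pos (by positivity)]
    gcongr
  choose! c hc0 hc using hone
  -- the summand `1` makes the constant positive
  refine ⟨1 + ∑ γ ∈ multiIdx d l, ∑ α ∈ multiIdx d (K + j), c γ α, ?_, fun δ hδ hδ1 => ?_⟩
  · have := Finset.sum_nonneg fun γ hγ => Finset.sum_nonneg fun α hα => hc0 γ hγ α hα
    linarith
  · calc wSobNorm (K + j) l e (conv f (dil δ ψ))
        ≤ ∑ γ ∈ multiIdx d l, ∑ α ∈ multiIdx d (K + j), ENNReal.ofReal (c γ α * δ⁻¹ ^ j) :=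
          Finset.sum_le_sum fun γ hγ => Finset.sum_le_sum fun α hα => hc γ hγ α hα δ hδ hδ1
      _ = ENNReal.ofReal ((∑ γ ∈ multiIdx d l, ∑ α ∈ multiIdx d (K + j), c γ α) * δ⁻¹ ^ j) := by
          rw [Finset.sum_mul, ENNReal.ofReal_sum_of_nonneg]
          · refine Finset.sum_congr rfl fun γ hγ => ?_
            rw [Finset.sum_mul, ENNReal.ofReal_sum_of_nonneg]
            exact fun α hα => mul_nonneg (hc0 γ hγ α hα) (by positivity)
          · exact fun γ hγ => mul_nonneg (Finset.sum_nonneg fun α hα => hc0 γ hγ α hα)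
              (by positivity)
      _ ≤ _ := by
          gcongr
          linarith

end Weights


/-! ### Mollification in the dual distance -/

section DualDistance

variable {d : ℕ}

theorem iSup_enorm_le_ofReal {Φ : Eucl d → ℝ} {b : ℝ} (hb : 0 ≤ b) :
    ⨆ x, ‖Φ x‖ₑ ≤ ENNReal.ofReal b ↔ ∀ x, |Φ x| ≤ b := by
  simp only [iSup_le_iff, Real.enorm_eq_ofReal_abs, ENNReal.ofReal_le_ofReal_iff hb]

theorem abs_conv_le {Φ χ : Eucl d → ℝ} {b : ℝ} (hΦ : Continuous Φ) (hb : ∀ x, |Φ x| ≤ b)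
    (hχ : IsTest χ) (x : Eucl d) : |conv Φ χ x| ≤ (∫⁻ x, ‖χ x‖ₑ).toReal * b := by
  have hb0 : 0 ≤ b := (abs_nonneg _).trans (hb 0)
  have h := isTransNorm_iSup.conv_le hΦ.measurable hχ
  have h2 := h.trans (mul_le_mul_right ((iSup_enorm_le_ofReal hb0).2 hb) _)
  rw [← ENNReal.ofReal_toReal hχ.integrable.2.ne, ← ENNReal.ofReal_mul ENNReal.toReal_nonneg] at h2
  exact (iSup_enorm_le_ofReal (mul_nonneg ENNReal.toReal_nonneg hb0)).1 h2 x

/-- Convolution with an even kernel is symmetric. -/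
theorem integral_mul_conv {f Φ χ : Eucl d → ℝ} (hf : Integrable f) (hΦ : Continuous Φ) {b : ℝ}
    (hb : ∀ x, |Φ x| ≤ b) (hχ : IsTest χ) (hχe : ∀ x, χ (-x) = χ x) :
    ∫ x, f x * conv Φ χ x = ∫ x, conv f χ x * Φ x := by
  have hint : Integrable (fun p : Eucl d × Eucl d => Φ p.1 * (f p.2 * χ (p.1 - p.2)))
      (volume.prod volume) :=
    (hf.convolution_integrand (ContinuousLinearMap.mul ℝ ℝ) hχ.integrable).bdd_mul
      (hΦ.comp continuous_fst).aestronglyMeasurable (Eventually.of_forall fun p => hb p.1)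
  calc ∫ x, f x * conv Φ χ x = ∫ t, ∫ x, Φ x * (f t * χ (x - t)) := by
        refine integral_congr_ae (Eventually.of_forall fun t => ?_)
        simp only [conv_apply]
        rw [← integral_const_mul]
        refine integral_congr_ae (Eventually.of_forall fun x => ?_)
        simp only
        rw [← hχe (x - t), neg_sub]
        ring
    _ = ∫ x, ∫ t, Φ x * (f t * χ (x - t)) := (integral_integral_swap hint).symm
    _ = _ := by
        refine integral_congr_ae (Eventually.of_forall fun x => ?_)
        simp only [conv_apply]
        rw [integral_const_mul, mul_comm]

theorem integrable_conv {f χ : Eucl d → ℝ} (hf : Integrable f) (hχ : IsTest χ) :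
    Integrable (conv f χ) := hf.integrable_convolution (ContinuousLinearMap.mul ℝ ℝ) hχ.integrable

theorem integrable_mul_of_bound {f Φ : Eucl d → ℝ} (hf : Integrable f) (hΦ : Continuous Φ) {b : ℝ}
    (hb : ∀ x, |Φ x| ≤ b) : Integrable fun x => f x * Φ x := by
  simpa only [mul_comm] using hf.bdd_mul hΦ.aestronglyMeasurable (Eventually.of_forall hb)

theorem dil_moll_neg {δ : ℝ} (x : Eucl d) : dil δ (moll d 0) (-x) = dil δ (moll d 0) x := by
  simp only [dil, smul_neg, moll_neg]

/-- Residuals of mollification, paired with an integrable function having integrable weak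
derivatives up to order `n`, are of order `δ ^ n`. -/
theorem abs_integral_mul_resid_le {f Φ : Eucl d → ℝ} {n : ℕ} {B : ℝ≥0∞} (hf : Integrable f)
    (hB : ∀ β : Fin d → ℕ, ∑ i, β i ≤ n → ∃ g, IsWeakDeriv β f g ∧ ∫⁻ x, ‖g x‖ₑ ≤ B)
    (hΦ : ContDiff ℝ ∞ Φ) {b : ℝ} (hb : ∀ x, |Φ x| ≤ b) {δ : ℝ} (hδ : 0 < δ) :
    ENNReal.ofReal |∫ x, f x * (resid (dil δ (moll d 0)))^[n] Φ x| ≤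
      (ENNReal.ofReal δ * d) ^ n * B * ENNReal.ofReal b := by
  have hb0 : 0 ≤ b := (abs_nonneg _).trans (hb 0)
  have hφ : IsTest (dil δ (moll d 0)) := (isTest_moll 0).dil hδ
  set φ := dil δ (moll d 0) with hφd
  have hK : IsTest (kern φ n) := isTest_kern hφ n
  have hfl := hf.locallyIntegrable
  set h : Eucl d → ℝ := fun x => f x - conv f (kern φ n) x with hh
  have hhi : Integrable h := hf.sub (integrable_conv hf hK)
  have h1 : ∫ x, f x * (resid φ)^[n] Φ x = ∫ x, h x * Φ x := by
    rw [← sub_conv_kern hφ hΦ.continuous.locallyIntegrable]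
    have i1 := integrable_mul_of_bound hf hΦ.continuous hb
    have i2 := integrable_mul_of_bound hf (contDiff_conv hΦ.continuous.locallyIntegrable hK).continuous
      (abs_conv_le hΦ.continuous hb hK)
    have i3 := integrable_mul_of_bound (integrable_conv hf hK) hΦ.continuous hb
    simp only [mul_sub, hh, sub_mul]
    rw [integral_sub i1 i2, integral_sub i1 i3,
      integral_mul_conv hf hΦ.continuous hb hK (kern_even dil_moll_neg n)]
  -- the weak derivatives are classical after a further mollification, removed in the limit
  have hlim : Tendsto (fun j => ∫ x, h x * conv Φ (moll d j) x) atTop (𝓝 (∫ x, h x * Φ x)) := by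
    refine tendsto_integral_of_dominated_convergence (fun x => |h x| * b) (fun j => ?_)
      (hhi.abs.mul_const b) (fun j => Eventually.of_forall fun x => ?_)
      (Eventually.of_forall fun x => (tendsto_conv_moll hΦ.continuous x).const_mul _)
    · exact hhi.aestronglyMeasurable.mul (contDiff_conv hΦ.continuous.locallyIntegrable
        (isTest_moll j)).continuous.aestronglyMeasurable
    · rw [Real.norm_eq_abs, abs_mul]
      have := abs_conv_le hΦ.continuous hb (isTest_moll j) x
      rw [lintegral_moll, ENNReal.toReal_one, one_mul] at this
      gcongr
  rw [h1]
  have hlim2 := (ENNReal.continuous_ofReal.tendsto _).comp hlim.abs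
  refine le_of_tendsto' hlim2 fun j => ?_
  have hmj := isTest_moll (d := d) j
  have hcm : conv h (moll d j) = (resid φ)^[n] (conv f (moll d j)) := by
    rw [hh, conv_sub_left hfl (contDiff_conv hfl hK).continuous.locallyIntegrable hmj,
      ← sub_conv_kern hφ (contDiff_conv hfl hmj).continuous.locallyIntegrable,
      conv_assoc hfl hK hmj, conv_comm (kern φ n), ← conv_assoc hfl hmj hK]
  have hbd : ∫⁻ x, ‖conv h (moll d j) x‖ₑ ≤ (ENNReal.ofReal δ * d) ^ n * B := by
    have := isTransNorm_lintegral.resid_dil_moll_le (contDiff_conv hfl hmj) hδ (n := n) (B := B)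
      (fun β hβ => ?_) n 0 (by simp)
    · rwa [mderiv_zero, ← hφd, ← hcm] at this
    · obtain ⟨g, hg, hgB⟩ := hB β hβ
      rw [mderiv_conv hfl hmj, hg.conv_eq hmj]
      refine (lintegral_conv_le hg.2.1.aestronglyMeasurable hmj).trans ?_
      rwa [lintegral_moll, one_mul]
  simp only [Function.comp_apply]
  rw [integral_mul_conv hhi hΦ.continuous hb hmj (moll_neg j), ← Real.enorm_eq_ofReal_abs]
  refine (enorm_integral_le_lintegral_enorm _).trans ?_
  calc ∫⁻ x, ‖conv h (moll d j) x * Φ x‖ₑ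
      ≤ ∫⁻ x, ‖conv h (moll d j) x‖ₑ * ENNReal.ofReal b := by
        refine lintegral_mono fun x => ?_
        rw [enorm_mul, Real.enorm_eq_ofReal_abs (Φ x)]
        gcongr
        exact hb x
    _ = (∫⁻ x, ‖conv h (moll d j) x‖ₑ) * ENNReal.ofReal b :=
        lintegral_mul_const' _ _ ENNReal.ofReal_ne_top
    _ ≤ _ := by gcongr

/-- The order of approximation in `d_k` is the number of derivatives of `f` plus `k`: of the
`n + k` differences in the residual, `k` fall on the test function and `n` on `f`. -/
theorem dk_conv_kern_le {f : Eucl d → ℝ} {n : ℕ} (k : ℕ) {B : ℝ≥0∞} (hf : Integrable f)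
    (hB : ∀ β : Fin d → ℕ, ∑ i, β i ≤ n → ∃ g, IsWeakDeriv β f g ∧ ∫⁻ x, ‖g x‖ₑ ≤ B)
    {δ : ℝ} (hδ : 0 < δ) :
    dk k (volume.withDensityᵥ f)
      (volume.withDensityᵥ (conv f (dil δ (kern (moll d 0) (n + k))))) ≤
      (ENNReal.ofReal δ * d) ^ n * B * (ENNReal.ofReal δ * d) ^ k := by
  refine iSup_le fun φ => iSup_le fun hφ => iSup_le fun hcφ => ?_
  change ENNReal.ofReal |spair _ φ - spair _ φ| ≤ _
  have hφ1 := abs_le_one_of_cNorm_le hcφ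
  have hψ : IsTest (dil δ (moll d 0)) := (isTest_moll 0).dil hδ
  rw [← kern_dil _ hδ]
  set ψ := dil δ (moll d 0) with hψd
  have hK : IsTest (kern ψ (n + k)) := isTest_kern hψ _
  have hφk : ∀ β : Fin d → ℕ, ∑ i, β i ≤ k → ⨆ x, ‖mderiv β φ x‖ₑ ≤ 1 := fun β hβ =>
    (Finset.single_le_sum (f := fun β => ⨆ x, ‖mderiv β φ x‖ₑ) (fun _ _ => zero_le)
      (mem_multiIdx.2 hβ)).trans hcφ
  have hΦb := isTransNorm_iSup.resid_dil_moll_le hφ hδ hφk k 0 (by simp)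
  rw [mderiv_zero, mul_one, ← ENNReal.ofReal_natCast, ← ENNReal.ofReal_mul hδ.le,
    ← ENNReal.ofReal_pow (by positivity), iSup_enorm_le_ofReal (by positivity), ← hψd] at hΦb
  have key := abs_integral_mul_resid_le hf hB (contDiff_resid_iterate hψ hφ k) hΦb hδ
  rw [ENNReal.ofReal_pow (by positivity), ENNReal.ofReal_mul hδ.le, ENNReal.ofReal_natCast] at key
  refine le_trans (le_of_eq ?_) key
  have i1 := integrable_mul_of_bound hf hφ.continuous hφ1
  have i2 := integrable_mul_of_bound hf
    (contDiff_conv hφ.continuous.locallyIntegrable hK).continuous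
    (abs_conv_le hφ.continuous hφ1 hK)
  rw [spair_withDensity hf hφ.continuous hφ1,
    spair_withDensity (integrable_conv hf hK) hφ.continuous hφ1,
    ← integral_mul_conv hf hφ.continuous hφ1 hK (kern_even dil_moll_neg _), ← integral_sub i1 i2,
    ← hψd, ← Function.iterate_add_apply, ← sub_conv_kern hψ hφ.continuous.locallyIntegrable]
  simp only [mul_sub]

end DualDistance


/-! ### The balance hypothesis for weighted Sobolev functions -/

section SobolevBalance

variable {d : ℕ}

/-- Up to an arbitrarily small loss in the exponent, `β_e(R)` is at most `R ^ α`. -/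
theorem IsYoungOfOrder.exists_betaFn_le {α γ : ℝ} {e : ℝ → ℝ} (he : IsYoungOfOrder α γ e) {ε : ℝ}
    (hε : 0 < ε) : ∃ C : ℝ, 0 < C ∧ ∀ᶠ x : ℝ in atTop, betaFn e x ≤ C * x ^ (α + ε) := by
  obtain ⟨c, hc, hct⟩ := exists_between he.limsup_lt_top
  have hev := eventually_lt_of_limsup_lt hc
  refine ⟨c.toReal + 1, by positivity, ?_⟩
  filter_upwards [hev, eventually_gt_atTop 1,
    (isLittleO_log_rpow_rpow_atTop γ hε).bound one_pos] with x hx hx1 hxl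
  have hx0 : 0 < x := by linarith
  have hlog : 0 < Real.log x := Real.log_pos hx1
  rw [Real.norm_of_nonneg (by positivity), Real.norm_of_nonneg (by positivity), one_mul] at hxl
  have hpos : 0 < x ^ α * Real.log x ^ γ := by positivity
  have h1 := (ENNReal.ofReal_le_iff_le_toReal hct.ne).1 hx.le
  rw [div_le_iff₀ hpos] at h1
  calc betaFn e x ≤ c.toReal * (x ^ α * Real.log x ^ γ) := h1
    _ ≤ (c.toReal + 1) * (x ^ α * x ^ ε) := by gcongr; linarith
    _ = _ := by rw [Real.rpow_add hx0]

theorem tendsto_La_atTop {a : ℝ} (ha : 0 ≤ a) : Tendsto (La a) atTop atTop := by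
  refine tendsto_atTop_mono' atTop ?_ tendsto_id
  filter_upwards [Real.tendsto_log_atTop.eventually_ge_atTop 1, eventually_ge_atTop 0] with R hR hR0
  exact le_mul_of_one_le_right hR0 (Real.one_le_rpow hR ha)

/-- The growth of the weight in the balance hypothesis, up to a loss in the exponent that absorbs
all logarithms. -/
theorem IsYoungOfOrder.exists_La_rpow_mul_betaFn_le {α γ : ℝ} {e : ℝ → ℝ}
    (he : IsYoungOfOrder α γ e) (hα : 0 ≤ α) {a p t σ : ℝ} (ha : 0 ≤ a) (hp : 0 ≤ p) (ht : 0 < t)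
    (hσ : p + t * α < σ) :
    ∃ C : ℝ, 0 < C ∧ ∀ᶠ R : ℝ in atTop, La a R ^ p * betaFn e (La a R ^ t) ≤ C * R ^ σ := by
  have hA : 0 ≤ p + t * α := by positivity
  -- half of the room in the exponent is spent on the logarithms in `β_e`, the rest on those in `L_a`
  set ε := (σ - (p + t * α)) / (2 * t) with hε
  have hε0 : 0 < ε := div_pos (by linarith) (by linarith)
  obtain ⟨C, hC0, hC⟩ := he.exists_betaFn_le hε0
  set A := p + t * (α + ε) with hAdef
  have hAeq : A = (σ + (p + t * α)) / 2 := by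
    rw [hAdef, hε]; field_simp; ring
  have hA0 : 0 < A := by rw [hAeq]; linarith
  have hAσ : 0 < σ / A - 1 := by
    rw [sub_pos, lt_div_iff₀ hA0, hAeq]; linarith
  have hLt := tendsto_La_atTop ha
  refine ⟨C, hC0, ?_⟩
  filter_upwards [((tendsto_rpow_atTop ht).comp hLt).eventually hC, hLt.eventually_gt_atTop 0,
    eventually_gt_atTop 1, (isLittleO_log_rpow_rpow_atTop a hAσ).bound one_pos] with R hR hL hR1 hRl
  have hR0 : 0 < R := by linarith
  have hlog : 0 < Real.log R := Real.log_pos hR1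
  rw [Real.norm_of_nonneg (by positivity), Real.norm_of_nonneg (by positivity), one_mul] at hRl
  have hLR : La a R ≤ R ^ (σ / A) := by
    calc La a R ≤ R * R ^ (σ / A - 1) := by unfold La; gcongr
      _ = _ := by rw [← Real.rpow_one_add' hR0.le (add_pos one_pos hAσ).ne']; ring_nf
  simp only [Function.comp_apply] at hR
  calc La a R ^ p * betaFn e (La a R ^ t) ≤ La a R ^ p * (C * (La a R ^ t) ^ (α + ε)) := by gcongr
    _ = C * La a R ^ A := by
        rw [hAdef, Real.rpow_add hL, Real.rpow_mul hL.le]; ring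
    _ ≤ C * (R ^ (σ / A)) ^ A := by gcongr
    _ = _ := by rw [← Real.rpow_mul hR0.le, div_mul_cancel₀ _ hA0.ne']

/-- Approximation of weighted Sobolev functions by smoother ones: a bound `R` on the weighted norm
of order `2m + q` allows an error of order `R ^ (-(q + 1 + k) / (2m - 1))` in `d_k`. -/
theorem exists_dkSet_le {e : ℝ → ℝ} (he : IsYoung e) {q m : ℕ} (k : ℕ) (hm : 1 ≤ m)
    (hd : d < 2 * m) {f : Eucl d → ℝ} (hf : f ∈ WSobSpace d (q + 1) (2 * m) e) :
    Integrable f ∧ ∃ C : ℝ, 0 < C ∧ ∀ᶠ R : ℝ in atTop,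
      dkSet k (volume.withDensityᵥ f) (MSet d m q e R) ≤
        ENNReal.ofReal (C * R ^ (-((q + 1 + k : ℝ) / (2 * m - 1)))) := by
  have hl : 2 * m ≠ 0 := by omega
  have hfin : wSobNorm (q + 1) (2 * m) e f < ⊤ := hf
  have hweak : ∀ β : Fin d → ℕ, ∑ i, β i ≤ q + 1 → ∃ g, IsWeakDeriv β f g ∧ Integrable g :=
    fun β hβ => by
      obtain ⟨g, hgm, hg, hgf⟩ := exists_weakDeriv_of_wSobNorm_lt_top he hl hfin hβ
      exact ⟨g, hg, integrable_of_luxNorm_weight_lt_top he hgm hd hgf⟩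
  have hfi : Integrable f := by
    obtain ⟨g, hg, hgi⟩ := hweak 0 (by simp)
    refine hgi.congr (hg.ae_unique ⟨hg.1, hg.1, fun φ _ _ => ?_⟩)
    simp [mderiv_zero]
  refine ⟨hfi, ?_⟩
  choose! g hg hgi using hweak
  set b : ℝ := 1 + ∑ β ∈ multiIdx d (q + 1), (∫⁻ x, ‖g β x‖ₑ).toReal with hb
  have hb0 : 0 < b := by
    have : 0 ≤ ∑ β ∈ multiIdx d (q + 1), (∫⁻ x, ‖g β x‖ₑ).toReal :=
      Finset.sum_nonneg fun _ _ => ENNReal.toReal_nonneg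
    linarith
  have hB : ∀ β : Fin d → ℕ, ∑ i, β i ≤ q + 1 →
      ∃ g, IsWeakDeriv β f g ∧ ∫⁻ x, ‖g x‖ₑ ≤ ENNReal.ofReal b := fun β hβ => by
    refine ⟨g β, hg β hβ, (ENNReal.le_ofReal_iff_toReal_le (hgi β hβ).2.ne hb0.le).2 ?_⟩
    have := Finset.single_le_sum (f := fun β => (∫⁻ x, ‖g β x‖ₑ).toReal)
      (fun _ _ => ENNReal.toReal_nonneg) (mem_multiIdx.2 hβ)
    linarith
  set ψ := kern (moll d 0) (q + 1 + k) with hψ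
  have hψt : IsTest ψ := isTest_kern (isTest_moll 0) _
  obtain ⟨C₁, hC₁, hSob⟩ := exists_wSobNorm_conv_dil_le he hl hfin hψt (2 * m - 1)
  rw [show q + 1 + (2 * m - 1) = 2 * m + q by omega] at hSob
  have hcast : ((2 * m - 1 : ℕ) : ℝ) = 2 * m - 1 := by
    rw [Nat.cast_sub (by omega)]; push_cast; ring
  have hj0 : (0 : ℝ) < 2 * m - 1 := by
    have : (1 : ℝ) ≤ m := by exact_mod_cast hm
    linarith
  set s : ℝ := (q + 1 + k : ℝ) / (2 * m - 1) with hs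
  refine ⟨(d + 1) ^ (q + 1 + k) * b * C₁ ^ s, by positivity, ?_⟩
  filter_upwards [eventually_ge_atTop C₁, eventually_gt_atTop 0] with R hRC hR0
  -- the scale at which the weighted norm of the mollification reaches `R`
  set δ : ℝ := (C₁ / R) ^ (1 / (2 * m - 1 : ℝ)) with hδ
  have hδ0 : 0 < δ := by positivity
  have hδ1 : δ ≤ 1 := Real.rpow_le_one (by positivity) ((div_le_one hR0).2 hRC) (by positivity)
  have hδj : δ ^ (2 * m - 1) = C₁ / R := by
    rw [hδ, ← Real.rpow_natCast, ← Real.rpow_mul (by positivity), hcast,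
      one_div_mul_cancel hj0.ne', Real.rpow_one]
  have hδN : δ ^ (q + 1 + k) = C₁ ^ s * R ^ (-s) := by
    rw [hδ, ← Real.rpow_natCast, ← Real.rpow_mul (by positivity), Real.rpow_neg hR0.le,
      ← div_eq_mul_inv, ← Real.div_rpow hC₁.le hR0.le, hs]
    congr 1
    push_cast
    ring
  have hFi : Integrable (conv f (dil δ ψ)) := integrable_conv hfi (hψt.dil hδ0)
  have hmem : volume.withDensityᵥ (conv f (dil δ ψ)) ∈ MSet d m q e R := by
    refine ⟨withDensity_mem_AC _, ?_⟩
    rw [wSobNorm_congr (dens_withDensity hFi)]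
    refine (hSob δ hδ0 hδ1).trans (le_of_eq ?_)
    rw [inv_pow, hδj, inv_div, mul_div_cancel₀ _ hC₁.ne']
  refine (iInf₂_le _ hmem).trans ((dk_conv_kern_le k hfi hB hδ0).trans ?_)
  rw [← ENNReal.ofReal_natCast, ← ENNReal.ofReal_mul hδ0.le, ← ENNReal.ofReal_pow (by positivity),
    ← ENNReal.ofReal_pow (by positivity), ← ENNReal.ofReal_mul (by positivity),
    ← ENNReal.ofReal_mul (by positivity)]
  refine ENNReal.ofReal_le_ofReal ?_
  calc (δ * d) ^ (q + 1) * b * (δ * d) ^ k = d ^ (q + 1 + k) * b * δ ^ (q + 1 + k) := by ring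
    _ ≤ (d + 1) ^ (q + 1 + k) * b * δ ^ (q + 1 + k) := by gcongr; linarith
    _ = _ := by rw [hδN]; ring

/-- The decay of the distance beats the weight in the balance hypothesis: the bound on `α` says that
the exponent of the weight is less than `(q + 1 + k) / (2m - 1)`. -/
theorem withDensity_mem_BSpace {α γ : ℝ} {e : ℝ → ℝ} (he : IsYoungOfOrder α γ e) (hα : 0 ≤ α)
    {q k m : ℕ} (hd : 1 ≤ d) (hm : 1 ≤ m) (hdm : d < 2 * m)
    (hαlt : α < (2 * m + k + q : ℝ) / (d * (2 * m - 1)))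
    {f : Eucl d → ℝ} (hf : f ∈ WSobSpace d (q + 1) (2 * m) e) :
    Integrable f ∧ volume.withDensityᵥ f ∈ BSpace d q k m e := by
  obtain ⟨hfi, C, hC0, hC⟩ := exists_dkSet_le he.isYoung k hm hdm hf
  -- powers of logarithms are negligible, so any `a > 1` serves
  refine ⟨hfi, 2, one_lt_two, ?_⟩
  have hd0 : (0 : ℝ) < d := by exact_mod_cast hd
  have hm1 : (1 : ℝ) ≤ m := by exact_mod_cast hm
  have hm0 : (0 : ℝ) < 2 * m := by linarith
  have hj0 : (0 : ℝ) < 2 * m - 1 := by linarith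
  set s : ℝ := (q + 1 + k : ℝ) / (2 * m - 1) with hs
  -- the weight has exponent `1 + (k + q) / (2m) + dα / (2m)` before division by `R`
  have hexp : 1 + ((k : ℝ) + q) / (2 * m) + (d : ℝ) / (2 * m) * α < 1 + s := by
    have h1 : (d : ℝ) / (2 * m) * α <
        (d : ℝ) / (2 * m) * ((2 * m + k + q : ℝ) / (d * (2 * m - 1))) := by gcongr
    have h2 : ((k : ℝ) + q) / (2 * m) +
        (d : ℝ) / (2 * m) * ((2 * m + k + q : ℝ) / (d * (2 * m - 1))) = s := by
      rw [hs]; field_simp; ring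
    linarith
  obtain ⟨C', hC'0, hC'⟩ := he.exists_La_rpow_mul_betaFn_le hα (a := 2) (by norm_num)
    (p := 1 + ((k : ℝ) + q) / (2 * m)) (by positivity) (t := (d : ℝ) / (2 * m)) (by positivity) hexp
  refine lt_of_le_of_lt (limsup_le_of_le (a := ENNReal.ofReal (C' * C)) (h := ?_))
    ENNReal.ofReal_lt_top
  filter_upwards [hC, hC', eventually_gt_atTop 0] with R h1 h2 hR0
  calc _ ≤ ENNReal.ofReal (C' * R ^ (1 + s) / R) * ENNReal.ofReal (C * R ^ (-s)) := by gcongr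
    _ = ENNReal.ofReal (C' * C) := by
        rw [← ENNReal.ofReal_mul (by positivity), Real.rpow_add hR0, Real.rpow_one,
          Real.rpow_neg hR0.le]
        congr 1
        have : R ^ s ≠ 0 := (Real.rpow_pos_of_pos hR0 s).ne'
        field_simp

end SobolevBalance

end OrliczBalance

end

open OrliczBalance
theorem mainTheorem1 (d : ℕ) (hd : 1 ≤ d) (q k m : ℕ) (hm : 1 ≤ m) (e : ℝ → ℝ) :
    (IsYoung e →
      BSpace d q k m e ⊆ SSpace d q k m e ∧
      SSpace d q k m e ⊆ HasDensityIn (SobSpace d q e)) ∧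
    (∀ α γ : ℝ, 0 ≤ α → 0 ≤ γ → IsYoungOfOrder α γ e →
      α < (2 * m + k + q : ℝ) / (d * (2 * m - 1)) → (d : ℝ) / 2 < m →
      ∀ f ∈ WSobSpace d (q + 1) (2 * m) e,
        Integrable f volume ∧ volume.withDensityᵥ f ∈ BSpace d q k m e) := by
  refine ⟨fun he => ⟨BSpace_subset_SSpace he q k hm, SSpace_subset_hasDensityIn he q k hm⟩,
    fun α γ hα _ he hαlt hdm f hf => withDensity_mem_BSpace he hα hd hm ?_ hαlt hf⟩
  have : (d : ℝ) < 2 * m := by linarith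
  exact_mod_cast this
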